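/- Let $k$ be an algebraically closed field of characteristic $0$ and $\mathfrak g$ a finite-dimensional semisimple Lie algebra over $k$. Let $A$ be a finitely generated commutative unital $k$-algebra, $X=\operatorname{Spec}A$, and let $X_{\mathrm{rat}}$ be its set of rational points (identified with the $k$-algebra homomorphisms $A\to k$); for $x\in X_{\mathrm{rat}}$ let $\mathfrak m_x\subset A$ be the corresponding maximal ideal. Let $\Gamma$ be a finite group acting by automorphisms on $A$ (hence on $X$, by $(\gamma\cdot x)(f)=x(\gamma^{-1}\cdot f)$) and on $\mathfrak g$, and let $\mathfrak M=M(X,\mathfrak g)^\Gamma=(\mathfrak g\otimes A)^\Gamma$ be the Lie algebra of $\Gamma$-equivariant regular maps $X\to\mathfrak g$. Let $X_*$ be the set of finite subsets $\mathbf x\subseteq X_{\mathrm{rat}}$ whose distinct elements lie in distinct $\Gamma$-orbits. For $\mathbf x\in X_*$ and finite-dimensional $\mathfrak g$-modules $V_x$ ($x\in\mathbf x$), let $\bigotimes_{x\in\mathbf x}V_x$ be the evaluation representation of $\mathfrak M$ on which $\alpha\in\mathfrak M$ acts by $\sum_{x}1\otimes\cdots\otimes\alpha(x)\otimes\cdots\otimes1$.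 $\operatorname{Ext}^1_{\mathfrak M}(V,V')$ denotes the $k$-vector space of extensions $0\to V'\to U\to V\to0$ of $\mathfrak M$-modules, and the isomorphisms below are isomorphisms of $k$-vector spaces. **(A)** Suppose that $\Gamma$ is abelian and acts freely on $X_{\mathrm{rat}}$ (so all isotropy groups are trivial). Let $V,V'$ be irreducible finite-dimensional representations of $\mathfrak M$. Then there are $\mathbf x\in X_*$ and finite-dimensional $\mathfrak g$-modules $V_x,V'_x$ ($x\in\mathbf x$) such that $V\cong\bigotimes_{x\in\mathbf x}V_x$ and $V'\cong\bigotimes_{x\in\mathbf x}V'_x$. Moreover, for all such $\mathbf x$, $(V_x)$, $(V'_x)$: 1. If $V_x\not\cong V'_x$ for more than one $x\in\mathbf x$, then $\operatorname{Ext}^1_{\mathfrak M}(V,V')=0$. 2. If $V_{x_0}\not\cong V'_{x_0}$ for some $x_0\in\mathbf x$ and $V_x\cong V'_x$ for all $x\in\mathbf x\setminus\{x_0\}$, then $$\operatorname{Ext}^1_{\mathfrak M}(V,V')\cong\operatorname{Hom}_{\mathfrak g}(\mathfrak g,V_{x_0}^*\otimes V'_{x_0})\otimes(\mathfrak m_{x_0}/\mathfrak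 m_{x_0}^2)^*.$$ 3. If $V\cong V'$, then $$\operatorname{Ext}^1_{\mathfrak M}(V,V')\cong\bigoplus_{x\in\mathbf x}\operatorname{Hom}_{\mathfrak g}(\mathfrak g,V_x^*\otimes V'_x)\otimes(\mathfrak m_x/\mathfrak m_x^2)^*.$$ **(B)** (Multiloop algebras.) Let $n\ge0$ and $m_1,\dots,m_n\ge1$ be integers, let $\xi_i\in k$ be a primitive $m_i$-th root of unity, let $\Gamma=\mathbb Z/m_1\times\cdots\times\mathbb Z/m_n$ with standard generators $\gamma_1,\dots,\gamma_n$ act on $\mathfrak g$ by Lie algebra automorphisms and on $X=(k^\times)^n$ by $\gamma_i\cdot(z_1,\dots,z_n)=(z_1,\dots,\xi_iz_i,\dots,z_n)$, and let $\mathfrak M=M(X,\mathfrak g)^\Gamma$ be the corresponding multiloop algebra. Then for irreducible finite-dimensional representations $V,V'$ of $\mathfrak M$ all the assertions of (A) hold with $(\mathfrak m_x/\mathfrak m_x^2)^*$ replaced by $k^n$: both are evaluation representations $V\cong\bigotimes_{x\in\mathbf x}V_x$, $V'\cong\bigotimes_{x\in\mathbf x}V'_x$ for some $\mathbf x\in X_*$,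 and for all such presentations $\operatorname{Ext}^1_{\mathfrak M}(V,V')=0$ if $V_x\not\cong V'_x$ for more than one $x\in\mathbf x$; $\operatorname{Ext}^1_{\mathfrak M}(V,V')\cong\operatorname{Hom}_{\mathfrak g}(\mathfrak g,V_{x_0}^*\otimes V'_{x_0})\otimes k^n$ if they are non-isomorphic exactly at $x_0$; and $\operatorname{Ext}^1_{\mathfrak M}(V,V')\cong\bigoplus_{x\in\mathbf x}\operatorname{Hom}_{\mathfrak g}(\mathfrak g,V_x^*\otimes V'_x)\otimes k^n$ if $V\cong V'$. -/

import Mathlib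

open scoped TensorProduct DirectSum

universe u v w

/-! ### Finite-dimensional modules and extensions over a Lie algebra -/

/-- A finite-dimensional module over a Lie `k`-algebra `L`. -/
structure FDLieModule (k : Type u) (L : Type v) [Field k] [LieRing L] [LieAlgebra k L] where
  carrier : Type w
  [addCommGroup : AddCommGroup carrier]
  [module : Module k carrier]
  [lieRingModule : LieRingModule L carrier]
  [lieModule : LieModule k L carrier]
  [finite : Module.Finite k carrier]

namespace FDLieModule

variable {k : Type u} {L : Type v} [Field k] [LieRing L] [LieAlgebra k L]

instance : CoeSort (FDLieModule.{u, v, w} k L) (Type w) := ⟨carrier⟩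

attribute [instance] addCommGroup module lieRingModule lieModule finite

end FDLieModule

/-- An `L`-module regarded as a module over the universal enveloping algebra of `L`. -/
noncomputable def envelopingModule (k : Type u) (L : Type v) (V : Type w) [Field k] [LieRing L]
    [LieAlgebra k L] [AddCommGroup V] [Module k V] [LieRingModule L V] [LieModule k L V] :
    ModuleCat.{w} (UniversalEnvelopingAlgebra k L) :=
  letI : Module (UniversalEnvelopingAlgebra k L) V :=
    Module.compHom V
      (UniversalEnvelopingAlgebra.lift k (LieModule.toEnd k L V)).toRingHom
  ModuleCat.of (UniversalEnvelopingAlgebra k L) V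

/-- `Ext¹_L(V, V')`: the `k`-vector space of extensions `0 → V' → U → V → 0` of `L`-modules,
i.e. the first Yoneda `Ext` in the category of modules over the universal enveloping algebra. -/
abbrev LieExtOne (k : Type u) (L : Type u) (V V' : Type u) [Field k] [LieRing L] [LieAlgebra k L]
    [AddCommGroup V] [Module k V] [LieRingModule L V] [LieModule k L V]
    [AddCommGroup V'] [Module k V'] [LieRingModule L V'] [LieModule k L V'] : Type u :=
  CategoryTheory.Abelian.Ext (envelopingModule k L V) (envelopingModule k L V') 1

/-! ### Tensor products of representations -/

section TensorRep

attribute [local instance 100] LieRing.ofAssociativeRing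

variable {k : Type u} {L : Type v} [Field k] [LieRing L] [LieAlgebra k L]
  {ι : Type*} [DecidableEq ι] (W : ι → Type w) [∀ i, AddCommGroup (W i)] [∀ i, Module k (W i)]

/-- The operator `1 ⊗ ⋯ ⊗ f ⊗ ⋯ ⊗ 1` with `f` in the `i`-th place. -/
noncomputable def actAt (i : ι) : Module.End k (W i) →ₗ[k] Module.End k (⨂[k] i, W i) :=
  (PiTensorProduct.mapMultilinear k W W).toLinearMap (fun _ => LinearMap.id) i

theorem actAt_apply (i : ι) (f : Module.End k (W i)) :
    actAt W i f = PiTensorProduct.map (Function.update (fun _ => LinearMap.id) i f) := rfl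

theorem actAt_mul (i : ι) (f h : Module.End k (W i)) :
    actAt W i (f * h) = actAt W i f * actAt W i h := by
  simp only [actAt_apply, ← PiTensorProduct.map_mul]
  congr 1
  funext j
  by_cases hj : j = i
  · subst hj; simp
  · simp only [Function.update_of_ne hj]; rfl

theorem actAt_comm {i j : ι} (hij : i ≠ j) (f : Module.End k (W i)) (h : Module.End k (W j)) :
    actAt W i f * actAt W j h = actAt W j h * actAt W i f := by
  simp only [actAt_apply, ← PiTensorProduct.map_mul]
  congr 1
  funext l
  by_cases hi : l = i
  · subst hi; simp only [Function.update_self, Function.update_of_ne hij]; rfl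
  · simp only [Function.update_of_ne hi]; rfl

/-- The tensor product of finitely many representations `ρᵢ` of `L` on `Wᵢ`: the element `u` acts
on `⨂ᵢ Wᵢ` by `∑ᵢ 1 ⊗ ⋯ ⊗ ρᵢ(u) ⊗ ⋯ ⊗ 1`. -/
noncomputable def tensorRep [Fintype ι] (ρ : ∀ i, L →ₗ⁅k⁆ Module.End k (W i)) :
    L →ₗ⁅k⁆ Module.End k (⨂[k] i, W i) where
  toLinearMap := ∑ i, actAt W i ∘ₗ (ρ i).toLinearMap
  map_lie' := by
    intro x y
    simp only [AddHom.toFun_eq_coe, LinearMap.coe_toAddHom, LinearMap.sum_apply,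
      LinearMap.comp_apply, LieHom.coe_toLinearMap, LieHom.map_lie]
    simp only [LieRing.of_associative_ring_bracket, map_sub, actAt_mul, Finset.sum_mul_sum]
    rw [Finset.sum_comm (s := Finset.univ) (t := Finset.univ)
      (f := fun i j => actAt W i (ρ i y) * actAt W j (ρ j x)), ← Finset.sum_sub_distrib]
    refine Finset.sum_congr rfl fun i _ => ?_
    rw [← Finset.sum_sub_distrib, Finset.sum_eq_single i]
    · intro j _ hj
      rw [actAt_comm W hj.symm, sub_self]
    · simp

end TensorRep

/-! ### Equivariant map algebras -/

/-- The automorphism group of a Lie algebra. -/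
instance LieEquiv.instGroupAut {k : Type u} {g : Type v} [CommRing k] [LieRing g]
    [LieAlgebra k g] : Group (g ≃ₗ⁅k⁆ g) where
  mul e f := f.trans e
  one := LieEquiv.refl
  inv e := e.symm
  mul_assoc _ _ _ := rfl
  one_mul _ := rfl
  mul_one _ := rfl
  inv_mul_cancel e := by
    apply LieEquiv.ext
    intro x
    exact e.symm_apply_apply x

section EquivariantMaps

attribute [local instance 100] LieRing.ofAssociativeRing

variable {k : Type u} {A : Type v} {g : Type w} {Γ : Type*} [Field k] [CommRing A] [Algebra k A]
  [LieRing g] [LieAlgebra k g] [Group Γ]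

/-- The `Γ`-equivariant maps from `X = Spec A` to `g`: the fixed points of the diagonal action
of `Γ` on the Lie algebra `A ⊗ g` of regular maps from `X` to `g`. -/
noncomputable def equivariantMapAlgebra (ρA : Γ →* (A ≃ₐ[k] A)) (ρg : Γ →* (g ≃ₗ⁅k⁆ g)) :
    LieSubalgebra k (A ⊗[k] g) where
  carrier := {α | ∀ γ : Γ, TensorProduct.map (ρA γ).toLinearMap
    ((ρg γ : g →ₗ⁅k⁆ g) : g →ₗ[k] g) α = α}
  add_mem' ha hb γ := by rw [map_add, ha γ, hb γ]
  zero_mem' γ := map_zero _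
  smul_mem' c α hα γ := by rw [map_smul, hα γ]
  lie_mem' := by
    intro α β hα hβ γ
    have key : ∀ x y : A ⊗[k] g,
        TensorProduct.map (ρA γ).toLinearMap ((ρg γ : g →ₗ⁅k⁆ g) : g →ₗ[k] g) ⁅x, y⁆ =
        ⁅TensorProduct.map (ρA γ).toLinearMap ((ρg γ : g →ₗ⁅k⁆ g) : g →ₗ[k] g) x,
          TensorProduct.map (ρA γ).toLinearMap ((ρg γ : g →ₗ⁅k⁆ g) : g →ₗ[k] g) y⁆ := by
      intro x y
      induction x using TensorProduct.induction_on with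
      | zero => simp
      | add x₁ x₂ h₁ h₂ => simp only [add_lie, map_add, h₁, h₂]
      | tmul a u =>
        induction y using TensorProduct.induction_on with
        | zero => simp
        | add y₁ y₂ h₁ h₂ => simp only [lie_add, map_add, h₁, h₂]
        | tmul b v => simp [LieAlgebra.ExtendScalars.bracket_tmul]
    rw [key, hα γ, hβ γ]

/-- The action of `Γ` on the rational points of `X = Spec A`, the latter being viewed as
`k`-algebra homomorphisms `x : A → k`: `(γ · x)(f) = x(γ⁻¹ · f)`. -/
def pointAction (ρA : Γ →* (A ≃ₐ[k] A)) (γ : Γ) (x : A →ₐ[k] k) : A →ₐ[k] k :=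
  x.comp (ρA γ⁻¹ : A →ₐ[k] A)

/-- `Γ` acts freely on the rational points of `X`. -/
def ActsFreely (ρA : Γ →* (A ≃ₐ[k] A)) : Prop :=
  ∀ (γ : Γ) (x : A →ₐ[k] k), pointAction ρA γ x = x → γ = 1

/-- The finite sets of rational points, no two of which lie in the same `Γ`-orbit. -/
def orbitSeparated (ρA : Γ →* (A ≃ₐ[k] A)) : Set (Finset (A →ₐ[k] k)) :=
  {s | (s : Set (A →ₐ[k] k)).PairwiseDisjoint fun x => Set.range fun γ => pointAction ρA γ x}

/-- Evaluation of a regular map `X → g` at a rational point `x`: `f ⊗ u ↦ f(x) u`. -/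
noncomputable def evalAt (x : A →ₐ[k] k) : A ⊗[k] g →ₗ⁅k⁆ g where
  toLinearMap := (TensorProduct.lid k g).toLinearMap ∘ₗ
    TensorProduct.map x.toLinearMap LinearMap.id
  map_lie' := by
    intro α β
    change TensorProduct.lid k g (TensorProduct.map x.toLinearMap LinearMap.id ⁅α, β⁆) =
      ⁅TensorProduct.lid k g (TensorProduct.map x.toLinearMap LinearMap.id α),
        TensorProduct.lid k g (TensorProduct.map x.toLinearMap LinearMap.id β)⁆
    induction α using TensorProduct.induction_on with
    | zero => simp
    | add x₁ x₂ h₁ h₂ => simp only [add_lie, map_add, h₁, h₂]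
    | tmul a u =>
      induction β using TensorProduct.induction_on with
      | zero => simp
      | add y₁ y₂ h₁ h₂ => simp only [lie_add, map_add, h₁, h₂]
      | tmul b v => simp [LieAlgebra.ExtendScalars.bracket_tmul, smul_smul, mul_comm]

open Classical in
/-- The evaluation representation of the equivariant map algebra on `⨂ₓ Wₓ` given by a
representation `Wₓ` of `g` for each `x ∈ s`: an equivariant map `α` acts on the factor `Wₓ`
through its value `α(x)`. (When `Γ` acts freely, all isotropy groups are trivial, so that the
subalgebra of `g` fixed by the isotropy group of `x` is `g` itself.) -/
noncomputable def evaluationRep (ρA : Γ →* (A ≃ₐ[k] A)) (ρg : Γ →* (g ≃ₗ⁅k⁆ g))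
    {s : Finset (A →ₐ[k] k)} (W : s → FDLieModule k g) :
    equivariantMapAlgebra ρA ρg →ₗ⁅k⁆ Module.End k (⨂[k] x, W x) :=
  tensorRep (fun x => (W x : Type _)) fun x =>
    (LieModule.toEnd k g (W x)).comp
      ((evalAt (x : A →ₐ[k] k)).comp (equivariantMapAlgebra ρA ρg).incl)

/-- `V ≅ ⨂ₓ Wₓ` as modules over the equivariant map algebra. -/
def IsEvaluationTensor (ρA : Γ →* (A ≃ₐ[k] A)) (ρg : Γ →* (g ≃ₗ⁅k⁆ g))
    {s : Finset (A →ₐ[k] k)} (W : s → FDLieModule k g)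
    (V : FDLieModule k (equivariantMapAlgebra ρA ρg)) : Prop :=
  ∃ e : V ≃ₗ[k] (⨂[k] x, W x), ∀ (α : equivariantMapAlgebra ρA ρg) (v : V),
    e ⁅α, v⁆ = evaluationRep ρA ρg W α (e v)

end EquivariantMaps

/-! ### The multiloop action -/

section Multiloop

variable (k : Type u) [Field k]

/-- The coordinate ring `k[z₁^{±1}, …, zₙ^{±1}]` of the torus `(kˣ)ⁿ`, spanned by the monomials
`z^a = AddMonoidAlgebra.single a 1`, `a ∈ ℤⁿ`. -/
abbrev LaurentRing (n : ℕ) : Type u := AddMonoidAlgebra k (Fin n → ℤ)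

/-- The algebra endomorphisms `f(z) ↦ f(tz)`, that is `z^a ↦ (∏ᵢ tᵢ^{aᵢ}) z^a`, for `t ∈ (kˣ)ⁿ`. -/
noncomputable def torusScale (n : ℕ) : (Fin n → kˣ) →* (LaurentRing k n →ₐ[k] LaurentRing k n) where
  toFun t := AddMonoidAlgebra.lift k (LaurentRing k n) (Fin n → ℤ)
    { toFun := fun a => AddMonoidAlgebra.single a.toAdd ((∏ i, t i ^ a.toAdd i : kˣ) : k)
      map_one' := by simp [AddMonoidAlgebra.one_def]
      map_mul' := fun a b => by
        simp [AddMonoidAlgebra.single_mul_single, zpow_add, Finset.prod_mul_distrib] }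
  map_one' := by
    refine AddMonoidAlgebra.algHom_ext (fun a => ?_) (by ext)
    simp
  map_mul' s t := by
    refine AddMonoidAlgebra.algHom_ext (fun a => ?_) (by ext)
    simp [mul_zpow, Finset.prod_mul_distrib, mul_comm]

variable {k}

/-- The group `ℤ/m₁ × ⋯ × ℤ/mₙ`, written multiplicatively. -/
abbrev MultiloopGroup {n : ℕ} (m : Fin n → ℕ) : Type := Multiplicative (∀ i, ZMod (m i))

/-- The homomorphism `(c₁, …, cₙ) ↦ (ξ₁^{c₁}, …, ξₙ^{cₙ})` into the torus. -/
noncomputable def multiloopTorusHom {n : ℕ} (m : Fin n → ℕ) (ξ : Fin n → kˣ)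
    (hξ : ∀ i, IsPrimitiveRoot (ξ i) (m i)) : MultiloopGroup m →* (Fin n → kˣ) :=
  MonoidHom.pi fun i =>
    AddMonoidHom.toMultiplicativeLeft
      ((ZMod.lift (m i) ⟨zmultiplesHom (Additive kˣ) (Additive.ofMul (ξ i)), by
        rw [zmultiplesHom_apply, natCast_zsmul, ← ofMul_pow, (hξ i).pow_eq_one, ofMul_one]⟩).comp
        (Pi.evalAddMonoidHom (fun j => ZMod (m j)) i))

/-- The action of `ℤ/m₁ × ⋯ × ℤ/mₙ` on the coordinate ring of `(kˣ)ⁿ` induced by the action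
`γᵢ · (z₁, …, zₙ) = (z₁, …, ξᵢ zᵢ, …, zₙ)` on points, that is `(γ · f)(z) = f(γ⁻¹ · z)`. -/
noncomputable def multiloopAction {n : ℕ} (m : Fin n → ℕ) (ξ : Fin n → kˣ)
    (hξ : ∀ i, IsPrimitiveRoot (ξ i) (m i)) :
    MultiloopGroup m →* (LaurentRing k n ≃ₐ[k] LaurentRing k n) :=
  ((AlgEquiv.algHomUnitsEquiv k (LaurentRing k n)).toMonoidHom.comp
    (torusScale k n).toHomUnits).comp (multiloopTorusHom m ξ hξ)⁻¹

end Multiloop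

/-! The projective presentation `U(L) ⊗ V → V` identifies Ext¹(V, V') with the Lie algebra
cohomology H¹(L, N) for N = Hom(V, V'), that is, with derivations L → N modulo inner ones
(`extOne_equiv_derivations`). Everything then rests on computing these for L = 𝔐 the equivariant map
algebra and N a module on which 𝔐 acts through its values at the points of s.

The maps vanishing on s act by zero on N, so a derivation kills all their commutators. These
commutators span all equivariant maps vanishing to second order on s
(`mem_span_lie_of_vanishing_sq`). This uses that g is perfect and that a free action is Galois: A ⊗
g is generated over A by equivariant maps, and averaging over Γ returns to equivariant maps. So a
derivation sees only the 1-jets at the points of s. Cutting off near one point at a time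
(`IsLocalizer`) splits the space of 1-jets into the pieces g ⊗ A/𝔪ₓ².

On the constant part g of each piece a derivation is a cocycle of g, and Whitehead's lemma, applied
to the commuting copies of g, removes all these parts by a single inner derivation. What remains is,
for each x, a linear map from 𝔪ₓ/𝔪ₓ² to the maps g → N that are equivariant for evaluation at x;
every such family conversely gives a derivation, by the Leibniz rule
(`nonempty_outerDerivations_equiv`).

For irreducible V and V' the tensor factors are irreducible. A map g → Hom(V, V') equivariant for
evaluation at x takes values intertwining the actions of g at every other point y. By Schur it is
zero if V_y and V'_y are not isomorphic for some y ≠ x; otherwise, by Burnside, its values are fixed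
isomorphisms at all y ≠ x tensored with an element of Hom(V_x, V'_x). This gives the three cases.

Irreducible modules are evaluation modules for the following reason. 𝔐 is perfect, so it acts
without trace and its image has trivial radical; ideals with abelian image therefore act by zero.
Consequently the kernel is stable under A^Γ, hence contains the maps with coefficients in some ideal
of finite codimension, and nilpotents in the quotient do not matter. The module thus factors through
evaluation on finitely many orbits, where an irreducible module for commuting copies of g is a
tensor product.

For multiloop algebras the action on the torus is free, and logarithmic coordinates identify each
tangent space with kⁿ. -/

section ExtOne

open CategoryTheory ModuleCat UniversalEnvelopingAlgebra

attribute [local instance 100] LieRing.ofAssociativeRing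

/-! ### Ext¹ from a projective presentation -/

section ProjectivePresentation

variable {k : Type u} [Field k] {U : Type u} [Ring U] [Algebra k U]
  {P X : Type u} [AddCommGroup P] [Module U P] [AddCommGroup X] [Module U X]

/-- A linear map as a morphism into a bundled module. -/
def homToModuleCat {Y : ModuleCat.{u} U} (φ : P →ₗ[U] Y) : ModuleCat.of U P ⟶ Y :=
  ModuleCat.ofHom φ

/-- Restriction of homomorphisms to the kernel of a presentation, as a `k`-linear map. -/
noncomputable def restrictToKer (f : P →ₗ[U] X) (Y : ModuleCat.{u} U) :
    (f.shortComplexKer.X₂ ⟶ Y) →ₗ[k] (f.shortComplexKer.X₁ ⟶ Y) where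
  toFun φ := f.shortComplexKer.f ≫ φ
  map_add' := by simp
  map_smul' := by simp

/-- `Ext¹(X, Y)` computed from a projective presentation of `X`. -/
theorem extOne_of_projective [Module.Projective U P] (f : P →ₗ[U] X)
    (hf : Function.Surjective f) (Y : ModuleCat.{u} U) :
    Nonempty (((f.shortComplexKer.X₁ ⟶ Y) ⧸ LinearMap.range (restrictToKer (k := k) f Y)) ≃ₗ[k]
      Abelian.Ext (ModuleCat.of U X) Y 1) := by
  have hS := LinearMap.shortExact_shortComplexKer hf
  have hP : Projective f.shortComplexKer.X₂ :=
    inferInstanceAs (Projective (ModuleCat.of U P))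
  -- The connecting map, pushing out the class of the presentation. It is onto because Ext¹(P, Y) =
  -- 0, and its kernel consists of the maps that extend to P.
  let α : (f.shortComplexKer.X₁ ⟶ Y) →ₗ[k] Abelian.Ext (ModuleCat.of U X) Y 1 :=
    (Abelian.Ext.precompOfLinear hS.extClass k Y (add_zero 1)).comp
      (Abelian.Ext.linearEquiv₀ (R := k)).symm.toLinearMap
  have hα : ∀ φ, α φ = hS.extClass.comp (Abelian.Ext.mk₀ φ) (add_zero 1) := fun φ => by
    simp [α]
  have hsurj : Function.Surjective α := by
    intro e
    obtain ⟨x, hx⟩ := Abelian.Ext.contravariant_sequence_exact₃ hS Y e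
      (Abelian.Ext.eq_zero_of_projective _) (add_zero 1)
    obtain ⟨φ, rfl⟩ := (Abelian.Ext.linearEquiv₀ (R := k)).symm.surjective x
    exact ⟨φ, by rw [hα, ← hx]; simp⟩
  have hker : LinearMap.ker α = LinearMap.range (restrictToKer (k := k) f Y) := by
    ext φ
    rw [LinearMap.mem_ker, hα, LinearMap.mem_range]
    constructor
    · intro h
      obtain ⟨x, hx⟩ := Abelian.Ext.contravariant_sequence_exact₁ hS Y _ (add_zero 1) h
      obtain ⟨ψ, rfl⟩ := (Abelian.Ext.linearEquiv₀ (R := k)).symm.surjective x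
      refine ⟨ψ, ?_⟩
      apply (Abelian.Ext.linearEquiv₀ (R := k)).symm.injective
      simpa [restrictToKer] using hx
    · rintro ⟨ψ, rfl⟩
      change hS.extClass.comp (Abelian.Ext.mk₀ (f.shortComplexKer.f ≫ ψ)) _ = 0
      rw [← Abelian.Ext.mk₀_comp_mk₀]
      exact hS.extClass_comp_assoc _
  exact ⟨(Submodule.quotEquivOfEq _ _ hker.symm).trans (α.quotKerEquivOfSurjective hsurj)⟩

end ProjectivePresentation

/-! ### The presentation by the enveloping algebra and one-cocycles -/

variable {k : Type u} {L : Type u} {V V' : Type u} [Field k] [LieRing L] [LieAlgebra k L]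
    [AddCommGroup V] [Module k V] [LieRingModule L V] [LieModule k L V]
    [AddCommGroup V'] [Module k V'] [LieRingModule L V'] [LieModule k L V']

local notation "U" => UniversalEnvelopingAlgebra k L

/-- The identity map from an `L`-module to the corresponding module over the enveloping algebra. -/
noncomputable def toEnveloping (k : Type u) (L : Type u) (V : Type u) [Field k] [LieRing L]
    [LieAlgebra k L] [AddCommGroup V] [Module k V] [LieRingModule L V] [LieModule k L V] :
    V ≃ₗ[k] envelopingModule k L V :=
  { AddEquiv.refl V with
    map_smul' := fun c v => by
      have : (lift k (LieModule.toEnd k L V)) (algebraMap k (UniversalEnvelopingAlgebra k L) c) v = c • v := by simp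
      exact this.symm }

theorem smul_toEnveloping (a : U) (v : V) :
    a • toEnveloping k L V v = toEnveloping k L V (lift k (LieModule.toEnd k L V) a v) := rfl

theorem ι_smul_toEnveloping (x : L) (v : V) :
    ι k x • toEnveloping k L V v = toEnveloping k L V ⁅x, v⁆ := by
  rw [smul_toEnveloping, lift_ι_apply]; rfl

variable (k L V) in
/-- The presentation `U(L) ⊗ V → V`. -/
noncomputable def envelopingPresentation : U ⊗[k] V →ₗ[U] envelopingModule k L V :=
  TensorProduct.AlgebraTensorModule.lift
    (LinearMap.toSpanSingleton U (V →ₗ[k] envelopingModule k L V) (toEnveloping k L V).toLinearMap)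

theorem envelopingPresentation_tmul (a : U) (v : V) :
    envelopingPresentation k L V (a ⊗ₜ v) =
      toEnveloping k L V (lift k (LieModule.toEnd k L V) a v) := by
  rw [← smul_toEnveloping]
  simp [envelopingPresentation]

theorem envelopingPresentation_surjective :
    Function.Surjective (envelopingPresentation k L V) := fun x => by
  obtain ⟨v, rfl⟩ := (toEnveloping k L V).surjective x
  exact ⟨1 ⊗ₜ v, by rw [envelopingPresentation_tmul]; simp⟩

variable (k L V) in
/-- The generators `x ⊗ v - 1 ⊗ xv` of the kernel of the presentation. -/
noncomputable def kerGenerator (x : L) :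
    V →ₗ[k] LinearMap.ker (envelopingPresentation k L V) where
  toFun v := ⟨ι k x ⊗ₜ v - 1 ⊗ₜ ⁅x, v⁆, by
    rw [LinearMap.mem_ker, map_sub, envelopingPresentation_tmul, envelopingPresentation_tmul,
      lift_ι_apply]
    simp⟩
  map_add' v w := by
    ext; simp [TensorProduct.tmul_add]; abel
  map_smul' c v := by
    ext; simp [smul_sub]

theorem kerGenerator_add (x y : L) :
    kerGenerator k L V (x + y) = kerGenerator k L V x + kerGenerator k L V y := by
  ext v
  simp [kerGenerator, TensorProduct.add_tmul, TensorProduct.tmul_add]; abel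

theorem kerGenerator_smul (c : k) (x : L) :
    kerGenerator k L V (c • x) = c • kerGenerator k L V x := by
  ext v
  simp [kerGenerator, smul_sub, TensorProduct.smul_tmul']

/-- This relation turns `U`-linearity of a map on the kernel into the cocycle rule for its values on
the generators. -/
theorem kerGenerator_lie (x y : L) (v : V) :
    kerGenerator k L V ⁅x, y⁆ v = ι k x • kerGenerator k L V y v - ι k y • kerGenerator k L V x v
      + kerGenerator k L V x ⁅y, v⁆ - kerGenerator k L V y ⁅x, v⁆ := by
  ext
  simp only [kerGenerator, LinearMap.coe_mk, AddHom.coe_mk, LieHom.map_lie,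
    LieRing.of_associative_ring_bracket, AddSubgroupClass.coe_sub, Submodule.coe_add,
    Submodule.coe_smul, smul_sub, TensorProduct.smul_tmul', smul_eq_mul, mul_one,
    TensorProduct.sub_tmul, lie_lie, TensorProduct.tmul_sub]
  abel

/-- The enveloping algebra is generated by `L`. -/
theorem UniversalEnvelopingAlgebra.adjoin_range_ι :
    Algebra.adjoin k (Set.range (ι k : L → U)) = ⊤ := by
  let S := Algebra.adjoin k (Set.range (ι k : L → U))
  let j : L →ₗ⁅k⁆ S :=
    { toFun := fun x => ⟨ι k x, Algebra.subset_adjoin ⟨x, rfl⟩⟩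
      map_add' := fun x y => by ext; simp
      map_smul' := fun c x => by ext; simp
      map_lie' := fun {x y} => by ext; simp [LieRing.of_associative_ring_bracket] }
  have h : S.val.comp (lift k j) = AlgHom.id k U := by
    apply hom_ext
    ext x
    simp [-ι_apply, lift_ι_apply, j]
  refine eq_top_iff.mpr fun a _ => ?_
  have := DFunLike.congr_fun h a
  simp only [AlgHom.comp_apply, AlgHom.id_apply] at this
  rw [← this]
  exact (lift k j a).2

/-- Modulo the generators, a ⊗ v is congruent to 1 ⊗ av, so every tensor reduces to some 1 ⊗ v,
which is in the kernel only for v = 0. Hence a homomorphism on the kernel is determined by its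
cocycle. -/
theorem span_kerGenerator :
    Submodule.span U {z | ∃ x v, kerGenerator k L V x v = z} = ⊤ := by
  set S := Submodule.span U {z | ∃ x v, kerGenerator k L V x v = z}
  have key : ∀ (a : U) (v : V), ∃ z ∈ S,
      (z : U ⊗[k] V) = a ⊗ₜ v - 1 ⊗ₜ (lift k (LieModule.toEnd k L V) a v) := by
    intro a
    have ha : a ∈ Algebra.adjoin k (Set.range (ι k : L → U)) := by
      rw [UniversalEnvelopingAlgebra.adjoin_range_ι]; trivial
    induction ha using Algebra.adjoin_induction with
    | mem a ha =>
      obtain ⟨x, rfl⟩ := ha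
      intro v
      refine ⟨_, Submodule.subset_span ⟨x, v, rfl⟩, ?_⟩
      rw [lift_ι_apply]; rfl
    | algebraMap c =>
      intro v
      refine ⟨0, S.zero_mem, ?_⟩
      simp [Algebra.algebraMap_eq_smul_one, TensorProduct.smul_tmul']
    | add a b _ _ ha hb =>
      intro v
      obtain ⟨z, hz, hz'⟩ := ha v
      obtain ⟨w, hw, hw'⟩ := hb v
      refine ⟨z + w, S.add_mem hz hw, ?_⟩
      rw [Submodule.coe_add, hz', hw', TensorProduct.add_tmul, map_add, LinearMap.add_apply,
        TensorProduct.tmul_add]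
      abel
    | mul a b _ _ ha hb =>
      intro v
      obtain ⟨z, hz, hz'⟩ := hb v
      obtain ⟨w, hw, hw'⟩ := ha (lift k (LieModule.toEnd k L V) b v)
      refine ⟨a • z + w, S.add_mem (S.smul_mem a hz) hw, ?_⟩
      rw [Submodule.coe_add, Submodule.coe_smul, hz', hw', map_mul, Module.End.mul_apply, smul_sub,
        TensorProduct.smul_tmul', TensorProduct.smul_tmul', smul_eq_mul, smul_eq_mul, mul_one]
      abel
  have key' : ∀ t : U ⊗[k] V, ∃ z ∈ S, ∃ v : V, t = (z : U ⊗[k] V) + 1 ⊗ₜ v := by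
    intro t
    induction t using TensorProduct.induction_on with
    | zero => exact ⟨0, S.zero_mem, 0, by simp⟩
    | tmul a v =>
      obtain ⟨z, hz, hz'⟩ := key a v
      exact ⟨z, hz, _, by rw [hz']; abel⟩
    | add s t hs ht =>
      obtain ⟨z, hz, v, rfl⟩ := hs
      obtain ⟨w, hw, v', rfl⟩ := ht
      exact ⟨z + w, S.add_mem hz hw, v + v', by
        rw [Submodule.coe_add, TensorProduct.tmul_add]; abel⟩
  refine eq_top_iff.mpr fun t _ => ?_
  obtain ⟨z, hz, v, h⟩ := key' t
  have hv : v = 0 := by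
    have h1 := t.2
    rw [h, LinearMap.mem_ker, map_add, LinearMap.mem_ker.mp z.2, zero_add,
      envelopingPresentation_tmul] at h1
    simpa using h1
  have : t = z := by ext; rw [h, hv]; simp
  rwa [this]

variable (k L V V') in
/-- A homomorphism on the kernel of the presentation gives a one-cocycle. -/
noncomputable def cocycleOfHom :
    ((envelopingPresentation k L V).shortComplexKer.X₁ ⟶ envelopingModule k L V') →ₗ[k]
      LieDerivation k L (V →ₗ[k] V') where
  toFun φ :=
    { toFun := fun x =>
        (toEnveloping k L V').symm.toLinearMap ∘ₗ (φ.hom.restrictScalars k) ∘ₗ kerGenerator k L V x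
      map_add' := fun x y => by
        rw [kerGenerator_add]; simp [LinearMap.comp_add]
      map_smul' := fun c x => by
        rw [kerGenerator_smul]; simp [LinearMap.comp_smul]
      leibniz' := fun x y => by
        ext v
        have h : ∀ (a : L) (t : LinearMap.ker (envelopingPresentation k L V)),
            (toEnveloping k L V').symm (φ.hom (ι k a • t)) =
              ⁅a, (toEnveloping k L V').symm (φ.hom t)⁆ := fun a t => by
          rw [LinearEquiv.symm_apply_eq, ← ι_smul_toEnveloping, LinearEquiv.apply_symm_apply]
          exact φ.hom.map_smul _ _
        simp only [LinearMap.coe_mk, AddHom.coe_mk, LinearMap.comp_apply, LinearEquiv.coe_coe,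
          LinearMap.coe_restrictScalars, LinearMap.sub_apply, LieHom.lie_apply, kerGenerator_lie]
        erw [map_sub, map_add, map_sub]
        rw [map_sub, map_add, map_sub, h, h]
        abel }
  map_add' φ ψ := by ext; rfl
  map_smul' c φ := by
    ext x v
    simp

theorem cocycleOfHom_apply
    (φ : (envelopingPresentation k L V).shortComplexKer.X₁ ⟶ envelopingModule k L V')
    (x : L) (v : V) : toEnveloping k L V' (cocycleOfHom k L V V' φ x v) =
      φ.hom (kerGenerator k L V x v) := rfl

theorem cocycleOfHom_injective : Function.Injective (cocycleOfHom k L V V') := by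
  intro φ ψ h
  apply ModuleCat.hom_ext
  apply LinearMap.ext_on_range (v := fun p : L × V => kerGenerator k L V p.1 p.2)
  · convert span_kerGenerator (k := k) (L := L) (V := V) using 2
    ext z
    simp
  · rintro ⟨x, v⟩
    dsimp only
    rw [← cocycleOfHom_apply, h, cocycleOfHom_apply]

/-- The action of `L` on `V' × V` twisted by a one-cocycle. -/
noncomputable def twistedAction (c : LieDerivation k L (V →ₗ[k] V')) :
    L →ₗ⁅k⁆ Module.End k (V' × V) where
  toFun x := LinearMap.prod
    (LinearMap.coprod (LieModule.toEnd k L V' x) (c x)) (LieModule.toEnd k L V x ∘ₗ LinearMap.snd k V' V)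
  map_add' x y := by ext <;> simp
  map_smul' a x := by ext <;> simp
  map_lie' {x y} := by
    apply LinearMap.ext
    rintro ⟨v', v⟩
    simp [LieRing.of_associative_ring_bracket, lie_add]
    abel

theorem lift_twistedAction_inl (c : LieDerivation k L (V →ₗ[k] V')) (a : U) (v : V') :
    lift k (twistedAction c) a (v, 0) = (lift k (LieModule.toEnd k L V') a v, 0) := by
  have ha : a ∈ Algebra.adjoin k (Set.range (ι k : L → U)) := by
    rw [UniversalEnvelopingAlgebra.adjoin_range_ι]; trivial
  induction ha using Algebra.adjoin_induction generalizing v with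
  | mem a ha =>
    obtain ⟨x, rfl⟩ := ha
    rw [lift_ι_apply, lift_ι_apply]
    simp [twistedAction]
  | algebraMap r => simp
  | add a b _ _ ha hb => simp [ha, hb]
  | mul a b _ _ ha hb => simp [ha, hb]

theorem lift_twistedAction_snd (c : LieDerivation k L (V →ₗ[k] V')) (a : U) (p : V' × V) :
    (lift k (twistedAction c) a p).2 = lift k (LieModule.toEnd k L V) a p.2 := by
  have ha : a ∈ Algebra.adjoin k (Set.range (ι k : L → U)) := by
    rw [UniversalEnvelopingAlgebra.adjoin_range_ι]; trivial
  induction ha using Algebra.adjoin_induction generalizing p with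
  | mem a ha =>
    obtain ⟨x, rfl⟩ := ha
    rw [lift_ι_apply, lift_ι_apply]
    simp [twistedAction]
  | algebraMap r => simp
  | add a b _ _ ha hb => simp [ha, hb]
  | mul a b _ _ ha hb => simp [ha, hb]

/-- The extension V' × V twisted by c realizes c: a ⊗ v ↦ a(0, v) is `U`-linear over V, so it
carries the kernel into V', and its value on x ⊗ v - 1 ⊗ xv is c(x)v. -/
theorem cocycleOfHom_surjective : Function.Surjective (cocycleOfHom k L V V') := by
  intro c
  let G : U ⊗[k] V →ₗ[k] V' × V := TensorProduct.lift
    ((LinearMap.lcomp k (V' × V) (LinearMap.inr k V' V)) ∘ₗ (lift k (twistedAction c)).toLinearMap)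
  have hG : ∀ a v, G (a ⊗ₜ v) = lift k (twistedAction c) a (0, v) := fun a v => by simp [G]
  have hG_smul : ∀ (a : U) t, G (a • t) = lift k (twistedAction c) a (G t) := by
    intro a t
    induction t using TensorProduct.induction_on with
    | zero => simp
    | tmul b v => rw [TensorProduct.smul_tmul', hG, hG, smul_eq_mul, map_mul]; rfl
    | add s t hs ht => rw [smul_add, map_add, hs, ht, map_add, map_add]
  have hG_snd : ∀ t, toEnveloping k L V (G t).2 = envelopingPresentation k L V t := by
    intro t
    induction t using TensorProduct.induction_on with
    | zero => simp
    | tmul b v => rw [hG, lift_twistedAction_snd, envelopingPresentation_tmul]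
    | add s t hs ht => rw [map_add G, map_add (envelopingPresentation k L V), ← hs, ← ht, Prod.snd_add, map_add]
  have hG_ker : ∀ t : LinearMap.ker (envelopingPresentation k L V), G t = ((G t).1, 0) := by
    intro t
    have h := hG_snd t
    rw [LinearMap.mem_ker.mp t.2, LinearEquiv.map_eq_zero_iff] at h
    exact Prod.ext rfl h
  let φ : LinearMap.ker (envelopingPresentation k L V) →ₗ[U] envelopingModule k L V' :=
    { toFun := fun t => toEnveloping k L V' (G t).1
      map_add' := fun s t => by simp
      map_smul' := fun a t => by
        rw [Submodule.coe_smul, hG_smul, hG_ker, lift_twistedAction_inl]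
        rfl }
  refine ⟨homToModuleCat φ, ?_⟩
  ext x v
  apply (toEnveloping k L V').injective
  rw [cocycleOfHom_apply]
  change toEnveloping k L V' (G (ι k x ⊗ₜ v - 1 ⊗ₜ ⁅x, v⁆)).1 = _
  rw [map_sub, hG, hG, lift_ι_apply]
  simp [twistedAction]

/-- A map on the induced module U ⊗ V is the same as a linear map n = ψ(1 ⊗ ·), with no condition on
n; its restriction to the kernel is the coboundary of n. -/
theorem map_cocycleOfHom_range :
    (LinearMap.range (restrictToKer (k := k) (envelopingPresentation k L V)
      (envelopingModule k L V'))).map (cocycleOfHom k L V V') =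
      LinearMap.range (LieDerivation.inner k L (V →ₗ[k] V')) := by
  have key : ∀ (ψ : (envelopingPresentation k L V).shortComplexKer.X₂ ⟶ envelopingModule k L V')
      (n : V →ₗ[k] V'), (∀ v, ψ.hom ((1 : U) ⊗ₜ[k] v) = toEnveloping k L V' (n v)) →
      cocycleOfHom k L V V' (restrictToKer (k := k) _ _ ψ) = LieDerivation.inner k L _ n := by
    intro ψ n h
    ext x v
    apply (toEnveloping k L V').injective
    rw [cocycleOfHom_apply]
    change ψ.hom (ι k x ⊗ₜ[k] v - (1 : U) ⊗ₜ[k] ⁅x, v⁆) = _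
    have h1 : (ι k x ⊗ₜ[k] v : U ⊗[k] V) = ι k x • ((1 : U) ⊗ₜ[k] v) := by
      rw [TensorProduct.smul_tmul', smul_eq_mul, mul_one]
    have h2 : ψ.hom (ι k x • ((1 : U) ⊗ₜ[k] v)) = ι k x • ψ.hom ((1 : U) ⊗ₜ[k] v) :=
      ψ.hom.map_smul _ _
    erw [map_sub]
    rw [h1]
    erw [h2]
    rw [h, h, ι_smul_toEnveloping]
    simp
  apply le_antisymm
  · rintro _ ⟨_, ⟨ψ, rfl⟩, rfl⟩
    refine ⟨(toEnveloping k L V').symm.toLinearMap ∘ₗ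
      (show U ⊗[k] V →ₗ[U] envelopingModule k L V' from ψ.hom).restrictScalars k ∘ₗ
        TensorProduct.mk k U V 1, ?_⟩
    symm
    apply key
    intro v
    rfl
  · rintro _ ⟨n, rfl⟩
    let f : U ⊗[k] V →ₗ[U] envelopingModule k L V' := TensorProduct.AlgebraTensorModule.lift
      (LinearMap.toSpanSingleton U (V →ₗ[k] envelopingModule k L V')
        ((toEnveloping k L V').toLinearMap ∘ₗ n))
    refine ⟨_, ⟨homToModuleCat f, rfl⟩, ?_⟩
    apply key
    intro v
    change f (1 ⊗ₜ v) = _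
    simp [f]

variable (k L V V') in
/-- `Ext¹_L(V, V')` is the first Lie algebra cohomology of `Hom(V, V')`. -/
theorem extOne_equiv_derivations :
    Nonempty (LieExtOne k L V V' ≃ₗ[k]
      LieDerivation k L (V →ₗ[k] V') ⧸ LinearMap.range (LieDerivation.inner k L (V →ₗ[k] V'))) := by
  obtain ⟨e⟩ := extOne_of_projective (k := k) (envelopingPresentation k L V)
    envelopingPresentation_surjective (envelopingModule k L V')
  exact ⟨e.symm.trans (Submodule.Quotient.equiv _ _
    (LinearEquiv.ofBijective _ ⟨cocycleOfHom_injective, cocycleOfHom_surjective⟩)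
    map_cocycleOfHom_range)⟩

end ExtOne

/-! ### Schur's lemma, Casimir elements and Whitehead's first lemma -/

section Whitehead

attribute [local instance 100] LieRing.ofAssociativeRing

open LieAlgebra LieModule Module

/-- Schur's lemma for irreducible modules over a Lie algebra. -/
theorem LieModule.exists_eq_smul_of_isIrreducible {k : Type*} {L : Type*} {V : Type*} [Field k]
    [IsAlgClosed k] [LieRing L] [LieAlgebra k L] [AddCommGroup V] [Module k V] [LieRingModule L V]
    [LieModule k L V] [Module.Finite k V] [IsIrreducible k L V] (T : V →ₗ[k] V)
    (hT : ∀ (x : L) (v : V), T ⁅x, v⁆ = ⁅x, T v⁆) : ∃ μ : k, ∀ v, T v = μ • v := by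
  have := nontrivial_of_isIrreducible k L V
  obtain ⟨μ, hμ⟩ := Module.End.exists_eigenvalue T
  let E : LieSubmodule k L V :=
    { End.eigenspace T μ with
      lie_mem := fun {x v} hv => by
        have hv : v ∈ End.eigenspace T μ := hv
        change ⁅x, v⁆ ∈ End.eigenspace T μ
        rw [End.mem_eigenspace_iff] at hv ⊢
        rw [hT, hv, lie_smul] }
  have hE : E = ⊤ := by
    refine (IsSimpleOrder.eq_bot_or_eq_top E).resolve_left fun h => hμ ?_
    have : (E : Submodule k V) = ⊥ := by rw [h]; rfl
    exact this
  exact ⟨μ, fun v => End.mem_eigenspace_iff.mp (hE ▸ LieSubmodule.mem_top v : v ∈ E)⟩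

variable {k : Type u} {g : Type v} [Field k] [LieRing g] [LieAlgebra k g]

/-- A Lie algebra with a faithful nilpotent module is nilpotent. -/
theorem LieRing.isNilpotent_of_faithful {I : Type*} [LieRing I] [LieAlgebra k I]
    [Module.Finite k I] {N : Type*} [AddCommGroup N] [Module k N] [LieRingModule I N]
    [LieModule k I N] [Module.Finite k N] (hN : LieModule.IsNilpotent I N)
    (hf : Function.Injective (toEnd k I N)) : LieRing.IsNilpotent I := by
  rw [LieAlgebra.isNilpotent_iff_forall (R := k)]
  intro x
  obtain ⟨n, hn⟩ := LieAlgebra.ad_nilpotent_of_nilpotent (R := k)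
    ((LieModule.isNilpotent_iff_forall' (R := k)).mp hN x)
  refine ⟨n, ?_⟩
  -- Engel: x is nilpotent on N, so bracketing with its operator is nilpotent on End N, and
  -- faithfulness carries this back to ad x.
  have key : ∀ (m : ℕ) (y : I), toEnd k I N ((ad k I x ^ m) y) =
      (ad k (Module.End k N) (toEnd k I N x) ^ m) (toEnd k I N y) := by
    intro m
    induction m with
    | zero => simp
    | succ m ih => intro y; rw [pow_succ, pow_succ, Module.End.mul_apply, ih]; simp
  ext y
  apply hf
  rw [key, hn]
  simp

/-- A derivation is inner as soon as some invariant element of `g ⊗ g` acts invertibly. -/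
theorem exists_inner_of_casimir {N : Type w} [AddCommGroup N] [Module k N] [LieRingModule g N]
    [LieModule k g N] {ι : Type*} [Fintype ι] (e f : ι → g)
    (hef : ∀ x : g, ∑ i, (⁅x, e i⁆ ⊗ₜ[k] f i + e i ⊗ₜ[k] ⁅x, f i⁆) = 0)
    (μ : k) (hμ : μ ≠ 0) (hΩ : ∀ n : N, ∑ i, ⁅e i, ⁅f i, n⁆⁆ = μ • n)
    (D : LieDerivation k g N) : ∃ n, ∀ x, D x = ⁅x, n⁆ := by
  -- Apply a ⊗ b ↦ a D(b) to the invariance relation: by the cocycle rule, x ∑ eᵢ D(fᵢ) = ∑ eᵢ fᵢ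
  -- D(x) = μ D(x).
  refine ⟨μ⁻¹ • ∑ i, ⁅e i, D (f i)⁆, fun x => ?_⟩
  rw [lie_smul, lie_sum, eq_inv_smul_iff₀ hμ, ← hΩ]
  let F : g ⊗[k] g →ₗ[k] N := TensorProduct.lift
    ((LieModule.toEnd k g N).toLinearMap.compl₂ D.toLinearMap)
  have hF : ∀ a b, F (a ⊗ₜ b) = ⁅a, D b⁆ := fun a b => rfl
  have h := congrArg F (hef x)
  rw [map_sum, map_zero] at h
  simp only [map_add, hF] at h
  rw [← sub_eq_zero, ← neg_eq_zero, ← h, ← Finset.sum_sub_distrib, ← Finset.sum_neg_distrib]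
  refine Finset.sum_congr rfl fun i _ => ?_
  rw [LieDerivation.apply_lie_eq_sub, leibniz_lie x]
  simp

variable [Module.Finite k g]

/-- By invariance of the Killing form, the orthogonal complement of [g, g] is central, hence zero.
-/
theorem LieAlgebra.derivedSeries_one_eq_top [LieAlgebra.IsKilling k g] :
    derivedSeries k g 1 = ⊤ := by
  have h := LieIdeal.isCompl_killingCompl (derivedSeries k g 1)
  have h0 : LieIdeal.killingCompl k g (derivedSeries k g 1) = ⊥ := by
    rw [LieSubmodule.eq_bot_iff]
    intro x hx
    have hx' : ∀ y : g, ⁅x, y⁆ = 0 := by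
      intro y
      apply (LieAlgebra.IsKilling.killingForm_nondegenerate k g).1 ⁅x, y⁆
      intro z
      rw [LieModule.traceForm_apply_lie_apply, LieModule.traceForm_comm]
      exact (LieIdeal.mem_killingCompl k g _).mp hx _
        (LieSubmodule.lie_mem_lie (LieSubmodule.mem_top _) (LieSubmodule.mem_top _))
    have : x ∈ LieAlgebra.center k g := by
      rw [LieModule.mem_maxTrivSubmodule]
      intro y
      rw [← lie_skew, hx', neg_zero]
    rw [LieAlgebra.center_eq_bot] at this
    simpa using this
  rw [h0] at h
  simpa using h.sup_eq_top

variable [CharZero k] {N : Type w} [AddCommGroup N] [Module k N] [LieRingModule g N] [LieModule k g N]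
  [Module.Finite k N]

/-- Over a semisimple Lie algebra the trace form of a module is nondegenerate on the complement of
its kernel. -/
theorem eq_zero_of_traceForm_eq_zero [LieAlgebra.IsKilling k g] (x : g)
    (hx : x ∈ LieIdeal.killingCompl k g (LieModule.ker k g N))
    (h : ∀ y ∈ LieIdeal.killingCompl k g (LieModule.ker k g N), traceForm k g N x y = 0) :
    x = 0 := by
  set J := LieIdeal.killingCompl k g (LieModule.ker k g N)
  have hcompl := LieIdeal.isCompl_killingCompl (LieModule.ker k g N)
  -- The radical of the trace form on J. It acts faithfully on N because J meets the kernel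
  -- trivially. The form vanishes on it, so its derived ideal acts nilpotently (Cartan); hence it is
  -- a solvable ideal of a semisimple algebra.
  let I : LieIdeal k g :=
    { carrier := {x | x ∈ J ∧ ∀ y ∈ J, traceForm k g N x y = 0}
      add_mem' := fun {a b} ha hb => ⟨J.add_mem ha.1 hb.1, fun y hy => by
        rw [map_add, LinearMap.add_apply, ha.2 y hy, hb.2 y hy, add_zero]⟩
      zero_mem' := ⟨J.zero_mem, fun y _ => by simp⟩
      smul_mem' := fun c a ha => ⟨J.smul_mem c ha.1, fun y hy => by
        rw [map_smul, LinearMap.smul_apply, ha.2 y hy, smul_zero]⟩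
      lie_mem := fun {z a} ha => ⟨J.lie_mem ha.1, fun y hy => by
        rw [← lie_skew, map_neg, LinearMap.neg_apply, traceForm_apply_lie_apply,
          ha.2 _ (J.lie_mem hy), neg_zero]⟩ }
  have htr : traceForm k I N = 0 := by
    ext a b
    exact a.2.2 b b.2.1
  have hinj : Function.Injective (toEnd k I N) := by
    rw [injective_iff_map_eq_zero]
    intro a ha
    have h1 : (a : g) ∈ LieModule.ker k g N := by
      rw [LieModule.mem_ker]
      intro n
      exact DFunLike.congr_fun ha n
    have h2 := (hcompl.disjoint.le_bot : _) (show (a : g) ∈ LieModule.ker k g N ⊓ J from ⟨h1, a.2.1⟩)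
    exact Subtype.ext (by simpa using h2)
  have hnil := isNilpotent_derivedSeries_of_traceForm_eq_zero htr
  have hD : LieRing.IsNilpotent (derivedSeries k I 1) := by
    refine LieRing.isNilpotent_of_faithful (k := k) hnil fun a b hab => ?_
    exact Subtype.ext (hinj hab)
  have hsol : LieAlgebra.IsSolvable I := by
    have := hD
    obtain ⟨n, hn⟩ := IsSolvable.solvable k (derivedSeries k I 1)
    rw [LieIdeal.derivedSeries_eq_bot_iff] at hn
    refine IsSolvable.mk (R := k) (k := n + 1) ?_
    rwa [derivedSeries_def, derivedSeriesOfIdeal_add]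
  have : I = ⊥ := LieAlgebra.HasTrivialRadical.eq_bot_of_isSolvable I
  have hxI : x ∈ I := ⟨hx, h⟩
  rw [this] at hxI
  simpa using hxI

/-- If g acts trivially, a derivation kills [g, g] = g. Otherwise the trace form on the complement J
of the kernel has a Casimir element; it is scalar by Schur, and its trace is dim J ≠ 0, so the
scalar is nonzero in characteristic zero. -/
theorem exists_inner_of_isIrreducible [IsAlgClosed k] [LieAlgebra.IsKilling k g]
    [IsIrreducible k g N] (D : LieDerivation k g N) : ∃ n, ∀ x, D x = ⁅x, n⁆ := by
  set J := LieIdeal.killingCompl k g (LieModule.ker k g N)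
  have hcompl := LieIdeal.isCompl_killingCompl (LieModule.ker k g N)
  by_cases hJ : J = ⊥
  · have hker : LieModule.ker k g N = ⊤ := by
      have := hcompl.sup_eq_top
      rwa [show LieIdeal.killingCompl k g (LieModule.ker k g N) = ⊥ from hJ, sup_bot_eq] at this
    have htriv : ∀ (x : g) (n : N), ⁅x, n⁆ = 0 := fun x n =>
      (LieModule.mem_ker k g N x).mp (hker ▸ LieSubmodule.mem_top x : x ∈ LieModule.ker k g N) n
    refine ⟨0, fun x => ?_⟩
    rw [lie_zero]
    have hx : x ∈ derivedSeries k g 1 := by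
      rw [LieAlgebra.derivedSeries_one_eq_top]; exact LieSubmodule.mem_top x
    have hle : (derivedSeries k g 1 : Submodule k g) ≤ LinearMap.ker D.toLinearMap := by
      rw [LieAlgebra.coe_derivedSeries_one_eq, Submodule.span_le]
      rintro _ ⟨a, b, rfl⟩
      simp [htriv]
    exact hle hx
  · let B : LinearMap.BilinForm k J :=
      (traceForm k g N).compl₁₂ (J : Submodule k g).subtype (J : Submodule k g).subtype
    have hBsymm : B.IsSymm := ⟨fun x y => LieModule.traceForm_comm k g N _ _⟩
    have hB : B.Nondegenerate := by
      apply LinearMap.BilinForm.Nondegenerate.ofSeparatingLeft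
      intro x hx
      exact Subtype.ext (eq_zero_of_traceForm_eq_zero (N := N) (x : g) x.2
        fun y hy => hx ⟨y, hy⟩)
    let b := Module.finBasis k J
    let b' := B.dualBasis hB b
    have hb : ∀ y : J, ∑ j, B (b' j) y • b j = y := fun y => by
      conv_rhs => rw [← b.sum_repr y]
      refine Finset.sum_congr rfl fun j _ => ?_
      congr 1
      conv_lhs => rw [← b.sum_repr y]
      rw [map_sum, Finset.sum_eq_single j]
      · rw [map_smul, LinearMap.BilinForm.apply_dualBasis_left, if_pos rfl, smul_eq_mul, mul_one]
      · intro i _ hij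
        rw [map_smul, LinearMap.BilinForm.apply_dualBasis_left, if_neg hij, smul_zero]
      · simp
    have hb' : ∀ y : J, ∑ i, B y (b i) • b' i = y := fun y => by
      conv_rhs => rw [← b'.sum_repr y]
      simp only [b', LinearMap.BilinForm.dualBasis_repr_apply]
    let Ω : Module.End k N := ∑ i, toEnd k g N (b i) * toEnd k g N (b' i)
    have hinv : ∀ x : g, ∑ i, (⁅x, (b i : g)⁆ ⊗ₜ[k] (b' i : g) + (b i : g) ⊗ₜ[k] ⁅x, (b' i : g)⁆) = 0 := by
      intro x
      have hskew : ∀ i j, B ⁅x, b' j⁆ (b i) = -B (b' j) ⁅x, b i⁆ := fun i j => by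
        change traceForm k g N ⁅x, (b' j : g)⁆ (b i : g) = -traceForm k g N (b' j : g) ⁅x, (b i : g)⁆
        rw [← lie_skew, map_neg, LinearMap.neg_apply, traceForm_apply_lie_apply]
      let S : J ⊗[k] J →ₗ[k] g ⊗[k] g :=
        TensorProduct.map (J : Submodule k g).subtype (J : Submodule k g).subtype
      -- In dual bases the matrices of ad x are negative transposes of each other, so the two sums
      -- cancel.
      have h : ∑ i, (⁅x, b i⁆ ⊗ₜ[k] b' i + b i ⊗ₜ[k] ⁅x, b' i⁆) = 0 := by
        rw [Finset.sum_add_distrib]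
        have h1 : ∑ i, ⁅x, b i⁆ ⊗ₜ[k] b' i = ∑ i, ∑ j, B (b' j) ⁅x, b i⁆ • (b j ⊗ₜ[k] b' i) :=
          Finset.sum_congr rfl fun i _ => by
            conv_lhs => rw [← hb ⁅x, b i⁆]
            rw [TensorProduct.sum_tmul]
            simp only [TensorProduct.smul_tmul']
        have h2 : ∑ j, b j ⊗ₜ[k] ⁅x, b' j⁆ = ∑ j, ∑ i, B ⁅x, b' j⁆ (b i) • (b j ⊗ₜ[k] b' i) :=
          Finset.sum_congr rfl fun j _ => by
            conv_lhs => rw [← hb' ⁅x, b' j⁆]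
            rw [TensorProduct.tmul_sum]
            simp only [TensorProduct.tmul_smul]
        rw [h1, h2, Finset.sum_comm, ← Finset.sum_add_distrib]
        refine Finset.sum_eq_zero fun j _ => ?_
        rw [← Finset.sum_add_distrib]
        refine Finset.sum_eq_zero fun i _ => ?_
        rw [hskew, neg_smul, add_neg_cancel]
      have := congrArg S h
      rw [map_sum, map_zero] at this
      exact this
    have hΩ : ∀ (x : g) (n : N), Ω ⁅x, n⁆ = ⁅x, Ω n⁆ := by
      intro x n
      let F : g ⊗[k] g →ₗ[k] N := TensorProduct.lift
        ((LieModule.toEnd k g N).toLinearMap.compl₂ ((LieModule.toEnd k g N).toLinearMap.flip n))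
      have hF : ∀ a b : g, F (a ⊗ₜ b) = ⁅a, ⁅b, n⁆⁆ := fun a b => rfl
      have h := congrArg F (hinv x)
      rw [map_sum, map_zero] at h
      simp only [map_add, hF] at h
      simp only [Ω, LinearMap.sum_apply, Module.End.mul_apply, toEnd_apply_apply, lie_sum]
      rw [← sub_eq_zero, ← neg_eq_zero, ← h, ← Finset.sum_sub_distrib, ← Finset.sum_neg_distrib]
      refine Finset.sum_congr rfl fun i _ => ?_
      rw [leibniz_lie x, leibniz_lie x]
      simp
    obtain ⟨μ, hμ⟩ := LieModule.exists_eq_smul_of_isIrreducible Ω hΩ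
    have htr : LinearMap.trace k N Ω = finrank k J := by
      simp only [Ω, map_sum]
      have : ∀ i, LinearMap.trace k N (toEnd k g N (b i) * toEnd k g N (b' i)) = 1 := fun i => by
        have := LinearMap.BilinForm.apply_dualBasis_right hB hBsymm b i i
        rw [if_pos rfl] at this
        exact this
      simp [this]
    refine exists_inner_of_casimir (fun i => (b i : g)) (fun i => (b' i : g)) hinv μ ?_ ?_ D
    · rintro rfl
      have h0 : Ω = 0 := by ext n; simp [hμ]
      rw [h0, map_zero, eq_comm, Nat.cast_eq_zero, finrank_eq_zero_iff_of_free] at htr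
      apply hJ
      rw [LieSubmodule.eq_bot_iff]
      intro x hx
      exact congrArg Subtype.val (Subsingleton.elim (⟨x, hx⟩ : J) 0)
    · intro n
      rw [← hμ]
      simp [Ω]

/-- **Whitehead's first lemma**. -/
theorem LieDerivation.exists_eq_inner [IsAlgClosed k] [LieAlgebra.IsKilling k g]
    (D : LieDerivation k g N) : ∃ n, ∀ x, D x = ⁅x, n⁆ := by
  induction hd : finrank k N using Nat.strong_induction_on generalizing N with
  | _ d ih =>
  by_cases hN : ∃ N₁ : LieSubmodule k g N, N₁ ≠ ⊥ ∧ N₁ ≠ ⊤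
  · obtain ⟨N₁, hbot, htop⟩ := hN
    have hbot' : (N₁ : Submodule k N) ≠ ⊥ := fun h => hbot (by simpa using h)
    have htop' : (N₁ : Submodule k N) ≠ ⊤ := fun h => htop (by simpa using h)
    have h1 : finrank k N₁ < d := by
      rw [← hd]
      exact Submodule.finrank_lt htop'
    have h2 : finrank k (N ⧸ N₁) < d := by
      rw [← hd]
      have := Submodule.finrank_quotient_add_finrank (N₁ : Submodule k N)
      have h0 := Submodule.one_le_finrank_iff.mpr hbot'
      have h3 : finrank k (N ⧸ N₁) = finrank k (N ⧸ (N₁ : Submodule k N)) := rfl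
      omega
    -- First solve modulo a proper submodule N₁; subtracting the inner derivation of a lifted
    -- primitive leaves a derivation into N₁.
    let D₂ : LieDerivation k g (N ⧸ N₁) :=
      { toLinearMap := (LieSubmodule.Quotient.mk' N₁ : N →ₗ[k] N ⧸ N₁) ∘ₗ D.toLinearMap
        leibniz' := fun a b => by simp; rfl }
    obtain ⟨n₂, hn₂⟩ := ih _ h2 D₂ rfl
    obtain ⟨n, rfl⟩ := LieSubmodule.Quotient.surjective_mk' N₁ n₂
    have hmem : ∀ x, D x - ⁅x, n⁆ ∈ N₁ := fun x => by
      have h := hn₂ x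
      rw [← LieModuleHom.map_lie, ← sub_eq_zero] at h
      rw [← LieSubmodule.Quotient.mk_eq_zero, map_sub]
      exact h
    let D₁ : LieDerivation k g N₁ :=
      { toLinearMap := LinearMap.codRestrict (N₁ : Submodule k N)
          (D - LieDerivation.inner k g N n).toLinearMap hmem
        leibniz' := fun a b => by
          ext
          exact (D - LieDerivation.inner k g N n).leibniz' a b }
    obtain ⟨n₁, hn₁⟩ := ih _ h1 D₁ rfl
    refine ⟨n + n₁, fun x => ?_⟩
    have := congrArg Subtype.val (hn₁ x)
    rw [lie_add]
    change D x - ⁅x, n⁆ = ⁅x, (n₁ : N)⁆ at this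
    rw [← this]
    abel
  · push Not at hN
    rcases subsingleton_or_nontrivial N with h | h
    · exact ⟨0, fun x => Subsingleton.elim _ _⟩
    · have : IsIrreducible k g N := LieModule.IsIrreducible.mk hN
      exact exists_inner_of_isIrreducible D

/-- Whitehead's first lemma for cocycles with values in an invariant subspace. -/
theorem exists_inner_of_invariant {g : Type v} [LieRing g] [LieAlgebra k g] [Module.Finite k g]
    [IsAlgClosed k] [LieAlgebra.IsKilling k g] {N : Type w} [AddCommGroup N] [Module k N]
    [Module.Finite k N] (ρ : g →ₗ⁅k⁆ Module.End k N)
    (N' : Submodule k N) (hN' : ∀ x, ∀ n ∈ N', ρ x n ∈ N') (c : g →ₗ[k] N) (hc : ∀ x, c x ∈ N')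
    (hcoc : ∀ x y, c ⁅x, y⁆ = ρ x (c y) - ρ y (c x)) : ∃ n ∈ N', ∀ x, c x = ρ x n := by
  let _ : LieRingModule g N := LieRingModule.compLieHom N ρ
  let _ : LieModule k g N := LieModule.compLieHom N ρ
  let P : LieSubmodule k g N := { N' with lie_mem := fun {x n} hn => hN' x n hn }
  let D : LieDerivation k g P :=
    { toLinearMap := LinearMap.codRestrict N' c hc
      leibniz' := fun a b => by ext; exact hcoc a b }
  obtain ⟨n, hn⟩ := D.exists_eq_inner
  exact ⟨n, n.2, fun x => congrArg Subtype.val (hn x)⟩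

end Whitehead

/-! ### Burnside's theorem, Schur's lemma and contractions of tensors -/

section TensorProducts

attribute [local instance 100] LieRing.ofAssociativeRing

open LieModule Module

/-- **Burnside's theorem**: an irreducible module generates all of its endomorphisms. -/
theorem LieModule.adjoin_range_toEnd_eq_top {k : Type*} {L : Type*} {V : Type*} [Field k]
    [IsAlgClosed k] [LieRing L] [LieAlgebra k L] [AddCommGroup V] [Module k V] [LieRingModule L V]
    [LieModule k L V] [Module.Finite k V] [IsIrreducible k L V] :
    Algebra.adjoin k (Set.range (toEnd k L V)) = ⊤ := by
  set R := Algebra.adjoin k (Set.range (toEnd k L V))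
  have hmem : ∀ x, toEnd k L V x ∈ R := fun x => Algebra.subset_adjoin ⟨x, rfl⟩
  have := nontrivial_of_isIrreducible k L V
  have hsimple : IsSimpleModule R V := by
    rw [isSimpleModule_iff]
    refine ⟨fun S => ?_⟩
    let N : LieSubmodule k L V :=
      { S.restrictScalars k with
        lie_mem := fun {x v} hv => S.smul_mem ⟨_, hmem x⟩ hv }
    rcases eq_bot_or_eq_top N with h | h
    · left
      rw [eq_bot_iff]
      intro v hv
      have : v ∈ N := hv
      rw [h] at this
      simpa using this
    · right
      rw [eq_top_iff]
      intro v _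
      have : v ∈ N := h ▸ LieSubmodule.mem_top v
      exact this
  have hscalar : ∀ T : Module.End R V, ∃ μ : k, ∀ v, T v = μ • v := fun T =>
    exists_eq_smul_of_isIrreducible (L := L) (T.restrictScalars k) fun x v =>
      T.map_smul (⟨_, hmem x⟩ : R) v
  classical
  refine eq_top_iff.mpr fun f _ => ?_
  -- The commutant consists of scalars, so every linear f commutes with it, and the density theorem
  -- finds an element of R agreeing with f on a basis.
  let F : Module.End (Module.End R V) V :=
    { toFun := f
      map_add' := f.map_add
      map_smul' := fun T v => by
        obtain ⟨μ, hμ⟩ := hscalar T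
        simp [hμ] }
  let b := Module.finBasis k V
  obtain ⟨r, hr⟩ := jacobson_density (R := R) F (Finset.univ.image b)
  have : f = r := b.ext fun i => hr (b i) (by simp)
  rw [this]
  exact r.2

/-- A nonzero homomorphism between irreducible modules is an isomorphism. -/
theorem LieModule.nonempty_equiv_of_ne_zero {k : Type*} {L : Type*} {V V' : Type*} [Field k]
    [LieRing L] [LieAlgebra k L] [AddCommGroup V] [Module k V] [LieRingModule L V]
    [LieModule k L V] [AddCommGroup V'] [Module k V'] [LieRingModule L V'] [LieModule k L V']
    [IsIrreducible k L V] [IsIrreducible k L V'] (f : V →ₗ⁅k,L⁆ V') (hf : f ≠ 0) :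
    Nonempty (V ≃ₗ⁅k,L⁆ V') := by
  have hker : f.ker = ⊥ := (eq_bot_or_eq_top f.ker).resolve_right fun h => hf <| by
    ext v
    have : v ∈ f.ker := h ▸ LieSubmodule.mem_top v
    simpa using this
  have hrange : f.range = ⊤ := (eq_bot_or_eq_top f.range).resolve_left fun h => hf <| by
    ext v
    have : f v ∈ f.range := ⟨v, rfl⟩
    rw [h] at this
    simpa using this
  have hbij : Function.Bijective f :=
    ⟨(LieModuleHom.ker_eq_bot f).mp hker, (LieModuleHom.range_eq_top f).mp hrange⟩
  exact ⟨{ f, LinearEquiv.ofBijective (f : V →ₗ[k] V') hbij with }⟩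

section Contraction

variable {k : Type u} [Field k] {ι : Type*} [Fintype ι] [dec : DecidableEq ι]
  {W W' : ι → Type*} [∀ i, AddCommGroup (W i)] [∀ i, Module k (W i)]
  [∀ i, AddCommGroup (W' i)] [∀ i, Module k (W' i)]

/-- Contraction of all tensor factors but the one at `x` with linear functionals. -/
noncomputable def contractAt (x : ι) (η : ∀ i, Dual k (W i)) : (⨂[k] i, W i) →ₗ[k] W x :=
  PiTensorProduct.lift
    -- The component of η at x is ignored; indexing by all of ι avoids tensor products over the
    -- complement of x.
    { toFun := fun w => (∏ i, if i = x then 1 else η i (w i)) • w x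
      map_update_add' := by
        intro dec' w i a b
        obtain rfl : dec' = dec := Subsingleton.elim _ _
        by_cases hi : i = x
        · subst hi
          have h : ∀ c, (∏ j, if j = i then (1 : k) else η j (Function.update w i c j)) =
              ∏ j, if j = i then 1 else η j (w j) := fun c =>
            Finset.prod_congr rfl fun j _ => by
              by_cases hj : j = i
              · simp [hj]
              · simp [hj]
          simp [h, smul_add]
        · have h : ∀ c, (∏ j, if j = x then (1 : k) else η j (Function.update w i c j)) =
              η i c * ∏ j ∈ Finset.univ.erase i, if j = x then 1 else η j (w j) := fun c => by
            rw [← Finset.mul_prod_erase _ _ (Finset.mem_univ i)]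
            congr 1
            · simp [hi]
            · refine Finset.prod_congr rfl fun j hj => ?_
              simp [Finset.ne_of_mem_erase hj]
          simp only [h, Function.update_of_ne (Ne.symm hi), map_add, add_mul, add_smul]
      map_update_smul' := by
        intro dec' w i a b
        obtain rfl : dec' = dec := Subsingleton.elim _ _
        by_cases hi : i = x
        · subst hi
          have h : ∀ c, (∏ j, if j = i then (1 : k) else η j (Function.update w i c j)) =
              ∏ j, if j = i then 1 else η j (w j) := fun c =>
            Finset.prod_congr rfl fun j _ => by
              by_cases hj : j = i
              · simp [hj]
              · simp [hj]
          simp only [h, Function.update_self]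
          rw [smul_comm]
        · have h : ∀ c, (∏ j, if j = x then (1 : k) else η j (Function.update w i c j)) =
              η i c * ∏ j ∈ Finset.univ.erase i, if j = x then 1 else η j (w j) := fun c => by
            rw [← Finset.mul_prod_erase _ _ (Finset.mem_univ i)]
            congr 1
            · simp [hi]
            · refine Finset.prod_congr rfl fun j hj => ?_
              simp [Finset.ne_of_mem_erase hj]
          simp only [h, Function.update_of_ne (Ne.symm hi), map_smul, smul_eq_mul, mul_assoc,
            mul_smul] }

theorem contractAt_tprod (x : ι) (η : ∀ i, Dual k (W i)) (w : ∀ i, W i) :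
    contractAt x η (PiTensorProduct.tprod k w) =
      (∏ i, if i = x then 1 else η i (w i)) • w x := by
  simp [contractAt]

theorem contractAt_map (x : ι) (η : ∀ i, Dual k (W' i)) (f : ∀ i, W i →ₗ[k] W' i)
    (z : ⨂[k] i, W i) :
    contractAt x η (PiTensorProduct.map f z) = f x (contractAt x (fun i => η i ∘ₗ f i) z) := by
  suffices contractAt x η ∘ₗ PiTensorProduct.map f = f x ∘ₗ contractAt x (fun i => η i ∘ₗ f i) from
    LinearMap.congr_fun this z
  ext w
  simp [contractAt_tprod]

theorem contractAt_actAt_self (x : ι) (η : ∀ i, Dual k (W i)) (f : Module.End k (W x))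
    (z : ⨂[k] i, W i) : contractAt x η (actAt W x f z) = f (contractAt x η z) := by
  suffices contractAt x η ∘ₗ actAt W x f = f ∘ₗ contractAt x η from LinearMap.congr_fun this z
  ext w
  simp only [LinearMap.compMultilinearMap_apply, LinearMap.comp_apply, actAt_apply,
    PiTensorProduct.map_tprod, contractAt_tprod, map_smul, Function.update_self]
  congr 1
  refine Finset.prod_congr rfl fun i _ => ?_
  by_cases hi : i = x
  · simp [hi]
  · simp [hi]

theorem contractAt_actAt_of_ne {x y : ι} (hxy : y ≠ x) (η : ∀ i, Dual k (W i))
    (f : Module.End k (W y)) (z : ⨂[k] i, W i) : contractAt x η (actAt W y f z) =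
      contractAt x (Function.update η y (η y ∘ₗ f)) z := by
  rw [actAt_apply, contractAt_map, Function.update_of_ne hxy.symm, LinearMap.id_apply]
  congr 2
  ext i : 1
  by_cases hi : i = y
  · subst hi; simp
  · simp [hi]

/-- Each coordinate in the product basis factors through a contraction by coordinate functionals. -/
theorem eq_zero_of_contractAt_eq_zero [∀ i, Module.Finite k (W i)] (x : ι) (z : ⨂[k] i, W i)
    (h : ∀ η, contractAt x η z = 0) : z = 0 := by
  let b := fun i => Module.finBasis k (W i)
  apply (Basis.piTensorProduct b).ext_elem
  intro p
  have key : (Basis.piTensorProduct b).coord p =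
      (b x).coord (p x) ∘ₗ contractAt x (fun i => (b i).coord (p i)) := by
    ext w
    simp only [LinearMap.compMultilinearMap_apply, LinearMap.comp_apply, contractAt_tprod,
      Basis.coord_apply, Basis.piTensorProduct_repr_tprod_apply, map_smul,
      smul_eq_mul]
    rw [← Finset.mul_prod_erase _ _ (Finset.mem_univ x),
      ← Finset.mul_prod_erase (s := Finset.univ) (a := x)
        (f := fun i => if i = x then (1 : k) else _) (Finset.mem_univ x), if_pos rfl, one_mul,
      mul_comm]
    congr 1
    refine Finset.prod_congr rfl fun i hi => ?_
    rw [if_neg (Finset.ne_of_mem_erase hi)]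
  have := LinearMap.congr_fun key z
  rw [LinearMap.comp_apply, h, map_zero] at this
  simpa using this

/-- Rank one operators at all factors but `x` contract all these factors. -/
theorem map_smulRight_eq (x : ι) (η : ∀ i, Dual k (W i)) (v : ∀ i, W' i) (f : ∀ i, W i →ₗ[k] W' i)
    (hf : ∀ i, i ≠ x → f i = (η i).smulRight (v i)) (z : ⨂[k] i, W i) :
    PiTensorProduct.map f z =
      PiTensorProduct.tprod k (Function.update v x (f x (contractAt x η z))) := by
  have hlin : ∀ a, (PiTensorProduct.tprod k).toLinearMap v x a =
    PiTensorProduct.tprod k (Function.update v x a) := fun a => rfl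
  suffices PiTensorProduct.map f =
      (PiTensorProduct.tprod k).toLinearMap v x ∘ₗ f x ∘ₗ contractAt x η from
    LinearMap.congr_fun this z
  ext w
  simp only [LinearMap.compMultilinearMap_apply, LinearMap.comp_apply, contractAt_tprod,
    PiTensorProduct.map_tprod, map_smul]
  rw [hlin]
  rw [← MultilinearMap.map_smul_univ]
  congr 1
  ext i : 1
  by_cases hi : i = x
  · subst hi; simp
  · simp [hi, hf i hi]

omit [Fintype ι] in
theorem map_insert_piecewise {i : ι} {S : Finset ι} (hi : i ∉ S) (f : ∀ i, Module.End k (W i)) :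
    PiTensorProduct.map ((insert i S).piecewise f 1) =
      actAt W i (f i) ∘ₗ PiTensorProduct.map (S.piecewise f 1) := by
  rw [actAt_apply, ← PiTensorProduct.map_comp]
  congr 1
  ext j : 1
  by_cases hj : j = i
  · subst hj
    simp [hi]
    rfl
  · simp [hj, Finset.piecewise]

/-- An operator commuting with operators at each single factor commutes with their product. -/
theorem comp_map_of_actAt (T : (⨂[k] i, W i) →ₗ[k] ⨂[k] i, W' i)
    (f : ∀ i, Module.End k (W i)) (f' : ∀ i, Module.End k (W' i))
    (h : ∀ i, T ∘ₗ actAt W i (f i) = actAt W' i (f' i) ∘ₗ T) :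
    T ∘ₗ PiTensorProduct.map f = PiTensorProduct.map f' ∘ₗ T := by
  have key : ∀ S : Finset ι, T ∘ₗ PiTensorProduct.map (S.piecewise f 1) =
      PiTensorProduct.map (S.piecewise f' 1) ∘ₗ T := by
    intro S
    induction S using Finset.induction_on with
    | empty =>
      simp only [Finset.piecewise_empty]
      erw [PiTensorProduct.map_one, PiTensorProduct.map_one]
      rfl
    | insert i S hi ih =>
      rw [map_insert_piecewise hi, map_insert_piecewise hi, ← LinearMap.comp_assoc, h, LinearMap.comp_assoc, ih, LinearMap.comp_assoc]
  simpa using key Finset.univ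

end Contraction

end TensorProducts

/-! ### Operators between tensor products that commute with the factors -/

section Intertwiners

attribute [local instance 100] LieRing.ofAssociativeRing

open LieModule Module

variable {k : Type u} [Field k] {g : Type v} [LieRing g] [LieAlgebra k g]
  {ι : Type*} [Fintype ι] [dec : DecidableEq ι]
  {W W' : ι → Type w} [∀ i, AddCommGroup (W i)] [∀ i, Module k (W i)]
  [∀ i, AddCommGroup (W' i)] [∀ i, Module k (W' i)]
  [∀ i, LieRingModule g (W i)] [∀ i, LieModule k g (W i)]
  [∀ i, LieRingModule g (W' i)] [∀ i, LieModule k g (W' i)]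
  [∀ i, Module.Finite k (W i)] [∀ i, Module.Finite k (W' i)]

omit [∀ i, Module.Finite k (W i)] in
-- Freezing the other factors in the source and contracting them in the target turns T into module
-- maps W y → W' y, which vanish by Schur; these maps together determine T.
theorem eq_zero_of_intertwines {y : ι} (hW : LieModule.IsIrreducible k g (W y))
    (hW' : LieModule.IsIrreducible k g (W' y)) (hne : IsEmpty (W y ≃ₗ⁅k,g⁆ W' y))
    (T : (⨂[k] i, W i) →ₗ[k] ⨂[k] i, W' i)
    (hT : ∀ u, T ∘ₗ actAt W y (toEnd k g (W y) u) = actAt W' y (toEnd k g (W' y) u) ∘ₗ T) :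
    T = 0 := by
  ext w
  apply eq_zero_of_contractAt_eq_zero y
  intro η
  let f : W y →ₗ[k] W' y :=
    contractAt y η ∘ₗ T ∘ₗ (PiTensorProduct.tprod k).toLinearMap w y
  have hf : ∀ a, f a = contractAt y η (T (PiTensorProduct.tprod k (Function.update w y a))) :=
    fun a => rfl
  let F : W y →ₗ⁅k,g⁆ W' y :=
    { f with
      map_lie' := fun {u a} => by
        change f ⁅u, a⁆ = ⁅u, f a⁆
        have h := LinearMap.congr_fun (hT u) (PiTensorProduct.tprod k (Function.update w y a))
        simp only [LinearMap.comp_apply] at h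
        rw [actAt_apply, PiTensorProduct.map_tprod] at h
        have h2 : (fun i => (Function.update (fun _ => LinearMap.id) y (toEnd k g (W y) u) :
            ∀ i, W i →ₗ[k] W i) i (Function.update w y a i)) = Function.update w y ⁅u, a⁆ := by
          ext i : 1
          by_cases hi : i = y
          · subst hi; simp
          · simp [hi]
        rw [h2] at h
        rw [hf, h, contractAt_actAt_self, hf]
        rfl }
  have hF : F = 0 := by
    by_contra h
    obtain ⟨e⟩ := nonempty_equiv_of_ne_zero F h
    exact hne.false e
  have h0 : f (w y) = 0 := LieModuleHom.congr_fun hF (w y)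
  rw [hf, Function.update_eq_self] at h0
  simpa using h0

omit [Fintype ι] [∀ i, Module.Finite k (W' i)] in
/-- Intertwining the action of an irreducible factor means commuting with all operators there. -/
theorem comp_actAt_of_intertwines [IsAlgClosed k] {y : ι}
    (hW : LieModule.IsIrreducible k g (W y)) (θ : W y ≃ₗ⁅k,g⁆ W' y)
    (T : (⨂[k] i, W i) →ₗ[k] ⨂[k] i, W' i)
    (hT : ∀ u, T ∘ₗ actAt W y (toEnd k g (W y) u) = actAt W' y (toEnd k g (W' y) u) ∘ₗ T)
    (f : Module.End k (W y)) :
    T ∘ₗ actAt W y f = actAt W' y ((θ : W y ≃ₗ[k] W' y).conj f) ∘ₗ T := by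
  have hf : f ∈ Algebra.adjoin k (Set.range (toEnd k g (W y))) := by
    rw [LieModule.adjoin_range_toEnd_eq_top]; trivial
  induction hf using Algebra.adjoin_induction with
  | mem f hf =>
    obtain ⟨u, rfl⟩ := hf
    rw [hT]
    congr 2
    ext a
    obtain ⟨b, rfl⟩ := θ.toLinearEquiv.surjective a
    have h1 : (θ : W y ≃ₗ[k] W' y).symm ((θ : W y ≃ₗ[k] W' y) b) = b :=
      LinearEquiv.symm_apply_apply _ _
    rw [LinearEquiv.conj_apply]
    simp only [LinearMap.comp_apply, LinearEquiv.coe_coe]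
    erw [h1]
    exact (θ.map_lie u b).symm
  | algebraMap r =>
    have h1 : ∀ {X : ι → Type w} [∀ i, AddCommGroup (X i)] [∀ i, Module k (X i)],
        actAt X y (1 : Module.End k (X y)) = 1 := by
      intro X _ _
      rw [actAt_apply]
      have : Function.update (fun _ => LinearMap.id) y 1 =
        (fun i => (LinearMap.id : X i →ₗ[k] X i)) := Function.update_eq_self _ _
      rw [this, PiTensorProduct.map_id]; rfl
    rw [Algebra.algebraMap_eq_smul_one, map_smul, map_smul, map_smul, h1]
    have h2 : (θ : W y ≃ₗ[k] W' y).conj 1 = 1 := LinearEquiv.conj_id _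
    rw [h2, h1]
    ext; simp
  | add a b _ _ ha hb =>
    rw [map_add, map_add, map_add, LinearMap.comp_add, LinearMap.add_comp, ha, hb]
  | mul a b _ _ ha hb =>
    have h2 : (θ : W y ≃ₗ[k] W' y).conj (a * b) = (θ : W y ≃ₗ[k] W' y).conj a *
      (θ : W y ≃ₗ[k] W' y).conj b := LinearEquiv.conj_comp _ _ _
    rw [h2, actAt_mul, actAt_mul, Module.End.mul_eq_comp, Module.End.mul_eq_comp,
      ← LinearMap.comp_assoc, ha, LinearMap.comp_assoc, hb, LinearMap.comp_assoc]

omit [∀ i, Module.Finite k (W' i)] in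
/-- An operator commuting with all operators at the factors other than `x` only acts at `x`. -/
theorem exists_eq_map_update (x : ι) (hnt : ∀ i, i ≠ x → Nontrivial (W i))
    (θ : ∀ i, i ≠ x → (W i ≃ₗ[k] W' i)) (θ' : ∀ i, W i →ₗ[k] W' i)
    (hθ : ∀ i (hi : i ≠ x), θ' i = θ i hi)
    (T : (⨂[k] i, W i) →ₗ[k] ⨂[k] i, W' i)
    (hT : ∀ i (hi : i ≠ x) f, T ∘ₗ actAt W i f = actAt W' i ((θ i hi).conj f) ∘ₗ T) :
    ∃ T₀ : W x →ₗ[k] W' x, T = PiTensorProduct.map (Function.update θ' x T₀) := by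
  have hη : ∀ i, ∃ (w : W i) (η : Dual k (W i)), i ≠ x → η w = 1 := by
    intro i
    by_cases hi : i = x
    · exact ⟨0, 0, fun h => absurd hi h⟩
    · have := hnt i hi
      obtain ⟨w, hw⟩ := exists_ne (0 : W i)
      obtain ⟨η, hη⟩ := Module.Projective.exists_dual_ne_zero k hw
      exact ⟨(η w)⁻¹ • w, η, fun _ => by simp [hη]⟩
  choose w₀ η hη using hη
  let η' : ∀ i, Dual k (W' i) := fun i => if hi : i ≠ x then η i ∘ₗ (θ i hi).symm else 0
  let T₀ : W x →ₗ[k] W' x :=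
    contractAt x η' ∘ₗ T ∘ₗ (PiTensorProduct.tprod k).toLinearMap w₀ x
  refine ⟨T₀, ?_⟩
  ext v
  -- Rank one operators carrying the base vectors `w₀` to v. Moving T past them replaces the other
  -- tensor factors of its output by the images θ(vᵢ), and leaves `T₀` at x.
  let f : ∀ i, Module.End k (W i) := fun i => if i = x then LinearMap.id else (η i).smulRight (v i)
  let f' : ∀ i, Module.End k (W' i) :=
    fun i => if hi : i ≠ x then (θ i hi).conj (f i) else LinearMap.id
  have hid : ∀ {X : ι → Type w} [∀ i, AddCommGroup (X i)] [∀ i, Module k (X i)],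
      actAt X x (LinearMap.id : Module.End k (X x)) = LinearMap.id := by
    intro X _ _
    rw [actAt_apply]
    have : Function.update (fun _ => LinearMap.id) x LinearMap.id =
      (fun i => (LinearMap.id : X i →ₗ[k] X i)) := Function.update_eq_self _ _
    rw [this, PiTensorProduct.map_id]
  have hcomp := comp_map_of_actAt T f f' (fun i => by
    by_cases hi : i = x
    · subst hi
      simp only [f, f', if_true, ne_eq, not_true, dif_neg, not_false_eq_true]
      erw [hid, hid]
      rfl
    · rw [hT i hi]
      simp [f', hi])
  have hv : PiTensorProduct.tprod k v =
      PiTensorProduct.map f (PiTensorProduct.tprod k (Function.update w₀ x (v x))) := by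
    rw [PiTensorProduct.map_tprod]
    congr 1
    ext i : 1
    by_cases hi : i = x
    · subst hi; simp [f]
    · simp [f, hi, hη i hi]
  simp only [LinearMap.compMultilinearMap_apply]
  rw [hv, ← LinearMap.comp_apply, hcomp, LinearMap.comp_apply,
    map_smulRight_eq x η' (fun i => θ' i (v i)) f', ← hv, PiTensorProduct.map_tprod]
  · congr 1
    ext i : 1
    by_cases hi : i = x
    · subst hi
      simp [f', T₀]
    · simp [hi]
  · intro i hi
    ext a
    simp [f', f, η', hi, LinearEquiv.conj_apply, hθ i hi]

/-- The tensor factors of an irreducible tensor product are irreducible. -/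
theorem isIrreducible_of_tensor [Nontrivial (⨂[k] i, W i)]
    (h : ∀ Z : Submodule k (⨂[k] i, W i),
      (∀ i (u : g), ∀ z ∈ Z, actAt W i (toEnd k g (W i) u) z ∈ Z) → Z = ⊥ ∨ Z = ⊤) (x : ι) :
    LieModule.IsIrreducible k g (W x) := by
  have hnt : ∀ i, Nontrivial (W i) := by
    intro i
    by_contra hi
    rw [not_nontrivial_iff_subsingleton] at hi
    have : (LinearMap.id : (⨂[k] i, W i) →ₗ[k] _) = 0 := by
      ext w
      simp only [LinearMap.compMultilinearMap_apply, LinearMap.id_apply, LinearMap.zero_apply]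
      exact (PiTensorProduct.tprod k).map_coord_zero i (Subsingleton.elim _ _)
    obtain ⟨z, hz⟩ := exists_ne (0 : ⨂[k] i, W i)
    exact hz (LinearMap.congr_fun this z)
  have hη : ∀ i, ∃ (w : W i) (η : Dual k (W i)), η w = 1 := by
    intro i
    obtain ⟨w, hw⟩ := exists_ne (0 : W i)
    obtain ⟨η, hη⟩ := Module.Projective.exists_dual_ne_zero k hw
    exact ⟨(η w)⁻¹ • w, η, by simp [hη]⟩
  choose w₀ η₀ hη₀ using hη
  refine LieModule.IsIrreducible.mk fun P hP => ?_
  -- The tensors all of whose contractions to x lie in P. An operator at another factor only changes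
  -- η, and at x submodule stability applies, so Z is invariant; it is proper and nonzero whenever P
  -- is.
  let Z : Submodule k (⨂[k] i, W i) := ⨅ η : ∀ i, Dual k (W i),
    (P : Submodule k (W x)).comap (contractAt x η)
  have hZ : ∀ z, z ∈ Z ↔ ∀ η, contractAt x η z ∈ P := fun z => by
    simp [Z, Submodule.mem_iInf]
  have hupd : ∀ (η : ∀ i, Dual k (W i)) (a : W x), contractAt x η
      (PiTensorProduct.tprod k (Function.update w₀ x a)) =
      (∏ i, if i = x then 1 else η i (w₀ i)) • a := by
    intro η a
    rw [contractAt_tprod, Function.update_self]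
    congr 1
    refine Finset.prod_congr rfl fun i _ => ?_
    by_cases hi : i = x
    · simp [hi]
    · simp [hi]
  have hupd₀ : ∀ a : W x, contractAt x η₀
      (PiTensorProduct.tprod k (Function.update w₀ x a)) = a := by
    intro a
    rw [hupd, Finset.prod_eq_one, one_smul]
    intro i _
    by_cases hi : i = x
    · simp [hi]
    · simp [hi, hη₀]
  rcases h Z (fun i u z hz => (hZ _).mpr fun η => by
    by_cases hi : i = x
    · subst hi
      rw [contractAt_actAt_self]
      exact P.lie_mem ((hZ z).mp hz η)
    · rw [contractAt_actAt_of_ne hi]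
      exact (hZ z).mp hz _) with h0 | h1
  · exfalso
    apply hP
    rw [LieSubmodule.eq_bot_iff]
    intro a ha
    have hmem : PiTensorProduct.tprod k (Function.update w₀ x a) ∈ Z :=
      (hZ _).mpr fun η => by rw [hupd]; exact P.smul_mem _ ha
    rw [h0, Submodule.mem_bot] at hmem
    rw [← hupd₀ a, hmem, map_zero]
  · rw [eq_top_iff]
    intro a _
    have hmem : PiTensorProduct.tprod k (Function.update w₀ x a) ∈ Z := h1 ▸ Submodule.mem_top
    rw [← hupd₀ a]
    exact (hZ _).mp hmem η₀

/-- A tensor product of irreducible modules is irreducible. -/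
theorem eq_bot_or_eq_top_of_irreducible_factors [IsAlgClosed k]
    (hW : ∀ i, LieModule.IsIrreducible k g (W i)) (Z : Submodule k (⨂[k] i, W i))
    (hZ : ∀ i (u : g), ∀ z ∈ Z, actAt W i (toEnd k g (W i) u) z ∈ Z) : Z = ⊥ ∨ Z = ⊤ := by
  have hact : ∀ i (f : Module.End k (W i)), ∀ z ∈ Z, actAt W i f z ∈ Z := by
    intro i f
    have := hW i
    have hf : f ∈ Algebra.adjoin k (Set.range (toEnd k g (W i))) := by
      rw [LieModule.adjoin_range_toEnd_eq_top]; trivial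
    induction hf using Algebra.adjoin_induction with
    | mem f hf =>
      obtain ⟨u, rfl⟩ := hf
      exact hZ i u
    | algebraMap r =>
      intro z hz
      have h1 : actAt W i (1 : Module.End k (W i)) = 1 := by
        rw [actAt_apply]
        have : Function.update (fun _ => LinearMap.id) i 1 =
          (fun i => (LinearMap.id : W i →ₗ[k] W i)) := Function.update_eq_self _ _
        rw [this, PiTensorProduct.map_id]; rfl
      rw [Algebra.algebraMap_eq_smul_one, map_smul, h1]
      exact Z.smul_mem r hz
    | add a b _ _ ha hb =>
      intro z hz
      rw [map_add]
      exact Z.add_mem (ha z hz) (hb z hz)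
    | mul a b _ _ ha hb =>
      intro z hz
      rw [actAt_mul]
      exact ha _ (hb z hz)
  have hmap : ∀ f : ∀ i, Module.End k (W i), ∀ z ∈ Z, PiTensorProduct.map f z ∈ Z := by
    intro f
    have key : ∀ S : Finset ι, ∀ z ∈ Z, PiTensorProduct.map (S.piecewise f 1) z ∈ Z := by
      intro S
      induction S using Finset.induction_on with
      | empty =>
        intro z hz
        simp only [Finset.piecewise_empty]
        erw [PiTensorProduct.map_one]
        exact hz
      | insert i S hi ih =>
        intro z hz
        rw [map_insert_piecewise hi]
        exact hact _ _ _ (ih z hz)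
    simpa using key Finset.univ
  by_cases h0 : Z = ⊥
  · exact Or.inl h0
  right
  obtain ⟨z, hz, hz0⟩ := Submodule.exists_mem_ne_zero_of_ne_bot h0
  let b := fun i => Module.finBasis k (W i)
  obtain ⟨p, hp⟩ : ∃ p, (Basis.piTensorProduct b).repr z p ≠ 0 := by
    by_contra! hcon
    exact hz0 ((Basis.piTensorProduct b).ext_elem fun p => by rw [hcon]; simp)
  rw [eq_top_iff, ← PiTensorProduct.span_tprod_eq_top, Submodule.span_le]
  rintro _ ⟨w, rfl⟩
  -- By Burnside Z is stable under all products of operators. A product of rank one operators reads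
  -- off one nonzero coordinate of z and returns an arbitrary pure tensor.
  have hrank : PiTensorProduct.map (fun i => ((b i).coord (p i)).smulRight (w i)) =
      ((Basis.piTensorProduct b).coord p).smulRight (PiTensorProduct.tprod k w) := by
    ext v
    simp only [LinearMap.compMultilinearMap_apply, PiTensorProduct.map_tprod,
      LinearMap.smulRight_apply, Basis.coord_apply, Basis.piTensorProduct_repr_tprod_apply]
    rw [MultilinearMap.map_smul_univ]
  have h1 := hmap (fun i => ((b i).coord (p i)).smulRight (w i)) z hz
  rw [hrank, LinearMap.smulRight_apply, Basis.coord_apply] at h1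
  exact (Submodule.smul_mem_iff _ hp).mp h1

end Intertwiners

/-! ### Modules for commuting copies of g -/

section Decomposition

attribute [local instance 100] LieRing.ofAssociativeRing

open LieModule Module

variable {k : Type u} [Field k] {g : Type v} [LieRing g] [LieAlgebra k g]

/-- A nonzero finite-dimensional module contains an irreducible submodule. -/
theorem LieModule.exists_isAtom (V : Type*) [AddCommGroup V] [Module k V] [LieRingModule g V]
    [LieModule k g V] [Module.Finite k V] [Nontrivial V] :
    ∃ P : LieSubmodule k g V, IsAtom P := by
  have : IsAtomic (LieSubmodule k g V) := 
    have := LieSubmodule.wellFoundedLT_of_isArtinian k g V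
    isAtomic_of_orderBot_wellFounded_lt wellFounded_lt
  obtain ⟨P, hP, -⟩ := (eq_bot_or_exists_atom_le (⊤ : LieSubmodule k g V)).resolve_left top_ne_bot
  exact ⟨P, hP⟩

theorem LieModule.isIrreducible_of_isAtom {V : Type*} [AddCommGroup V] [Module k V]
    [LieRingModule g V] [LieModule k g V] {P : LieSubmodule k g V} (hP : IsAtom P) :
    LieModule.IsIrreducible k g P := by
  have : Nontrivial P := by
    rw [LieSubmodule.nontrivial_iff_ne_bot]
    exact hP.1
  refine LieModule.IsIrreducible.mk fun Q hQ => ?_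
  have h1 : Q.map P.incl ≤ P := by
    rintro _ ⟨q, -, rfl⟩
    exact q.2
  have h2 : Q.map P.incl ≠ ⊥ := by
    intro h
    apply hQ
    rw [LieSubmodule.eq_bot_iff] at h ⊢
    intro q hq
    exact Subtype.ext (h _ ⟨q, hq, rfl⟩)
  have h3 := (hP.le_iff.mp h1).resolve_left h2
  rw [eq_top_iff]
  intro q _
  have : (q : V) ∈ Q.map P.incl := by rw [h3]; exact q.2
  obtain ⟨q', hq', h⟩ := this
  rwa [← Subtype.ext (show (q' : V) = q from h)]

/-- Commuting representations admit a nonzero equivariant multilinear map from irreducible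
modules. -/
theorem exists_multilinear_of_commuting (n : ℕ) (V : Type w) [AddCommGroup V]
    [Module k V] [Module.Finite k V] [Nontrivial V] (ρ : Fin n → g →ₗ⁅k⁆ Module.End k V)
    (hρ : ∀ i j, i ≠ j → ∀ u v, ρ i u * ρ j v = ρ j v * ρ i u) :
    ∃ (W : Fin n → FDLieModule.{u, v, w} k g) (f : MultilinearMap k (fun i => W i) V),
      (∀ i, LieModule.IsIrreducible k g (W i)) ∧ f ≠ 0 ∧
      ∀ i u w, ρ i u (f w) = f (Function.update w i ⁅u, w i⁆) := by
  induction n generalizing V with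
  | zero =>
    obtain ⟨v, hv⟩ := exists_ne (0 : V)
    refine ⟨fun i => i.elim0, MultilinearMap.constOfIsEmpty k _ v, fun i => i.elim0, fun h => ?_,
      fun i => i.elim0⟩
    exact hv (congrArg (fun f => f (fun i => i.elim0)) h)
  | succ n ih =>
    let _ : LieRingModule g V := LieRingModule.compLieHom V (ρ 0)
    let _ : LieModule k g V := LieModule.compLieHom V (ρ 0)
    obtain ⟨P, hP⟩ := LieModule.exists_isAtom (k := k) (g := g) V
    have hPirr := LieModule.isIrreducible_of_isAtom hP
    let W₀ : FDLieModule.{u, v, w} k g := { carrier := P }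
    -- The multiplicity space of P in V for the first representation. The remaining representations
    -- act on it by composition, which allows induction.
    let H : Submodule k (P →ₗ[k] V) :=
      { carrier := {h | ∀ u w, h ⁅u, w⁆ = ρ 0 u (h w)}
        add_mem' := fun {a b} ha hb u w => by simp [ha u w, hb u w]
        zero_mem' := fun u w => by simp
        smul_mem' := fun c a ha u w => by simp [ha u w] }
    have := nontrivial_of_isIrreducible k g P
    have : Nontrivial H := by
      obtain ⟨p, hp⟩ := exists_ne (0 : P)
      refine ⟨⟨⟨(P : Submodule k V).subtype, fun u w => rfl⟩, 0, fun h => hp ?_⟩⟩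
      exact Subtype.ext (LinearMap.congr_fun (congrArg Subtype.val h) p)
    let ρ' : Fin n → g →ₗ⁅k⁆ Module.End k H := fun i =>
      { toFun := fun u =>
          { toFun := fun h => ⟨ρ i.succ u ∘ₗ h.1, fun v w => by
              have := LinearMap.congr_fun (hρ i.succ 0 (Fin.succ_ne_zero i) u v) (h.1 w)
              rw [LinearMap.comp_apply, h.2 v w]
              exact this⟩
            map_add' := fun a b => by ext; simp
            map_smul' := fun c a => by ext; simp }
        map_add' := fun u v => by ext; simp
        map_smul' := fun c u => by ext; simp
        map_lie' := fun {u v} => by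
          ext
          simp [LieRing.of_associative_ring_bracket] }
    obtain ⟨W', f', hW', hf', hequiv⟩ := ih H ρ' (fun i j hij u v => by
      ext h w
      exact LinearMap.congr_fun (hρ i.succ j.succ (fun h => hij (Fin.succ_injective _ h)) u v) (h.1 w))
    let W : Fin (n + 1) → FDLieModule.{u, v, w} k g := Fin.cons W₀ W'
    let ev : P →ₗ[k] H →ₗ[k] V := (Submodule.subtype H).flip
    let F : (W 0) →ₗ[k] MultilinearMap k (fun i : Fin n => (W i.succ : Type w)) V :=
      { toFun := fun a => (ev a).compMultilinearMap f'
        map_add' := fun a b => by ext w; exact map_add (f' w).1 _ _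
        map_smul' := fun c a => by ext w; exact map_smul (f' w).1 _ _ }
    refine ⟨W, LinearMap.uncurryLeft (M := fun i => (W i : Type w)) F, ?_, ?_, ?_⟩
    · intro i
      refine Fin.cases ?_ (fun i => ?_) i
      · exact hPirr
      · exact hW' i
    · intro h
      apply hf'
      ext w a
      have := congrArg (fun f => f (Fin.cons (α := fun i => (W i : Type w)) a w)) h
      exact this
    · intro i u w
      rw [LinearMap.uncurryLeft_apply, LinearMap.uncurryLeft_apply]
      refine Fin.cases ?_ (fun i => ?_) i
      · rw [Function.update_self, Fin.tail_update_zero]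
        exact ((f' (Fin.tail w)).2 u (w 0)).symm
      · rw [Function.update_of_ne (Fin.succ_ne_zero i).symm, Fin.tail_update_succ]
        have := congrArg (fun h => h.1 (w 0)) (hequiv i u (Fin.tail w))
        exact this

/-- An irreducible space with commuting representations is a tensor product of irreducible
modules. -/
theorem exists_tensor_decomposition [IsAlgClosed k] {ι : Type*} [Fintype ι] [dec : DecidableEq ι]
    (V : Type w) [AddCommGroup V] [Module k V] [Module.Finite k V] [Nontrivial V]
    (ρ : ι → g →ₗ⁅k⁆ Module.End k V)
    (hρ : ∀ i j, i ≠ j → ∀ u v, ρ i u * ρ j v = ρ j v * ρ i u)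
    (hirr : ∀ Z : Submodule k V, (∀ i u, ∀ z ∈ Z, ρ i u z ∈ Z) → Z = ⊥ ∨ Z = ⊤) :
    ∃ (W : ι → FDLieModule.{u, v, w} k g) (e : V ≃ₗ[k] (⨂[k] i, W i)),
      ∀ i u v, e (ρ i u v) = actAt (fun i => (W i : Type w)) i (toEnd k g (W i) u) (e v) := by
  let σ := (Fintype.equivFin ι).symm
  obtain ⟨W', f', hW', hf', hequiv'⟩ := exists_multilinear_of_commuting (Fintype.card ι) V
    (fun j => ρ (σ j)) (fun i j hij => hρ _ _ (fun h => hij (σ.injective h)))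
  let W : ι → FDLieModule.{u, v, w} k g := fun i => W' (σ.symm i)
  let f : MultilinearMap k (fun i => (W i : Type w)) V :=
    MultilinearMap.domDomCongrLinearEquiv' k k (fun i => (W' i : Type w)) V σ f'
  have hfx : ∀ w, f w = f' ((σ.piCongrLeft' (fun i => (W' i : Type w))).symm w) := fun w => rfl
  have hequiv : ∀ i u w, ρ i u (f w) = f (Function.update w i ⁅u, w i⁆) := by
    intro i u w
    rw [hfx, hfx, Function.piCongrLeft'_symm_update]
    have h1 := hequiv' (σ.symm i) u ((σ.piCongrLeft' (fun i => (W' i : Type w))).symm w)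
    rw [σ.apply_symm_apply] at h1
    have h2 : (σ.piCongrLeft' (fun i => (W' i : Type w))).symm w (σ.symm i) = w i :=
      congrFun ((σ.piCongrLeft' (fun i => (W' i : Type w))).apply_symm_apply w) i
    rw [h1, h2]
  have hf : f ≠ 0 := fun h => hf' <| by
    apply (MultilinearMap.domDomCongrLinearEquiv' k k (fun i => (W' i : Type w)) V σ).injective
    rw [map_zero]
    exact h
  have hW : ∀ i, LieModule.IsIrreducible k g (W i) := fun i => hW' _
  let T : (⨂[k] i, (W i : Type w)) →ₗ[k] V := PiTensorProduct.lift f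
  have hT : ∀ i u z, T (actAt (fun i => (W i : Type w)) i (toEnd k g (W i) u) z) = ρ i u (T z) := by
    intro i u z
    suffices T ∘ₗ actAt (fun i => (W i : Type w)) i (toEnd k g (W i) u) = ρ i u ∘ₗ T from
      LinearMap.congr_fun this z
    ext w
    simp only [LinearMap.compMultilinearMap_apply, LinearMap.comp_apply, actAt_apply,
      PiTensorProduct.map_tprod, T, PiTensorProduct.lift.tprod, hequiv]
    congr 1
    ext j : 1
    by_cases hj : j = i
    · subst hj; simp
    · simp [hj]
  have hT0 : T ≠ 0 := fun h => hf <| by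
    ext w
    have := LinearMap.congr_fun h (PiTensorProduct.tprod k w)
    simpa [T] using this
  -- Both sides are irreducible for the joint action of all the copies of g, so the nonzero
  -- intertwiner T is bijective.
  have hker : LinearMap.ker T = ⊥ :=
    (eq_bot_or_eq_top_of_irreducible_factors (g := g) hW (LinearMap.ker T) fun i u z hz => by
      rw [LinearMap.mem_ker] at hz ⊢
      rw [hT, hz, map_zero]).resolve_right fun h => hT0 (LinearMap.ker_eq_top.mp h)
  have hrange : LinearMap.range T = ⊤ :=
    (hirr (LinearMap.range T) fun i u z hz => by
      obtain ⟨z, rfl⟩ := hz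
      exact ⟨_, hT i u z⟩).resolve_left fun h => hT0 (LinearMap.range_eq_bot.mp h)
  let E := LinearEquiv.ofBijective T ⟨LinearMap.ker_eq_bot.mp hker, LinearMap.range_eq_top.mp hrange⟩
  refine ⟨W, E.symm, fun i u v => ?_⟩
  rw [LinearEquiv.symm_apply_eq]
  change _ = T _
  rw [hT]
  congr 1
  exact (E.apply_symm_apply v).symm

end Decomposition

/-! ### Averaging, free actions and commutators of equivariant maps -/

section Geometry

attribute [local instance 100] LieRing.ofAssociativeRing

open Module

variable {k : Type u} {A : Type v} {g : Type w} {Γ : Type*} [Field k] [CommRing A] [Algebra k A]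
  [LieRing g] [LieAlgebra k g] [Group Γ]

/-- The diagonal action of `Γ` on `A ⊗ g`. -/
noncomputable def diagAction (ρA : Γ →* (A ≃ₐ[k] A)) (ρg : Γ →* (g ≃ₗ⁅k⁆ g)) (γ : Γ) :
    A ⊗[k] g →ₗ[k] A ⊗[k] g :=
  TensorProduct.map (ρA γ).toLinearMap ((ρg γ : g →ₗ⁅k⁆ g) : g →ₗ[k] g)

variable (ρA : Γ →* (A ≃ₐ[k] A)) (ρg : Γ →* (g ≃ₗ⁅k⁆ g))

theorem mem_equivariantMapAlgebra {α : A ⊗[k] g} :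
    α ∈ equivariantMapAlgebra ρA ρg ↔ ∀ γ, diagAction ρA ρg γ α = α := Iff.rfl

theorem diagAction_tmul (γ : Γ) (a : A) (u : g) :
    diagAction ρA ρg γ (a ⊗ₜ u) = ρA γ a ⊗ₜ ρg γ u := rfl

theorem diagAction_smul (γ : Γ) (a : A) (α : A ⊗[k] g) :
    diagAction ρA ρg γ (a • α) = ρA γ a • diagAction ρA ρg γ α := by
  induction α using TensorProduct.induction_on with
  | zero => simp
  | tmul b u => simp [TensorProduct.smul_tmul', diagAction_tmul]
  | add x y hx hy => rw [smul_add, map_add, hx, hy, map_add, smul_add]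

theorem diagAction_mul (γ δ : Γ) (α : A ⊗[k] g) :
    diagAction ρA ρg (γ * δ) α = diagAction ρA ρg γ (diagAction ρA ρg δ α) := by
  induction α using TensorProduct.induction_on with
  | zero => simp
  | tmul b u => simp only [diagAction_tmul, map_mul]; rfl
  | add x y hx hy => rw [map_add, hx, hy, map_add, map_add]

theorem diagAction_one (α : A ⊗[k] g) : diagAction ρA ρg 1 α = α := by
  induction α using TensorProduct.induction_on with
  | zero => simp
  | tmul b u => rw [diagAction_tmul, map_one, map_one]; rfl
  | add x y hx hy => rw [map_add, hx, hy]

/-- Invariant functions act on equivariant maps. -/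
theorem smul_mem_equivariantMapAlgebra {a : A} (ha : ∀ γ, ρA γ a = a) {α : A ⊗[k] g}
    (hα : α ∈ equivariantMapAlgebra ρA ρg) : a • α ∈ equivariantMapAlgebra ρA ρg := fun γ => by
  change diagAction ρA ρg γ (a • α) = a • α
  rw [diagAction_smul, ha, (mem_equivariantMapAlgebra ρA ρg).mp hα]

section Trace

variable [Fintype Γ]

/-- The sum over the group of all translates of a map. -/
noncomputable def orbitSum : A ⊗[k] g →ₗ[k] A ⊗[k] g := ∑ γ, diagAction ρA ρg γ

theorem orbitSum_apply (α : A ⊗[k] g) : orbitSum ρA ρg α = ∑ γ, diagAction ρA ρg γ α := by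
  simp [orbitSum]

theorem orbitSum_mem (α : A ⊗[k] g) : orbitSum ρA ρg α ∈ equivariantMapAlgebra ρA ρg := by
  rw [mem_equivariantMapAlgebra]
  intro γ
  rw [orbitSum_apply, map_sum]
  simp only [← diagAction_mul]
  exact Fintype.sum_equiv (Equiv.mulLeft γ) _ _ fun δ => rfl

theorem orbitSum_smul_of_mem (a : A) {α : A ⊗[k] g} (hα : α ∈ equivariantMapAlgebra ρA ρg) :
    orbitSum ρA ρg (a • α) = (∑ γ, ρA γ a) • α := by
  rw [orbitSum_apply, Finset.sum_smul]
  refine Finset.sum_congr rfl fun γ _ => ?_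
  rw [diagAction_smul, (mem_equivariantMapAlgebra ρA ρg).mp hα]

theorem orbitSum_of_mem {α : A ⊗[k] g} (hα : α ∈ equivariantMapAlgebra ρA ρg) :
    orbitSum ρA ρg α = (Fintype.card Γ : k) • α := by
  have := orbitSum_smul_of_mem ρA ρg 1 hα
  rw [one_smul] at this
  rw [this]
  simp [Nat.cast_smul_eq_nsmul]

theorem invariant_sum (a : A) (δ : Γ) : ρA δ (∑ γ, ρA γ a) = ∑ γ, ρA γ a := by
  rw [map_sum]
  exact Fintype.sum_equiv (Equiv.mulLeft δ) _ _ fun γ => by simp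

theorem orbitSum_smul_invariant {a : A} (ha : ∀ γ, ρA γ a = a) (α : A ⊗[k] g) :
    orbitSum ρA ρg (a • α) = a • orbitSum ρA ρg α := by
  rw [orbitSum_apply, orbitSum_apply, Finset.smul_sum]
  exact Finset.sum_congr rfl fun γ _ => by rw [diagAction_smul, ha]

end Trace

section Galois

/-- The ring homomorphism `a ⊗ b ↦ a γ(b)`. -/
noncomputable def graphMap (γ : Γ) : A ⊗[k] A →ₐ[k] A :=
  (Algebra.TensorProduct.lmul' k).comp
    (Algebra.TensorProduct.map (AlgHom.id k A) (ρA γ : A →ₐ[k] A))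

theorem graphMap_tmul (γ : Γ) (a b : A) : graphMap ρA γ (a ⊗ₜ b) = a * ρA γ b := by
  simp [graphMap]

theorem pointAction_apply (γ : Γ) (x : A →ₐ[k] k) (a : A) :
    pointAction ρA γ x a = x (ρA γ⁻¹ a) := rfl

theorem pointAction_one (x : A →ₐ[k] k) : pointAction ρA 1 x = x := by
  ext a; simp [pointAction_apply]

theorem pointAction_mul (γ δ : Γ) (x : A →ₐ[k] k) :
    pointAction ρA (γ * δ) x = pointAction ρA γ (pointAction ρA δ x) := by
  ext a; simp [pointAction_apply]

/-- Over an algebraically closed field, proper ideals of an algebra of finite type have rational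
points. -/
theorem Ideal.exists_point_of_ne_top [IsAlgClosed k] [Algebra.FiniteType k A] (I : Ideal A)
    (hI : I ≠ ⊤) : ∃ x : A →ₐ[k] k, I ≤ RingHom.ker x := by
  obtain ⟨M, hM, hIM⟩ := Ideal.exists_le_maximal I hI
  let _ : Field (A ⧸ M) := Ideal.Quotient.field M
  have h1 : Algebra.FiniteType k (A ⧸ M) := inferInstance
  have h2 : Module.Finite k (A ⧸ M) := finite_of_finite_type_of_isJacobsonRing k (A ⧸ M)
  have h3 : Function.Bijective (algebraMap k (A ⧸ M)) :=
    IsAlgClosed.algebraMap_bijective_of_isIntegral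
  let e : k ≃ₐ[k] A ⧸ M := AlgEquiv.ofBijective (Algebra.ofId k (A ⧸ M)) h3
  refine ⟨(e.symm : A ⧸ M →ₐ[k] k).comp (Ideal.Quotient.mkₐ k M), fun a ha => ?_⟩
  rw [RingHom.mem_ker]
  have h0 : Ideal.Quotient.mkₐ k M a = 0 := Ideal.Quotient.eq_zero_iff_mem.mpr (hIM ha)
  rw [AlgHom.comp_apply, h0, map_zero]

/-- A free action of a finite group is Galois. -/
theorem exists_galois_element [Fintype Γ] [DecidableEq Γ] [IsAlgClosed k] [Algebra.FiniteType k A]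
    (hfree : ActsFreely ρA) :
    ∃ t : A ⊗[k] A, ∀ γ, graphMap ρA γ t = if γ = 1 then 1 else 0 := by
  have key : ∀ γ : Γ, γ ≠ 1 → ∃ t : A ⊗[k] A, graphMap ρA 1 t = 1 ∧ graphMap ρA γ t = 0 := by
    intro γ hγ
    -- A rational point containing all differences a - γ(a) in its kernel would be fixed by γ⁻¹.
    have htop : Ideal.span (Set.range fun a : A => a - ρA γ a) = ⊤ := by
      by_contra hne
      obtain ⟨x, hx⟩ := Ideal.exists_point_of_ne_top (k := k) _ hne
      apply hγ
      rw [← inv_eq_one]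
      apply hfree γ⁻¹ x
      ext a
      have h := hx (Ideal.subset_span ⟨a, rfl⟩)
      rw [RingHom.mem_ker, map_sub, sub_eq_zero] at h
      rw [pointAction_apply, inv_inv]
      exact h.symm
    have h1 : (1 : A) ∈ Ideal.span (Set.range fun a : A => a - ρA γ a) := htop ▸ Submodule.mem_top
    have h2 : ∀ c ∈ Ideal.span (Set.range fun a : A => a - ρA γ a),
        ∃ t : A ⊗[k] A, graphMap ρA 1 t = c ∧ graphMap ρA γ t = 0 := by
      intro c hc
      induction hc using Submodule.span_induction with
      | mem c hc =>
        obtain ⟨a, rfl⟩ := hc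
        exact ⟨1 ⊗ₜ a - (ρA γ a) ⊗ₜ 1, by simp [graphMap_tmul], by simp [graphMap_tmul]⟩
      | zero => exact ⟨0, by simp, by simp⟩
      | add a b _ _ ha hb =>
        obtain ⟨s, hs1, hs2⟩ := ha
        obtain ⟨t, ht1, ht2⟩ := hb
        exact ⟨s + t, by rw [map_add, hs1, ht1], by rw [map_add, hs2, ht2, add_zero]⟩
      | smul a b _ hb =>
        obtain ⟨t, ht1, ht2⟩ := hb
        exact ⟨(a ⊗ₜ 1) * t, by rw [map_mul, ht1, graphMap_tmul]; simp,
          by rw [map_mul, ht2, mul_zero]⟩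
    exact h2 1 h1
  choose t ht using key
  -- Each factor is 1 on the diagonal and kills one graph, so the product kills the graphs of all γ
  -- ≠ 1.
  refine ⟨∏ γ, if h : γ = 1 then 1 else t γ h, fun γ => ?_⟩
  rw [map_prod]
  split_ifs with hγ
  · subst hγ
    refine Finset.prod_eq_one fun γ _ => ?_
    split_ifs with h
    · exact map_one _
    · exact (ht γ h).1
  · refine Finset.prod_eq_zero (Finset.mem_univ γ) ?_
    rw [dif_neg hγ]
    exact (ht γ hγ).2

/-- If t = ∑ aⱼ ⊗ bⱼ is the Galois element, then ∑ aⱼ ∑_γ γ(bⱼβ) = ∑_γ (∑ aⱼ γ(bⱼ)) γβ = β. So A ⊗ g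
is generated over A by equivariant maps. -/
theorem mem_span_orbitSum [Fintype Γ] [DecidableEq Γ] [IsAlgClosed k] [Algebra.FiniteType k A]
    (hfree : ActsFreely ρA) (β : A ⊗[k] g) :
    β ∈ Submodule.span A (Set.range fun b : A => orbitSum ρA ρg (b • β)) := by
  have key : ∀ t : A ⊗[k] A, ∑ γ, graphMap ρA γ t • diagAction ρA ρg γ β ∈
      Submodule.span A (Set.range fun b : A => orbitSum ρA ρg (b • β)) := by
    intro t
    induction t using TensorProduct.induction_on with
    | zero => simp
    | tmul a b =>
      have : ∑ γ, graphMap ρA γ (a ⊗ₜ b) • diagAction ρA ρg γ β = a • orbitSum ρA ρg (b • β) := by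
        rw [orbitSum_apply, Finset.smul_sum]
        refine Finset.sum_congr rfl fun γ _ => ?_
        rw [graphMap_tmul, diagAction_smul, mul_smul]
      rw [this]
      exact Submodule.smul_mem _ _ (Submodule.subset_span ⟨b, rfl⟩)
    | add s t hs ht =>
      simp only [map_add, add_smul, Finset.sum_add_distrib]
      exact Submodule.add_mem _ hs ht
  obtain ⟨t, ht⟩ := exists_galois_element ρA hfree
  have := key t
  simp only [ht, ite_smul, one_smul, zero_smul, Finset.sum_ite_eq', Finset.mem_univ, if_true,
    diagAction_one] at this
  exact this

end Galois

section IdealParts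

variable [Module.Finite k g]

variable (k g) in
/-- The maps with all coordinates in the ideal `I`. -/
noncomputable def tensorIdeal (I : Ideal A) : Submodule A (A ⊗[k] g) :=
  ⨅ i, Submodule.comap ((Algebra.TensorProduct.basis A (Module.finBasis k g)).coord i) I

theorem mem_tensorIdeal {I : Ideal A} {α : A ⊗[k] g} : α ∈ tensorIdeal k g I ↔
    ∀ i, (Algebra.TensorProduct.basis A (Module.finBasis k g)).repr α i ∈ I := by
  simp [tensorIdeal, Submodule.mem_iInf]

theorem tmul_mem_tensorIdeal {I : Ideal A} {a : A} (ha : a ∈ I) (u : g) :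
    a ⊗ₜ[k] u ∈ tensorIdeal k g I := by
  rw [mem_tensorIdeal]
  intro i
  rw [Algebra.TensorProduct.basis_repr_tmul]
  simp only [Finsupp.smul_apply, Finsupp.mapRange_apply, smul_eq_mul]
  exact I.mul_mem_right _ ha

theorem tensorIdeal_sum_repr (α : A ⊗[k] g) :
    ∑ i, (Algebra.TensorProduct.basis A (Module.finBasis k g)).repr α i ⊗ₜ Module.finBasis k g i =
      α := by
  conv_rhs => rw [← (Algebra.TensorProduct.basis A (Module.finBasis k g)).sum_repr α]
  refine Finset.sum_congr rfl fun i _ => ?_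
  rw [Algebra.TensorProduct.basis_apply, TensorProduct.smul_tmul', smul_eq_mul, mul_one]

theorem tensorIdeal_induction {I : Ideal A} {P : A ⊗[k] g → Prop} (h0 : P 0)
    (hadd : ∀ α β, P α → P β → P (α + β)) (htmul : ∀ a ∈ I, ∀ u, P (a ⊗ₜ u)) {α : A ⊗[k] g}
    (hα : α ∈ tensorIdeal k g I) : P α := by
  rw [← tensorIdeal_sum_repr α]
  exact Finset.sum_induction _ P hadd h0 fun i _ => htmul _ (mem_tensorIdeal.mp hα i) _

theorem smul_mem_tensorIdeal {I : Ideal A} {a : A} (ha : a ∈ I) (α : A ⊗[k] g) :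
    a • α ∈ tensorIdeal k g I := by
  rw [mem_tensorIdeal]
  intro i
  rw [map_smul, Finsupp.smul_apply, smul_eq_mul]
  exact I.mul_mem_right _ ha

theorem tensorIdeal_mono {I J : Ideal A} (h : I ≤ J) : tensorIdeal k g I ≤ tensorIdeal k g J :=
  fun _ hα => mem_tensorIdeal.mpr fun i => h (mem_tensorIdeal.mp hα i)

theorem diagAction_mem_tensorIdeal {I J : Ideal A} {γ : Γ} (h : ∀ a ∈ I, ρA γ a ∈ J)
    {α : A ⊗[k] g} (hα : α ∈ tensorIdeal k g I) : diagAction ρA ρg γ α ∈ tensorIdeal k g J := by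
  refine tensorIdeal_induction (P := fun α => diagAction ρA ρg γ α ∈ tensorIdeal k g J)
    (by simp) (fun α β ha hb => by rw [map_add]; exact Submodule.add_mem _ ha hb)
    (fun a ha u => ?_) hα
  rw [diagAction_tmul]
  exact tmul_mem_tensorIdeal (h a ha) _

variable [Fintype Γ]

theorem orbitSum_mem_tensorIdeal {I : Ideal A} (h : ∀ γ, ∀ a ∈ I, ρA γ a ∈ I)
    {α : A ⊗[k] g} (hα : α ∈ tensorIdeal k g I) : orbitSum ρA ρg α ∈ tensorIdeal k g I := by
  rw [orbitSum_apply]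
  exact Submodule.sum_mem _ fun γ _ => diagAction_mem_tensorIdeal ρA ρg (h γ) hα

variable [IsAlgClosed k] [CharZero k] [Algebra.FiniteType k A] [LieAlgebra.IsKilling k g]

/-- Equivariant maps vanishing on a product of ideals are sums of commutators. -/
theorem mem_span_lie_of_mem_tensorIdeal_mul (hfree : ActsFreely ρA) {I J : Ideal A}
    (hI : ∀ γ, ∀ a ∈ I, ρA γ a ∈ I) (hJ : ∀ γ, ∀ a ∈ J, ρA γ a ∈ J) {α : A ⊗[k] g}
    (hα : α ∈ equivariantMapAlgebra ρA ρg) (hα' : α ∈ tensorIdeal k g (I * J)) :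
    α ∈ Submodule.span k {z | ∃ κ ∈ equivariantMapAlgebra ρA ρg, κ ∈ tensorIdeal k g I ∧
      ∃ κ' ∈ equivariantMapAlgebra ρA ρg, κ' ∈ tensorIdeal k g J ∧ ⁅κ, κ'⁆ = z} := by
  classical
  set S := {z | ∃ κ ∈ equivariantMapAlgebra ρA ρg, κ ∈ tensorIdeal k g I ∧
      ∃ κ' ∈ equivariantMapAlgebra ρA ρg, κ' ∈ tensorIdeal k g J ∧ ⁅κ, κ'⁆ = z}
  have hgen : ∀ (I : Ideal A), (∀ γ, ∀ a ∈ I, ρA γ a ∈ I) → ∀ β ∈ tensorIdeal k g I,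
      β ∈ Submodule.span A {κ | κ ∈ equivariantMapAlgebra ρA ρg ∧ κ ∈ tensorIdeal k g I} := by
    intro I hI β hβ
    refine Submodule.span_mono ?_ (mem_span_orbitSum ρA ρg hfree β)
    rintro _ ⟨b, rfl⟩
    exact ⟨orbitSum_mem _ _ _, orbitSum_mem_tensorIdeal ρA ρg hI (Submodule.smul_mem _ b hβ)⟩
  have hlie : ∀ β ∈ tensorIdeal k g I, ∀ β' ∈ tensorIdeal k g J,
      ⁅β, β'⁆ ∈ Submodule.span A S := by
    intro β hβ β' hβ'
    have h := hgen I hI β hβ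
    have h' := hgen J hJ β' hβ'
    clear hβ hβ'
    induction h using Submodule.span_induction with
    | mem κ hκ =>
      induction h' using Submodule.span_induction with
      | mem κ' hκ' => exact Submodule.subset_span ⟨κ, hκ.1, hκ.2, κ', hκ'.1, hκ'.2, rfl⟩
      | zero => simp
      | add a b _ _ ha hb => rw [lie_add]; exact Submodule.add_mem _ ha hb
      | smul a b _ hb => rw [lie_smul]; exact Submodule.smul_mem _ _ hb
    | zero => simp
    | add a b _ _ ha hb => rw [add_lie]; exact Submodule.add_mem _ ha hb
    | smul a b _ hb => rw [smul_lie]; exact Submodule.smul_mem _ _ hb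
  -- Since g is perfect, it is enough to write ij ⊗ [v, v'] as [i ⊗ v, j ⊗ v'].
  have hspan : ∀ β ∈ tensorIdeal k g (I * J), β ∈ Submodule.span A S := by
    intro β hβ
    refine tensorIdeal_induction (P := fun β => β ∈ Submodule.span A S) (Submodule.zero_mem _)
      (fun _ _ => Submodule.add_mem _) (fun a ha u => ?_) hβ
    have hu : u ∈ (LieAlgebra.derivedSeries k g 1 : Submodule k g) := by
      rw [LieAlgebra.derivedSeries_one_eq_top]; trivial
    rw [LieAlgebra.coe_derivedSeries_one_eq] at hu
    induction ha using Submodule.mul_induction_on' with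
    | mem_mul_mem i hi j hj =>
      induction hu using Submodule.span_induction with
      | mem u hu =>
        obtain ⟨v, v', rfl⟩ := hu
        rw [← LieAlgebra.ExtendScalars.bracket_tmul]
        exact hlie _ (tmul_mem_tensorIdeal hi v) _ (tmul_mem_tensorIdeal hj v')
      | zero => simp
      | add u v _ _ hu hv => rw [TensorProduct.tmul_add]; exact Submodule.add_mem _ hu hv
      | smul c u _ hu =>
        rw [TensorProduct.tmul_smul, ← algebraMap_smul A c]
        exact Submodule.smul_mem _ _ hu
    | add a _ b _ ha hb => rw [TensorProduct.add_tmul]; exact Submodule.add_mem _ ha hb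
  -- Averaging returns from A-combinations to k-combinations: the orbit sum of a[κ, κ'] is [tr(a)κ,
  -- κ'], and the trace of a is invariant.
  have htrace : ∀ β ∈ Submodule.span A S, ∀ a : A,
      orbitSum ρA ρg (a • β) ∈ Submodule.span k S := by
    intro β hβ
    induction hβ using Submodule.span_induction with
    | mem β hβ =>
      obtain ⟨κ, hκ, hκI, κ', hκ', hκJ, rfl⟩ := hβ
      intro a
      rw [orbitSum_smul_of_mem _ _ _ (LieSubalgebra.lie_mem _ hκ hκ'), ← smul_lie]
      exact Submodule.subset_span ⟨_, smul_mem_equivariantMapAlgebra ρA ρg (invariant_sum ρA a) hκ,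
        Submodule.smul_mem _ _ hκI, κ', hκ', hκJ, rfl⟩
    | zero => simp
    | add a b _ _ ha hb =>
      intro c
      rw [smul_add, map_add]
      exact Submodule.add_mem _ (ha c) (hb c)
    | smul a b _ hb =>
      intro c
      rw [smul_smul]
      exact hb _
  have h1 := htrace α (hspan α hα') 1
  rw [one_smul, orbitSum_of_mem _ _ hα] at h1
  exact (Submodule.smul_mem_iff _ (by simp [Fintype.card_ne_zero])).mp h1

end IdealParts

end Geometry

/-! ### Evaluation at rational points, interpolation and local lifts -/

section Points

attribute [local instance 100] LieRing.ofAssociativeRing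

open Module

variable {k : Type u} {A : Type v} {g : Type w} {Γ : Type*} [Field k] [CommRing A] [Algebra k A]
  [LieRing g] [LieAlgebra k g] [Group Γ]

theorem evalAt_tmul (x : A →ₐ[k] k) (a : A) (u : g) : evalAt x (a ⊗ₜ[k] u) = x a • u := by
  change TensorProduct.lid k g (TensorProduct.map x.toLinearMap LinearMap.id (a ⊗ₜ u)) = _
  simp

variable (ρA : Γ →* (A ≃ₐ[k] A)) (ρg : Γ →* (g ≃ₗ⁅k⁆ g))

theorem evalAt_diagAction (γ : Γ) (x : A →ₐ[k] k) (α : A ⊗[k] g) :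
    evalAt x (diagAction ρA ρg γ α) = ρg γ (evalAt (pointAction ρA γ⁻¹ x) α) := by
  induction α using TensorProduct.induction_on with
  | zero => simp
  | tmul b u =>
    rw [diagAction_tmul, evalAt_tmul, evalAt_tmul, pointAction_apply, inv_inv]
    exact ((ρg γ).map_smul _ _).symm
  | add α β hα hβ => rw [map_add, map_add, hα, hβ, map_add, map_add]

theorem evalAt_pointAction {α : A ⊗[k] g} (hα : α ∈ equivariantMapAlgebra ρA ρg) (γ : Γ)
    (x : A →ₐ[k] k) : evalAt (pointAction ρA γ x) α = ρg γ (evalAt x α) := by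
  have h := evalAt_diagAction ρA ρg γ (pointAction ρA γ x) α
  rw [(mem_equivariantMapAlgebra ρA ρg).mp hα γ, ← pointAction_mul, inv_mul_cancel,
    pointAction_one] at h
  exact h

theorem mem_ker_pointAction {γ : Γ} {x : A →ₐ[k] k} {a : A} :
    a ∈ RingHom.ker (pointAction ρA γ x) ↔ ρA γ⁻¹ a ∈ RingHom.ker x := Iff.rfl

theorem map_mem_ker_sq {γ : Γ} {x : A →ₐ[k] k} {a : A}
    (ha : a ∈ RingHom.ker (pointAction ρA γ⁻¹ x) ^ 2) : ρA γ a ∈ RingHom.ker x ^ 2 := by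
  have h := Ideal.mem_map_of_mem (ρA γ : A →+* A) ha
  rw [Ideal.map_pow] at h
  refine Ideal.pow_right_mono ?_ 2 h
  rw [Ideal.map_le_iff_le_comap]
  intro b hb
  rw [mem_ker_pointAction, inv_inv] at hb
  exact hb

section TensorIdeal

variable [Module.Finite k g]

theorem evalAt_eq_zero_iff {x : A →ₐ[k] k} {α : A ⊗[k] g} :
    evalAt x α = 0 ↔ α ∈ tensorIdeal k g (RingHom.ker x) := by
  have h : evalAt x α =
      ∑ i, x ((Algebra.TensorProduct.basis A (Module.finBasis k g)).repr α i) •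
        Module.finBasis k g i := by
    conv_lhs => rw [← tensorIdeal_sum_repr α]
    simp only [map_sum, evalAt_tmul]
  rw [h, mem_tensorIdeal]
  constructor
  · exact fun h0 => Fintype.linearIndependent_iff.mp (Module.finBasis k g).linearIndependent _ h0
  · exact fun h0 => Finset.sum_eq_zero fun i _ => by rw [h0 i, zero_smul]

theorem mem_tensorIdeal_iInf {ι : Sort*} {I : ι → Ideal A} {α : A ⊗[k] g} :
    α ∈ tensorIdeal k g (⨅ i, I i) ↔ ∀ i, α ∈ tensorIdeal k g (I i) := by
  simp only [mem_tensorIdeal, Submodule.mem_iInf]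
  exact forall_comm

theorem lie_mem_tensorIdeal_mul {I J : Ideal A} {α β : A ⊗[k] g} (hα : α ∈ tensorIdeal k g I)
    (hβ : β ∈ tensorIdeal k g J) : ⁅α, β⁆ ∈ tensorIdeal k g (I * J) := by
  refine tensorIdeal_induction (P := fun α => ⁅α, β⁆ ∈ tensorIdeal k g (I * J))
    (by simp) (fun α α' h h' => by rw [add_lie]; exact Submodule.add_mem _ h h')
    (fun a ha u => ?_) hα
  refine tensorIdeal_induction (P := fun β => ⁅a ⊗ₜ[k] u, β⁆ ∈ tensorIdeal k g (I * J))
    (by simp) (fun α α' h h' => by rw [lie_add]; exact Submodule.add_mem _ h h')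
    (fun b hb v => ?_) hβ
  rw [LieAlgebra.ExtendScalars.bracket_tmul]
  exact tmul_mem_tensorIdeal (Ideal.mul_mem_mul ha hb) _

theorem mem_tensorIdeal_top (α : A ⊗[k] g) : α ∈ tensorIdeal k g (⊤ : Ideal A) :=
  mem_tensorIdeal.mpr fun _ => trivial

theorem lie_mem_tensorIdeal_right {I : Ideal A} (α : A ⊗[k] g) {β : A ⊗[k] g}
    (hβ : β ∈ tensorIdeal k g I) : ⁅α, β⁆ ∈ tensorIdeal k g I := by
  have := lie_mem_tensorIdeal_mul (mem_tensorIdeal_top α) hβ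
  rwa [Ideal.top_mul] at this

theorem lie_mem_tensorIdeal_left {I : Ideal A} {α : A ⊗[k] g} (hα : α ∈ tensorIdeal k g I)
    (β : A ⊗[k] g) : ⁅α, β⁆ ∈ tensorIdeal k g I := by
  have := lie_mem_tensorIdeal_mul hα (mem_tensorIdeal_top β)
  rwa [Ideal.mul_top] at this

theorem sub_one_tmul_evalAt_mem (x : A →ₐ[k] k) (α : A ⊗[k] g) :
    α - 1 ⊗ₜ[k] evalAt x α ∈ tensorIdeal k g (RingHom.ker x) := by
  rw [← evalAt_eq_zero_iff, map_sub, evalAt_tmul, map_one, one_smul, sub_self]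

end TensorIdeal

theorem isMaximal_ker_point (x : A →ₐ[k] k) : (RingHom.ker x).IsMaximal :=
  RingHom.ker_isMaximal_of_surjective x fun c => ⟨algebraMap k A c, by simp⟩

theorem ker_point_injective {x y : A →ₐ[k] k} (h : RingHom.ker x = RingHom.ker y) : x = y := by
  ext a
  have ha : a - algebraMap k A (x a) ∈ RingHom.ker x := by simp [RingHom.mem_ker]
  rw [h, RingHom.mem_ker, map_sub, AlgHom.commutes, sub_eq_zero] at ha
  exact ha.symm

theorem isCoprime_ker_sq {x y : A →ₐ[k] k} (h : x ≠ y) :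
    IsCoprime (RingHom.ker x ^ 2) (RingHom.ker y ^ 2) := by
  have := isMaximal_ker_point x
  have := isMaximal_ker_point y
  exact (Ideal.isCoprime_of_isMaximal fun h' => h (ker_point_injective h')).pow

/-- Interpolation to second order at finitely many rational points. -/
theorem exists_interpolation {ι : Type*} [Finite ι] (P : ι → A →ₐ[k] k)
    (hP : Function.Injective P) (i : ι) : ∃ e : A, e - 1 ∈ RingHom.ker (P i) ^ 2 ∧
      ∀ j, j ≠ i → e ∈ RingHom.ker (P j) ^ 2 := by
  classical
  have := Fintype.ofFinite ι
  have h : IsCoprime (RingHom.ker (P i) ^ 2)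
      (⨅ j ∈ Finset.univ.erase i, RingHom.ker (P j) ^ 2) := by
    refine Ideal.isCoprime_biInf fun j hj => isCoprime_ker_sq fun h => ?_
    exact Finset.ne_of_mem_erase hj (hP h).symm
  obtain ⟨a, ha, b, hb, hab⟩ := Submodule.mem_sup.mp
    ((Ideal.isCoprime_iff_sup_eq.mp h).symm ▸ Submodule.mem_top : (1 : A) ∈ _)
  refine ⟨b, ?_, fun j hj => ?_⟩
  · rw [← hab, sub_add_cancel_right]
    exact Submodule.neg_mem _ ha
  · simp only [Submodule.mem_iInf] at hb
    exact hb j (Finset.mem_erase.mpr ⟨hj, Finset.mem_univ j⟩)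

/-- The maximal ideals of distinct rational points are coprime, so intersections of them, or of
their squares, are products. This puts second-order vanishing in the form I * I to which the
commutator theorem applies. -/
theorem iInf_ker_sq {ι : Type*} [Finite ι] (P : ι → A →ₐ[k] k) (hP : Function.Injective P) :
    ⨅ i, RingHom.ker (P i) ^ 2 = (⨅ i, RingHom.ker (P i)) * ⨅ i, RingHom.ker (P i) := by
  have := Fintype.ofFinite ι
  have h1 : ∏ i, RingHom.ker (P i) ^ 2 = ⨅ i, RingHom.ker (P i) ^ 2 := by
    simpa using Ideal.prod_eq_iInf_of_pairwise_isCoprime (s := Finset.univ)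
      (J := fun i => RingHom.ker (P i) ^ 2)
      fun i _ j _ hij => isCoprime_ker_sq fun h => hij (hP h)
  have h2 : ∏ i, RingHom.ker (P i) = ⨅ i, RingHom.ker (P i) := by
    have h : ((Finset.univ : Finset ι) : Set ι).Pairwise
        (Function.onFun IsCoprime fun i => RingHom.ker (P i)) := by
      intro i _ j _ hij
      have := isMaximal_ker_point (P i)
      have := isMaximal_ker_point (P j)
      exact Ideal.isCoprime_of_isMaximal fun h' => hij (hP (ker_point_injective h'))
    simpa using Ideal.prod_eq_iInf_of_pairwise_isCoprime h
  rw [← h1, ← h2, ← pow_two, Finset.prod_pow]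

variable {ρA} in
-- Orbit separation distinguishes different x, and freeness distinguishes the translates of one x,
-- so the interpolation theorem applies to all of them at once.
theorem injective_orbit_points (hfree : ActsFreely ρA) {s : Finset (A →ₐ[k] k)}
    (hs : s ∈ orbitSeparated ρA) :
    Function.Injective fun p : Γ × s => pointAction ρA p.1 (p.2 : A →ₐ[k] k) := by
  rintro ⟨γ, x⟩ ⟨δ, y⟩ h
  simp only at h
  have hxy : x = y := by
    by_contra hne
    have := hs x.2 y.2 fun h' => hne (Subtype.ext h')
    exact Set.disjoint_left.mp this ⟨γ, rfl⟩ ⟨δ, h.symm⟩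
  subst hxy
  have h1 : pointAction ρA (δ⁻¹ * γ) (x : A →ₐ[k] k) = x := by
    rw [pointAction_mul, h, ← pointAction_mul, inv_mul_cancel, pointAction_one]
  have := hfree _ _ h1
  rw [inv_mul_eq_one] at this
  rw [this]

/-- An element of the coordinate ring that is `1` to second order at `x` and vanishes to second
order at all other points of the orbits meeting `s`. -/
theorem exists_localizer [Finite Γ] (hfree : ActsFreely ρA) {s : Finset (A →ₐ[k] k)}
    (hs : s ∈ orbitSeparated ρA) (x : s) :
    ∃ e : A, e - 1 ∈ RingHom.ker (x : A →ₐ[k] k) ^ 2 ∧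
      ∀ (γ : Γ) (y : s), (γ ≠ 1 ∨ y ≠ x) → ρA γ e ∈ RingHom.ker (y : A →ₐ[k] k) ^ 2 := by
  obtain ⟨e, he, he'⟩ := exists_interpolation _ (injective_orbit_points hfree hs) (1, x)
  refine ⟨e, by simpa only [pointAction_one] using he, fun γ y h => ?_⟩
  refine map_mem_ker_sq ρA (he' (γ⁻¹, y) fun h' => ?_)
  rw [Prod.mk.injEq, inv_eq_one] at h'
  exact h.elim (fun h => h h'.1) fun h => h h'.2

section Lifts

variable [Fintype Γ]

/-- The equivariant map with prescribed first order behaviour at `x`. -/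
noncomputable def localLift (e : A) : A ⊗[k] g →ₗ[k] equivariantMapAlgebra ρA ρg where
  toFun β := ⟨orbitSum ρA ρg (e • β), orbitSum_mem ρA ρg _⟩
  map_add' β β' := Subtype.ext (by simp)
  map_smul' c β := Subtype.ext (by simp [smul_comm e c β])

theorem coe_localLift (e : A) (β : A ⊗[k] g) :
    (localLift ρA ρg e β : A ⊗[k] g) = orbitSum ρA ρg (e • β) := rfl

variable [Module.Finite k g]

/-- Modulo 𝔪ₓ², only the term γ = 1 of the orbit sum survives. -/
theorem localLift_sub_mem {x : A →ₐ[k] k} {e : A} (he : e - 1 ∈ RingHom.ker x ^ 2)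
    (he' : ∀ γ : Γ, γ ≠ 1 → ρA γ e ∈ RingHom.ker x ^ 2) (β : A ⊗[k] g) :
    (localLift ρA ρg e β : A ⊗[k] g) - β ∈ tensorIdeal k g (RingHom.ker x ^ 2) := by
  classical
  rw [coe_localLift, orbitSum_apply, ← Finset.add_sum_erase _ _ (Finset.mem_univ (1 : Γ)),
    diagAction_one, add_sub_right_comm]
  refine Submodule.add_mem _ ?_ (Submodule.sum_mem _ fun γ hγ => ?_)
  · rw [show e • β - β = (e - 1) • β by rw [sub_smul, one_smul]]
    exact smul_mem_tensorIdeal he _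
  · rw [diagAction_smul]
    exact smul_mem_tensorIdeal (he' γ (Finset.ne_of_mem_erase hγ)) _

theorem localLift_mem {y : A →ₐ[k] k} {e : A} (he' : ∀ γ : Γ, ρA γ e ∈ RingHom.ker y ^ 2)
    (β : A ⊗[k] g) : (localLift ρA ρg e β : A ⊗[k] g) ∈ tensorIdeal k g (RingHom.ker y ^ 2) := by
  rw [coe_localLift, orbitSum_apply]
  refine Submodule.sum_mem _ fun γ hγ => ?_
  rw [diagAction_smul]
  exact smul_mem_tensorIdeal (he' γ) _

/-- An equivariant map vanishing to second order at the points of `s` is a sum of commutators of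
equivariant maps vanishing on `s`. -/
theorem mem_span_lie_of_vanishing_sq [IsAlgClosed k] [CharZero k] [Algebra.FiniteType k A]
    [LieAlgebra.IsKilling k g] (hfree : ActsFreely ρA) {s : Finset (A →ₐ[k] k)}
    (hs : s ∈ orbitSeparated ρA) {α : A ⊗[k] g} (hα : α ∈ equivariantMapAlgebra ρA ρg)
    (h : ∀ x ∈ s, α ∈ tensorIdeal k g (RingHom.ker x ^ 2)) :
    α ∈ Submodule.span k {z | ∃ κ ∈ equivariantMapAlgebra ρA ρg, (∀ x ∈ s, evalAt x κ = 0) ∧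
      ∃ κ' ∈ equivariantMapAlgebra ρA ρg, (∀ x ∈ s, evalAt x κ' = 0) ∧ ⁅κ, κ'⁆ = z} := by
  -- Equivariance spreads second-order vanishing from s to the whole orbits, whose ideal is Γ-stable
  -- as the commutator theorem requires.
  have hsq : α ∈ tensorIdeal k g
      (⨅ p : Γ × s, RingHom.ker (pointAction ρA p.1 (p.2 : A →ₐ[k] k)) ^ 2) := by
    rw [mem_tensorIdeal_iInf]
    rintro ⟨γ, x⟩
    have h1 := (mem_equivariantMapAlgebra ρA ρg).mp hα γ
    rw [← h1]
    refine diagAction_mem_tensorIdeal ρA ρg (fun a ha => map_mem_ker_sq ρA ?_) (h x x.2)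
    rwa [← pointAction_mul, inv_mul_cancel, pointAction_one]
  rw [iInf_ker_sq _ (injective_orbit_points hfree hs)] at hsq
  have hst : ∀ δ : Γ, ∀ a ∈ ⨅ p : Γ × s, RingHom.ker (pointAction ρA p.1 (p.2 : A →ₐ[k] k)),
      ρA δ a ∈ ⨅ p : Γ × s, RingHom.ker (pointAction ρA p.1 (p.2 : A →ₐ[k] k)) := by
    intro δ a ha
    simp only [Submodule.mem_iInf] at ha ⊢
    rintro ⟨γ, x⟩
    have := ha (δ⁻¹ * γ, x)
    rw [mem_ker_pointAction] at this ⊢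
    simpa [mul_inv_rev] using this
  refine Submodule.span_mono ?_ (mem_span_lie_of_mem_tensorIdeal_mul ρA ρg hfree hst hst hα hsq)
  have hev : ∀ κ ∈ tensorIdeal k g
      (⨅ p : Γ × s, RingHom.ker (pointAction ρA p.1 (p.2 : A →ₐ[k] k))),
      ∀ x ∈ s, evalAt x κ = 0 := by
    intro κ hκ x hx
    have := mem_tensorIdeal_iInf.mp hκ (1, ⟨x, hx⟩)
    simp only [pointAction_one] at this
    exact evalAt_eq_zero_iff.mpr this
  rintro _ ⟨κ, hκ, hκ1, κ', hκ', hκ1', rfl⟩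
  exact ⟨κ, hκ, hev κ hκ1, κ', hκ', hev κ' hκ1', rfl⟩

end Lifts

end Points

/-! ### Whitehead's lemma for several commuting representations -/

section Whitehead

attribute [local instance 100] LieRing.ofAssociativeRing

/-- Compatible cocycles for commuting representations have a common primitive. -/
theorem exists_common_primitive {k : Type u} [Field k] [IsAlgClosed k] [CharZero k] {g : Type v}
    [LieRing g] [LieAlgebra k g] [Module.Finite k g] [LieAlgebra.IsKilling k g] {N : Type w}
    [AddCommGroup N] [Module k N] [Module.Finite k N] {ι : Type*} (t : Finset ι)
    (ρ : ι → g →ₗ⁅k⁆ Module.End k N) (c : ι → g →ₗ[k] N)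
    (hcoc : ∀ i u v, c i ⁅u, v⁆ = ρ i u (c i v) - ρ i v (c i u))
    (hcross : ∀ i j, i ≠ j → ∀ u v, ρ i u (c j v) = ρ j v (c i u))
    (hcomm : ∀ i j, i ≠ j → ∀ u v n, ρ i u (ρ j v n) = ρ j v (ρ i u n)) :
    ∃ n, ∀ i ∈ t, ∀ u, c i u = ρ i u n := by
  classical
  induction t using Finset.induction_on with
  | empty => exact ⟨0, by simp⟩
  | insert j t hj ih =>
    obtain ⟨n, hn⟩ := ih
    -- The vectors killed by the representations already treated. By the cross condition, c j minus
    -- the coboundary of n has values in N', so the correction n' can be taken there and does not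
    -- disturb the earlier indices.
    let N' : Submodule k N := ⨅ i ∈ t, ⨅ u, LinearMap.ker (ρ i u)
    have hN' : ∀ m, m ∈ N' ↔ ∀ i ∈ t, ∀ u, ρ i u m = 0 := by
      simp [N', Submodule.mem_iInf]
    have hne : ∀ i ∈ t, i ≠ j := fun i hi h => hj (h ▸ hi)
    obtain ⟨n', hn', h'⟩ := exists_inner_of_invariant (ρ j) N'
      (fun u m hm => (hN' _).mpr fun i hi v => by
        rw [hcomm i j (hne i hi), (hN' m).mp hm i hi v, map_zero])
      (c j - (ρ j).toLinearMap.flip n)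
      (fun u => (hN' _).mpr fun i hi v => by
        rw [LinearMap.sub_apply, map_sub, hcross i j (hne i hi), hn i hi, LinearMap.flip_apply,
          LieHom.coe_toLinearMap, hcomm i j (hne i hi), sub_self])
      (fun u v => by
        simp only [LinearMap.sub_apply, LinearMap.flip_apply, LieHom.coe_toLinearMap, hcoc,
          LieHom.map_lie, LieRing.of_associative_ring_bracket, Module.End.mul_apply, map_sub]
        abel)
    refine ⟨n + n', fun i hi u => ?_⟩
    rcases Finset.mem_insert.mp hi with rfl | hi
    · rw [map_add, ← h' u, LinearMap.sub_apply, LinearMap.flip_apply, LieHom.coe_toLinearMap,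
        add_sub_cancel]
    · rw [map_add, (hN' n').mp hn' i hi, add_zero, hn i hi]

end Whitehead

/-! ### Derivations with values in a module supported on s -/

section Derivations

attribute [local instance 100] LieRing.ofAssociativeRing

open Module

variable {k : Type u} {A : Type v} {g : Type w} {Γ : Type*} [Field k] [CommRing A] [Algebra k A]
  [LieRing g] [LieAlgebra k g] [Group Γ]
  {ρA : Γ →* (A ≃ₐ[k] A)} {ρg : Γ →* (g ≃ₗ⁅k⁆ g)} {s : Finset (A →ₐ[k] k)}

/-- Functions that are `1` to second order at one of the points of `s` and vanish to second order
at all the other points of the orbits meeting `s`. -/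
structure IsLocalizer (ρA : Γ →* (A ≃ₐ[k] A)) (s : Finset (A →ₐ[k] k)) (e : s → A) : Prop where
  sub_one_mem : ∀ x : s, e x - 1 ∈ RingHom.ker (x : A →ₐ[k] k) ^ 2
  map_mem : ∀ (x : s) (γ : Γ) (y : s), (γ ≠ 1 ∨ y ≠ x) →
    ρA γ (e x) ∈ RingHom.ker (y : A →ₐ[k] k) ^ 2

theorem exists_isLocalizer [Finite Γ] (hfree : ActsFreely ρA) (hs : s ∈ orbitSeparated ρA) :
    ∃ e, IsLocalizer ρA s e := by
  choose e h1 h2 using exists_localizer ρA hfree hs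
  exact ⟨e, h1, h2⟩

namespace IsLocalizer

variable [Fintype Γ] {e : s → A} (he : IsLocalizer ρA s e) [Module.Finite k g]
include he

theorem lift_self (x : s) (β : A ⊗[k] g) : (localLift ρA ρg (e x) β : A ⊗[k] g) - β ∈
    tensorIdeal k g (RingHom.ker (x : A →ₐ[k] k) ^ 2) :=
  localLift_sub_mem ρA ρg (he.sub_one_mem x) (fun γ hγ => he.map_mem x γ x (Or.inl hγ)) β

theorem lift_ne {x y : s} (h : y ≠ x) (β : A ⊗[k] g) : (localLift ρA ρg (e x) β : A ⊗[k] g) ∈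
    tensorIdeal k g (RingHom.ker (y : A →ₐ[k] k) ^ 2) :=
  localLift_mem ρA ρg (fun γ => he.map_mem x γ y (Or.inr h)) β

end IsLocalizer

theorem evalAt_eq_of_sub_mem_sq [Module.Finite k g] {x : A →ₐ[k] k} {α β : A ⊗[k] g}
    (h : α - β ∈ tensorIdeal k g (RingHom.ker x ^ 2)) : evalAt x α = evalAt x β := by
  rw [← sub_eq_zero, ← map_sub, evalAt_eq_zero_iff]
  exact tensorIdeal_mono (Ideal.pow_le_self two_ne_zero) h

theorem evalAt_eq_zero_of_mem_sq [Module.Finite k g] {x : A →ₐ[k] k} {α : A ⊗[k] g}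
    (h : α ∈ tensorIdeal k g (RingHom.ker x ^ 2)) : evalAt x α = 0 :=
  evalAt_eq_zero_iff.mpr (tensorIdeal_mono (Ideal.pow_le_self two_ne_zero) h)

namespace IsLocalizer

variable [Fintype Γ] {e : s → A} (he : IsLocalizer ρA s e) [Module.Finite k g]
include he

theorem evalAt_lift_self (x : s) (β : A ⊗[k] g) :
    evalAt (x : A →ₐ[k] k) (localLift ρA ρg (e x) β : A ⊗[k] g) = evalAt (x : A →ₐ[k] k) β :=
  evalAt_eq_of_sub_mem_sq (he.lift_self x β)

theorem evalAt_lift_ne {x y : s} (h : y ≠ x) (β : A ⊗[k] g) :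
    evalAt (y : A →ₐ[k] k) (localLift ρA ρg (e x) β : A ⊗[k] g) = 0 :=
  evalAt_eq_zero_of_mem_sq (he.lift_ne h β)

/-- At y the lift for y reproduces the 1-jet of α and all other lifts vanish to second order. -/
theorem sub_sum_lift_mem (α : A ⊗[k] g) (y : s) :
    α - ∑ x : s, (localLift ρA ρg (e x) α : A ⊗[k] g) ∈
      tensorIdeal k g (RingHom.ker (y : A →ₐ[k] k) ^ 2) := by
  classical
  rw [← Finset.add_sum_erase _ _ (Finset.mem_univ y), ← sub_sub]
  refine Submodule.sub_mem _ ?_ (Submodule.sum_mem _ fun x hx =>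
    he.lift_ne (Finset.ne_of_mem_erase hx).symm α)
  rw [← neg_sub]
  exact Submodule.neg_mem _ (he.lift_self y α)

theorem evalAt_sum_lift (β : s → A ⊗[k] g) (y : s) :
    evalAt (y : A →ₐ[k] k) (∑ x : s, (localLift ρA ρg (e x) (β x) : A ⊗[k] g)) =
      evalAt (y : A →ₐ[k] k) (β y) := by
  classical
  rw [map_sum, Finset.sum_eq_single y, he.evalAt_lift_self]
  · exact fun x _ hx => he.evalAt_lift_ne hx.symm _
  · simp

end IsLocalizer

section Module

variable {N : Type*} [AddCommGroup N] [Module k N] [LieRingModule (equivariantMapAlgebra ρA ρg) N]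
  [LieModule k (equivariantMapAlgebra ρA ρg) N]

variable (ρA ρg s N) in
/-- The module `N` depends only on the values of equivariant maps at the points of `s`. -/
def FactorsThrough : Prop :=
  ∀ α : equivariantMapAlgebra ρA ρg, (∀ x ∈ s, evalAt x (α : A ⊗[k] g) = 0) → ∀ n : N, ⁅α, n⁆ = 0

omit [Module k N] [LieModule k (equivariantMapAlgebra ρA ρg) N] in
theorem FactorsThrough.lie_eq (hN : FactorsThrough ρA ρg s N) {α β : equivariantMapAlgebra ρA ρg}
    (h : ∀ x : s, evalAt (x : A →ₐ[k] k) (α : A ⊗[k] g) = evalAt (x : A →ₐ[k] k) (β : A ⊗[k] g))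
    (n : N) : ⁅α, n⁆ = ⁅β, n⁆ := by
  rw [← sub_eq_zero, ← sub_lie]
  refine hN _ (fun x hx => ?_) n
  have := h ⟨x, hx⟩
  rw [AddSubgroupClass.coe_sub, map_sub, this, sub_self]

variable (ρA ρg N) in
/-- The linear maps `g → N` that are equivariant for the action of equivariant maps on `g` by
evaluation at `x`. -/
def evalEquivariantHoms (x : A →ₐ[k] k) : Submodule k (g →ₗ[k] N) where
  carrier := {φ | ∀ (α : equivariantMapAlgebra ρA ρg) (u : g),
    φ ⁅evalAt x (α : A ⊗[k] g), u⁆ = ⁅α, φ u⁆}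
  add_mem' ha hb α u := by
    rw [LinearMap.add_apply, ha, hb, LinearMap.add_apply, lie_add]
  zero_mem' α u := by simp
  smul_mem' c φ hφ α u := by
    rw [LinearMap.smul_apply, hφ, LinearMap.smul_apply, lie_smul]

variable [Module.Finite k g] [Fintype Γ] {e : s → A}

/-- The representation of `g` through which equivariant maps supported near `x` act. -/
noncomputable def pointRep (he : IsLocalizer ρA s e) (hN : FactorsThrough ρA ρg s N) (x : s) :
    g →ₗ⁅k⁆ Module.End k N where
  toFun u := LieModule.toEnd k (equivariantMapAlgebra ρA ρg) N
    (localLift ρA ρg (e x) (1 ⊗ₜ u))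
  map_add' u v := by rw [TensorProduct.tmul_add, map_add, map_add]
  map_smul' c u := by rw [TensorProduct.tmul_smul, map_smul, map_smul]; rfl
  map_lie' {u v} := by
    rw [← LieHom.map_lie]
    ext n
    rw [LieModule.toEnd_apply_apply, LieModule.toEnd_apply_apply]
    refine hN.lie_eq (fun y => ?_) n
    rw [LieSubalgebra.coe_bracket, LieHom.map_lie]
    rcases eq_or_ne y x with rfl | hy
    · simp only [he.evalAt_lift_self, evalAt_tmul, map_one, one_smul]
    · simp only [he.evalAt_lift_ne hy, lie_zero]

variable (he : IsLocalizer ρA s e) (hN : FactorsThrough ρA ρg s N)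

theorem pointRep_apply (x : s) (u : g) (n : N) :
    pointRep he hN x u n = ⁅localLift ρA ρg (e x) (1 ⊗ₜ u), n⁆ := rfl

include he hN in
theorem lie_lift (x : s) (β : A ⊗[k] g) (n : N) :
    ⁅localLift ρA ρg (e x) β, n⁆ = pointRep he hN x (evalAt (x : A →ₐ[k] k) β) n := by
  rw [pointRep_apply]
  refine hN.lie_eq (fun y => ?_) n
  rcases eq_or_ne y x with rfl | hy
  · simp only [he.evalAt_lift_self, evalAt_tmul, map_one, one_smul]
  · simp only [he.evalAt_lift_ne hy]

theorem lie_eq_sum_pointRep (α : equivariantMapAlgebra ρA ρg) (n : N) :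
    ⁅α, n⁆ = ∑ x : s, pointRep he hN x (evalAt (x : A →ₐ[k] k) (α : A ⊗[k] g)) n := by
  simp only [← lie_lift he hN, ← LieModule.toEnd_apply_apply k]
  rw [← LinearMap.sum_apply, ← map_sum]
  refine hN.lie_eq (fun y => ?_) n
  rw [AddSubmonoidClass.coe_finsetSum, he.evalAt_sum_lift]

/-- The commutator of lifts at distinct points of s vanishes on s. -/
theorem pointRep_comm {x y : s} (h : x ≠ y) (u v : g) (n : N) :
    pointRep he hN x u (pointRep he hN y v n) = pointRep he hN y v (pointRep he hN x u n) := by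
  rw [← sub_eq_zero]
  simp only [pointRep_apply]
  rw [← lie_lie]
  refine hN _ (fun z hz => ?_) n
  rw [LieSubalgebra.coe_bracket, LieHom.map_lie]
  by_cases hx : (⟨z, hz⟩ : s) = x
  · have := he.evalAt_lift_ne (ρg := ρg) (y := ⟨z, hz⟩) (fun h' => h (hx.symm.trans h')) (1 ⊗ₜ[k] v)
    rw [this, lie_zero]
  · have := he.evalAt_lift_ne (ρg := ρg) (y := ⟨z, hz⟩) hx (1 ⊗ₜ[k] u)
    rw [this, zero_lie]

section Derivation

variable [IsAlgClosed k] [CharZero k] [Algebra.FiniteType k A]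
    [LieAlgebra.IsKilling k g] (hfree : ActsFreely ρA) (hs : s ∈ orbitSeparated ρA)

include hN hfree hs in
-- Such an α is a sum of brackets [κ, κ'] of maps vanishing on s. Both κ and κ' act by zero on N, so
-- D[κ, κ'] = κD(κ') - κ'D(κ) = 0.
theorem derivation_eq_zero (D : LieDerivation k (equivariantMapAlgebra ρA ρg) N)
    {α : equivariantMapAlgebra ρA ρg}
    (hα : ∀ x : s, (α : A ⊗[k] g) ∈ tensorIdeal k g (RingHom.ker (x : A →ₐ[k] k) ^ 2)) :
    D α = 0 := by
  have h := mem_span_lie_of_vanishing_sq ρA ρg hfree hs α.2 fun x hx => hα ⟨x, hx⟩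
  obtain ⟨α, hα'⟩ := α
  clear hα
  change α ∈ _ at h
  -- Span induction runs in A ⊗ g, so the membership needed to apply D is carried along.
  suffices H : ∃ h : α ∈ equivariantMapAlgebra ρA ρg, D ⟨α, h⟩ = 0 from H.2
  clear hα'
  induction h using Submodule.span_induction with
  | mem z hz =>
    obtain ⟨κ, hκ, hκ0, κ', hκ', hκ0', rfl⟩ := hz
    refine ⟨LieSubalgebra.lie_mem _ hκ hκ', ?_⟩
    change D ⁅(⟨κ, hκ⟩ : equivariantMapAlgebra ρA ρg), ⟨κ', hκ'⟩⁆ = 0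
    rw [D.apply_lie_eq_sub, hN ⟨κ, hκ⟩ hκ0, hN ⟨κ', hκ'⟩ hκ0', sub_zero]
  | zero => exact ⟨zero_mem _, map_zero D⟩
  | add a b _ _ ha hb =>
    obtain ⟨ha, ha0⟩ := ha
    obtain ⟨hb, hb0⟩ := hb
    refine ⟨add_mem ha hb, ?_⟩
    change D (⟨a, ha⟩ + ⟨b, hb⟩) = 0
    rw [map_add, ha0, hb0, add_zero]
  | smul c a _ ha =>
    obtain ⟨ha, ha0⟩ := ha
    refine ⟨(equivariantMapAlgebra ρA ρg).smul_mem c ha, ?_⟩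
    change D (c • ⟨a, ha⟩) = 0
    rw [map_smul, ha0, smul_zero]

include hN hfree hs in
theorem derivation_eq (D : LieDerivation k (equivariantMapAlgebra ρA ρg) N)
    {α β : equivariantMapAlgebra ρA ρg}
    (h : ∀ x : s, (α : A ⊗[k] g) - (β : A ⊗[k] g) ∈
      tensorIdeal k g (RingHom.ker (x : A →ₐ[k] k) ^ 2)) : D α = D β := by
  rw [← sub_eq_zero, ← map_sub]
  exact derivation_eq_zero hN hfree hs D h

include he hN hfree hs in
theorem derivation_eq_sum (D : LieDerivation k (equivariantMapAlgebra ρA ρg) N)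
    (α : equivariantMapAlgebra ρA ρg) : D α = ∑ x : s, D (localLift ρA ρg (e x) α) := by
  rw [← map_sum]
  refine derivation_eq hN hfree hs D fun y => ?_
  rw [AddSubmonoidClass.coe_finsetSum]
  exact he.sub_sum_lift_mem _ y

include he hN hfree hs in
theorem derivation_lift_eq (D : LieDerivation k (equivariantMapAlgebra ρA ρg) N) {x : s}
    {β β' : A ⊗[k] g} (h : β - β' ∈ tensorIdeal k g (RingHom.ker (x : A →ₐ[k] k) ^ 2)) :
    D (localLift ρA ρg (e x) β) = D (localLift ρA ρg (e x) β') := by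
  refine derivation_eq hN hfree hs D fun y => ?_
  rw [← AddSubgroupClass.coe_sub, ← map_sub]
  rcases eq_or_ne y x with rfl | hy
  · have := he.lift_self (ρg := ρg) y (β - β')
    exact (Submodule.sub_mem_iff_left _ h).mp this
  · exact he.lift_ne hy _

include he hN hfree hs in
-- Both arguments have the same 1-jets on s: at x they agree with [α, β], and at the other points
-- they vanish to second order.
theorem derivation_lie_lift (D : LieDerivation k (equivariantMapAlgebra ρA ρg) N) {x : s}
    (α : equivariantMapAlgebra ρA ρg) (β : A ⊗[k] g) :
    D ⁅α, localLift ρA ρg (e x) β⁆ = D (localLift ρA ρg (e x) ⁅(α : A ⊗[k] g), β⁆) := by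
  refine derivation_eq hN hfree hs D fun y => ?_
  rw [LieSubalgebra.coe_bracket]
  rcases eq_or_ne y x with rfl | hy
  · have h1 := he.lift_self (ρg := ρg) y ⁅(α : A ⊗[k] g), β⁆
    have h2 := lie_mem_tensorIdeal_right (α : A ⊗[k] g) (he.lift_self (ρg := ρg) y β)
    rw [lie_sub] at h2
    have := Submodule.sub_mem _ h2 h1
    rwa [sub_sub_sub_cancel_right] at this
  · exact Submodule.sub_mem _ (lie_mem_tensorIdeal_right _ (he.lift_ne hy _)) (he.lift_ne hy _)

include he hN hfree hs in
theorem derivation_lie_lift_lift (D : LieDerivation k (equivariantMapAlgebra ρA ρg) N) {x y : s}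
    (h : x ≠ y) (β β' : A ⊗[k] g) :
    D ⁅localLift ρA ρg (e x) β, localLift ρA ρg (e y) β'⁆ = 0 := by
  refine derivation_eq_zero hN hfree hs D fun z => ?_
  rw [LieSubalgebra.coe_bracket]
  by_cases hx : z = x
  · exact lie_mem_tensorIdeal_right _ (he.lift_ne (fun h' => h (hx.symm.trans h')) _)
  · exact lie_mem_tensorIdeal_left (he.lift_ne hx _) _

include he hN hfree hs in
/-- Up to inner derivations, a derivation vanishes on the constant parts. -/
theorem exists_sub_inner [Module.Finite k N]
    (D : LieDerivation k (equivariantMapAlgebra ρA ρg) N) :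
    ∃ n : N, ∀ (x : s) (u : g), D (localLift ρA ρg (e x) (1 ⊗ₜ u)) =
      ⁅localLift ρA ρg (e x) (1 ⊗ₜ u), n⁆ := by
  let c : s → g →ₗ[k] N := fun x =>
    D.toLinearMap ∘ₗ localLift ρA ρg (e x) ∘ₗ TensorProduct.mk k A g 1
  have hc : ∀ x u, c x u = D (localLift ρA ρg (e x) (1 ⊗ₜ u)) := fun _ _ => rfl
  have hcoc : ∀ x u v, c x ⁅u, v⁆ = pointRep he hN x u (c x v) - pointRep he hN x v (c x u) := by
    intro x u v
    simp only [hc, pointRep_apply]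
    rw [← D.apply_lie_eq_sub, derivation_lie_lift he hN hfree hs]
    refine derivation_lift_eq he hN hfree hs D ?_
    have := lie_mem_tensorIdeal_left (he.lift_self (ρg := ρg) x (1 ⊗ₜ u)) (1 ⊗ₜ[k] v)
    rw [sub_lie, LieAlgebra.ExtendScalars.bracket_tmul, one_mul] at this
    rw [← neg_sub]
    exact Submodule.neg_mem _ this
  -- The bracket of lifts at distinct points vanishes to second order on s, so D kills it; the
  -- Leibniz rule turns this into the compatibility of the two cocycles.
  have hcross : ∀ x y, x ≠ y → ∀ u v,
      pointRep he hN x u (c y v) = pointRep he hN y v (c x u) := by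
    intro x y hxy u v
    simp only [hc, pointRep_apply]
    rw [← sub_eq_zero, ← D.apply_lie_eq_sub, derivation_lie_lift_lift he hN hfree hs D hxy]
  obtain ⟨n, hn⟩ := exists_common_primitive (Finset.univ : Finset s) (pointRep he hN) c hcoc hcross
    fun x y hxy u v n => pointRep_comm he hN hxy u v n
  exact ⟨n, fun x u => hn x (Finset.mem_univ x) u⟩

end Derivation

end Module

end Derivations

/-! ### Outer derivations and cotangent spaces -/

section OuterDerivations

attribute [local instance 100] LieRing.ofAssociativeRing

open Module

variable {k : Type u} {A : Type v} {g : Type w} {Γ : Type*} [Field k] [CommRing A] [Algebra k A]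
  [LieRing g] [LieAlgebra k g] [Group Γ]
  {ρA : Γ →* (A ≃ₐ[k] A)} {ρg : Γ →* (g ≃ₗ⁅k⁆ g)} {s : Finset (A →ₐ[k] k)}

theorem nonempty_quotient_equiv_of_surjective {R M P : Type*} [Ring R] [AddCommGroup M] [Module R M]
    [AddCommGroup P] [Module R P] (f : M →ₗ[R] P) {K : Submodule R M} (hK : LinearMap.ker f = K)
    (hf : Function.Surjective f) : Nonempty ((M ⧸ K) ≃ₗ[R] P) := by
  subst hK
  exact ⟨f.quotKerEquivOfSurjective hf⟩

theorem sub_algebraMap_mem_ker (x : A →ₐ[k] k) (f : A) :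
    f - algebraMap k A (x f) ∈ RingHom.ker x := by simp [RingHom.mem_ker]

/-- The differential of a function at a rational point. -/
noncomputable def cotangentMap (x : A →ₐ[k] k) : A →ₗ[k] (RingHom.ker x).Cotangent where
  toFun f := (RingHom.ker x).toCotangent ⟨f - algebraMap k A (x f), sub_algebraMap_mem_ker x f⟩
  map_add' f f' := by
    rw [← map_add]
    congr 1
    ext
    simp only [map_add, Submodule.coe_add]
    ring
  map_smul' c f := by
    rw [RingHom.id_apply, ← LinearMap.map_smul_of_tower]
    congr 1
    ext
    change c • f - algebraMap k A (x (c • f)) = c • (f - algebraMap k A (x f))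
    rw [map_smul, smul_eq_mul, map_mul, Algebra.smul_def, Algebra.smul_def]
    ring

theorem cotangentMap_apply (x : A →ₐ[k] k) (f : A) : cotangentMap x f =
    (RingHom.ker x).toCotangent ⟨f - algebraMap k A (x f), sub_algebraMap_mem_ker x f⟩ := rfl

theorem cotangentMap_of_mem {x : A →ₐ[k] k} {f : A} (hf : f ∈ RingHom.ker x) :
    cotangentMap x f = (RingHom.ker x).toCotangent ⟨f, hf⟩ := by
  rw [cotangentMap_apply]
  congr 1
  ext
  simp [show x f = 0 from hf]

theorem cotangentMap_eq_zero_of_mem {x : A →ₐ[k] k} {f : A} (hf : f ∈ RingHom.ker x ^ 2) :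
    cotangentMap x f = 0 := by
  rw [cotangentMap_of_mem (Ideal.pow_le_self two_ne_zero hf), Ideal.toCotangent_eq_zero]
  exact hf

theorem cotangentMap_mul (x : A →ₐ[k] k) (f f' : A) :
    cotangentMap x (f * f') = x f • cotangentMap x f' + x f' • cotangentMap x f := by
  rw [← map_smul, ← map_smul, ← map_add, ← sub_eq_zero, ← map_sub]
  have h : (f - algebraMap k A (x f)) * (f' - algebraMap k A (x f')) ∈ RingHom.ker x ^ 2 := by
    rw [pow_two]
    exact Ideal.mul_mem_mul (sub_algebraMap_mem_ker x f) (sub_algebraMap_mem_ker x f')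
  have h1 : cotangentMap x (algebraMap k A (x f * x f')) = 0 := by
    rw [cotangentMap_apply, Ideal.toCotangent_eq_zero]
    simp
  rw [← add_zero (cotangentMap x _), ← h1, ← map_add]
  convert cotangentMap_eq_zero_of_mem h using 2
  rw [Algebra.smul_def, Algebra.smul_def, map_mul]
  ring

theorem cotangentMap_surjective (x : A →ₐ[k] k) : Function.Surjective (cotangentMap x) := by
  intro ξ
  obtain ⟨⟨a, ha⟩, rfl⟩ := (RingHom.ker x).toCotangent_surjective ξ
  exact ⟨a, cotangentMap_of_mem ha⟩

theorem smul_cotangent (x : A →ₐ[k] k) (f : A) (ξ : (RingHom.ker x).Cotangent) :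
    f • ξ = x f • ξ := by
  have h := Ideal.Cotangent.smul_eq_zero_of_mem (sub_algebraMap_mem_ker x f) ξ
  rwa [sub_smul, sub_eq_zero, algebraMap_smul] at h

/-- The ideal is finitely generated, and A acts on the cotangent space through the residue field k.
-/
instance cotangent_finite [Algebra.FiniteType k A] (x : A →ₐ[k] k) :
    Module.Finite k (RingHom.ker x).Cotangent := by
  have : IsNoetherianRing A := Algebra.FiniteType.isNoetherianRing k A
  obtain ⟨t, ht⟩ := (Module.Finite.of_surjective _ (RingHom.ker x).toCotangent_surjective).fg_top
  refine ⟨t, eq_top_iff.mpr fun ξ _ => ?_⟩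
  have hξ : ξ ∈ Submodule.span A (t : Set (RingHom.ker x).Cotangent) := ht ▸ trivial
  induction hξ using Submodule.span_induction with
  | mem ξ hξ => exact Submodule.subset_span hξ
  | zero => exact zero_mem _
  | add a b _ _ ha hb => exact add_mem (ha trivial) (hb trivial)
  | smul f a _ ha =>
    rw [smul_cotangent]
    exact Submodule.smul_mem _ _ (ha trivial)

variable {N : Type*} [AddCommGroup N] [Module k N] [LieRingModule (equivariantMapAlgebra ρA ρg) N]
  [LieModule k (equivariantMapAlgebra ρA ρg) N]

section FirstOrder

variable {x : A →ₐ[k] k}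

/-- The linear map on `A ⊗ g` depending on first derivatives at `x` through `h`. -/
noncomputable def firstOrder
    (h : (RingHom.ker x).Cotangent →ₗ[k] evalEquivariantHoms ρA ρg N x) : A ⊗[k] g →ₗ[k] N :=
  TensorProduct.lift ((evalEquivariantHoms ρA ρg N x).subtype ∘ₗ h ∘ₗ cotangentMap x)

variable (h : (RingHom.ker x).Cotangent →ₗ[k] evalEquivariantHoms ρA ρg N x)

theorem firstOrder_tmul (f : A) (u : g) :
    firstOrder h (f ⊗ₜ u) = (h (cotangentMap x f) : g →ₗ[k] N) u := rfl

theorem firstOrder_eq_zero [Module.Finite k g] {β : A ⊗[k] g}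
    (hβ : β ∈ tensorIdeal k g (RingHom.ker x ^ 2)) : firstOrder h β = 0 := by
  refine tensorIdeal_induction (P := fun β => firstOrder h β = 0) (map_zero _)
    (fun α β ha hb => by rw [map_add, ha, hb, add_zero]) (fun a ha u => ?_) hβ
  rw [firstOrder_tmul, cotangentMap_eq_zero_of_mem ha, map_zero]
  rfl

theorem firstOrder_lie_one (α : equivariantMapAlgebra ρA ρg) (β : A ⊗[k] g) :
    firstOrder h ⁅(1 : A) ⊗ₜ[k] evalAt x (α : A ⊗[k] g), β⁆ = ⁅α, firstOrder h β⁆ := by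
  induction β using TensorProduct.induction_on with
  | zero => simp
  | add β β' hβ hβ' => rw [lie_add, map_add, hβ, hβ', map_add, lie_add]
  | tmul f u =>
    rw [LieAlgebra.ExtendScalars.bracket_tmul, one_mul, firstOrder_tmul, firstOrder_tmul]
    exact (h (cotangentMap x f)).2 α u

/-- This is d(ff') = f(x)df' + f'(x)df. Together with equivariance of the values of h, it is exactly
the derivation rule. -/
theorem firstOrder_lie (β β' : A ⊗[k] g) :
    firstOrder h ⁅β, β'⁆ = firstOrder h ⁅(1 : A) ⊗ₜ[k] evalAt x β, β'⁆ -
      firstOrder h ⁅(1 : A) ⊗ₜ[k] evalAt x β', β⁆ := by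
  induction β using TensorProduct.induction_on with
  | zero => simp
  | add β₁ β₂ h₁ h₂ =>
    simp only [add_lie, lie_add, map_add, h₁, h₂, TensorProduct.tmul_add]
    abel
  | tmul f u =>
    induction β' using TensorProduct.induction_on with
    | zero => simp
    | add β₁ β₂ h₁ h₂ =>
      simp only [add_lie, lie_add, map_add, h₁, h₂, TensorProduct.tmul_add]
      abel
    | tmul f' u' =>
      simp only [LieAlgebra.ExtendScalars.bracket_tmul, evalAt_tmul, firstOrder_tmul, one_mul,
        smul_lie, cotangentMap_mul, map_add, map_smul, Submodule.coe_add, Submodule.coe_smul,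
        LinearMap.add_apply, LinearMap.smul_apply]
      rw [← lie_skew u' u, map_neg, smul_neg, sub_neg_eq_add]

theorem firstOrder_derivation (α β : equivariantMapAlgebra ρA ρg) :
    firstOrder h ⁅(α : A ⊗[k] g), (β : A ⊗[k] g)⁆ =
      ⁅α, firstOrder h (β : A ⊗[k] g)⁆ - ⁅β, firstOrder h (α : A ⊗[k] g)⁆ := by
  rw [firstOrder_lie, firstOrder_lie_one, firstOrder_lie_one]

end FirstOrder

/-- The derivation assembled from first order data at the points of `s`. -/
noncomputable def firstOrderDerivation
    (h : ∀ x : s, (RingHom.ker (x : A →ₐ[k] k)).Cotangent →ₗ[k] evalEquivariantHoms ρA ρg N x) :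
    LieDerivation k (equivariantMapAlgebra ρA ρg) N where
  toLinearMap := (∑ x, firstOrder (h x)) ∘ₗ (equivariantMapAlgebra ρA ρg).toSubmodule.subtype
  leibniz' α β := by
    change (∑ x, firstOrder (h x)) ⁅(α : A ⊗[k] g), (β : A ⊗[k] g)⁆ =
      ⁅α, (∑ x, firstOrder (h x)) (β : A ⊗[k] g)⁆ - ⁅β, (∑ x, firstOrder (h x)) (α : A ⊗[k] g)⁆
    simp only [LinearMap.sum_apply, firstOrder_derivation, lie_sum, Finset.sum_sub_distrib]

theorem firstOrderDerivation_apply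
    (h : ∀ x : s, (RingHom.ker (x : A →ₐ[k] k)).Cotangent →ₗ[k] evalEquivariantHoms ρA ρg N x)
    (α : equivariantMapAlgebra ρA ρg) :
    firstOrderDerivation h α = ∑ x, firstOrder (h x) (α : A ⊗[k] g) := by
  change (∑ x, firstOrder (h x)) (α : A ⊗[k] g) = _
  rw [LinearMap.sum_apply]

variable [Module.Finite k g] [Fintype Γ] {e : s → A}
  [IsAlgClosed k] [CharZero k] [Algebra.FiniteType k A] [LieAlgebra.IsKilling k g]

variable (he : IsLocalizer ρA s e) (hN : FactorsThrough ρA ρg s N)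
  (hfree : ActsFreely ρA) (hs : s ∈ orbitSeparated ρA) (x : s)

include he hN in
omit [IsAlgClosed k] [CharZero k] [Algebra.FiniteType k A] [LieAlgebra.IsKilling k g] in
theorem lie_lift_eq_zero {a : A} (ha : a ∈ RingHom.ker x.1) (u : g) (n : N) :
    ⁅localLift ρA ρg (e x) (a ⊗ₜ u), n⁆ = 0 := by
  rw [lie_lift he hN, evalAt_tmul, RingHom.mem_ker.mp ha, zero_smul, map_zero]
  rfl

include he hN hfree hs in
-- The lift of a ⊗ u acts by zero on N, so the Leibniz rule for its bracket with α keeps one term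
-- only; and [α, a ⊗ u] ≡ a ⊗ [α(x), u] modulo 𝔪ₓ².
theorem derivation_lift_equivariant (D : LieDerivation k (equivariantMapAlgebra ρA ρg) N) {a : A}
    (ha : a ∈ RingHom.ker x.1) (α : equivariantMapAlgebra ρA ρg) (u : g) :
    D (localLift ρA ρg (e x) (a ⊗ₜ ⁅evalAt x.1 (α : A ⊗[k] g), u⁆)) =
      ⁅α, D (localLift ρA ρg (e x) (a ⊗ₜ u))⁆ := by
  have h1 := D.apply_lie_eq_sub α (localLift ρA ρg (e x) (a ⊗ₜ u))
  rw [lie_lift_eq_zero he hN x ha, sub_zero, derivation_lie_lift he hN hfree hs] at h1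
  rw [← h1]
  refine derivation_lift_eq he hN hfree hs D ?_
  have h2 := lie_mem_tensorIdeal_mul (sub_one_tmul_evalAt_mem x.1 (α : A ⊗[k] g))
    (tmul_mem_tensorIdeal ha u)
  rw [sub_lie, LieAlgebra.ExtendScalars.bracket_tmul, one_mul, ← pow_two] at h2
  rw [← neg_sub]
  exact Submodule.neg_mem _ h2

/-- The first order part of a derivation at a point of `s`. -/
noncomputable def derivationSymbol (σ : (RingHom.ker x.1).Cotangent →ₗ[k] A)
    (hσ : ∀ ξ, σ ξ ∈ RingHom.ker x.1) :
    LieDerivation k (equivariantMapAlgebra ρA ρg) N →ₗ[k]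
      (RingHom.ker x.1).Cotangent →ₗ[k] evalEquivariantHoms ρA ρg N x.1 where
  toFun D := LinearMap.codRestrict _
    ((TensorProduct.mk k A g).compr₂ (D.toLinearMap ∘ₗ localLift ρA ρg (e x)) ∘ₗ σ)
    fun ξ α u => derivation_lift_equivariant he hN hfree hs x D (hσ ξ) α u
  map_add' _ _ := rfl
  map_smul' _ _ := rfl

include he hN hfree hs in
theorem derivation_eq_zero_of_symbol (D : LieDerivation k (equivariantMapAlgebra ρA ρg) N)
    (h1 : ∀ (x : s) (u : g), D (localLift ρA ρg (e x) (1 ⊗ₜ u)) = 0)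
    (h2 : ∀ (x : s), ∀ a ∈ RingHom.ker x.1, ∀ u, D (localLift ρA ρg (e x) (a ⊗ₜ u)) = 0) :
    D = 0 := by
  have h3 : ∀ (x : s) (β : A ⊗[k] g), D (localLift ρA ρg (e x) β) = 0 := by
    intro x β
    induction β using TensorProduct.induction_on with
    | zero => rw [map_zero, map_zero]
    | add β β' h h' => rw [map_add, map_add, h, h', add_zero]
    | tmul f u =>
      have h4 := h2 x _ (sub_algebraMap_mem_ker x.1 f) u
      rw [TensorProduct.sub_tmul, map_sub, map_sub, Algebra.algebraMap_eq_smul_one,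
        ← TensorProduct.smul_tmul', map_smul, map_smul, h1, smul_zero, sub_zero] at h4
      exact h4
  ext α
  rw [derivation_eq_sum he hN hfree hs D α]
  simp [h3]

set_option maxHeartbeats 2000000 in
include hN hfree hs in
/-- Derivations modulo inner derivations are the homomorphisms from the cotangent spaces to
equivariant maps. -/
theorem nonempty_outerDerivations_equiv [Module.Finite k N] :
    Nonempty ((LieDerivation k (equivariantMapAlgebra ρA ρg) N ⧸
        LinearMap.range (LieDerivation.inner k (equivariantMapAlgebra ρA ρg) N)) ≃ₗ[k]
      (∀ x : s, (RingHom.ker (x : A →ₐ[k] k)).Cotangent →ₗ[k] evalEquivariantHoms ρA ρg N x)) := by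
  obtain ⟨e, he⟩ := exists_isLocalizer hfree hs
  choose σ hσ using fun x : s => LinearMap.exists_rightInverse_of_surjective (cotangentMap x.1)
    (LinearMap.range_eq_top.mpr (cotangentMap_surjective x.1))
  -- A linear section of the differential, corrected by constants so as to take values in 𝔪ₓ.
  let σ' : ∀ x : s, (RingHom.ker (x : A →ₐ[k] k)).Cotangent →ₗ[k] A := fun x =>
    σ x - Algebra.linearMap k A ∘ₗ x.1.toLinearMap ∘ₗ σ x
  have hσker : ∀ x ξ, σ' x ξ ∈ RingHom.ker x.1 := fun x ξ => sub_algebraMap_mem_ker x.1 (σ x ξ)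
  have hσ' : ∀ x ξ, cotangentMap x.1 (σ' x ξ) = ξ := fun x ξ => by
    rw [cotangentMap_of_mem (hσker x ξ)]
    exact LinearMap.congr_fun (hσ x) ξ
  let Ψ : LieDerivation k (equivariantMapAlgebra ρA ρg) N →ₗ[k]
      (∀ x : s, (RingHom.ker (x : A →ₐ[k] k)).Cotangent →ₗ[k] evalEquivariantHoms ρA ρg N x) :=
    LinearMap.pi fun x => derivationSymbol he hN hfree hs x (σ' x) (hσker x)
  have hΨ : ∀ D x ξ u, ((Ψ D x ξ : g →ₗ[k] N)) u = D (localLift ρA ρg (e x) (σ' x ξ ⊗ₜ u)) :=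
    fun _ _ _ _ => rfl
  -- An inner derivation has zero symbol because lifts of 𝔪ₓ ⊗ g act by zero. Conversely, Whitehead
  -- removes the constant parts of D, and a vanishing symbol removes the rest.
  have hker : LinearMap.ker Ψ =
      LinearMap.range (LieDerivation.inner k (equivariantMapAlgebra ρA ρg) N) := by
    apply le_antisymm
    · intro D hD
      have hD : ∀ x ξ u, D (localLift ρA ρg (e x) (σ' x ξ ⊗ₜ u)) = 0 := by
        intro x ξ u
        rw [← hΨ, LinearMap.mem_ker.mp hD]
        rfl
      obtain ⟨n, hn⟩ := exists_sub_inner he hN hfree hs D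
      refine ⟨n, ?_⟩
      symm
      rw [← sub_eq_zero]
      refine derivation_eq_zero_of_symbol he hN hfree hs _ (fun x u => ?_) fun x a ha u => ?_
      · rw [LieDerivation.sub_apply, hn, LieDerivation.inner_apply_apply]
        exact sub_self _
      · have h1 : a - σ' x (cotangentMap x.1 a) ∈ RingHom.ker x.1 ^ 2 := by
          refine (RingHom.ker x.1).toCotangent_eq (x := ⟨a, ha⟩)
            (y := ⟨_, hσker x (cotangentMap x.1 a)⟩) |>.mp ?_
          rw [← cotangentMap_of_mem, ← cotangentMap_of_mem, hσ']
        rw [LieDerivation.sub_apply, LieDerivation.inner_apply_apply,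
          derivation_lift_eq he hN hfree hs D (β' := σ' x (cotangentMap x.1 a) ⊗ₜ u)
            (by rw [← TensorProduct.sub_tmul]; exact tmul_mem_tensorIdeal h1 u), hD]
        change 0 - ⁅_, n⁆ = 0
        rw [lie_lift_eq_zero he hN x ha, sub_zero]
    · rintro _ ⟨n, rfl⟩
      rw [LinearMap.mem_ker]
      funext x
      refine LinearMap.ext fun ξ => Subtype.ext (LinearMap.ext fun u => ?_)
      rw [hΨ, LieDerivation.inner_apply_apply]
      exact lie_lift_eq_zero he hN x (hσker x ξ) u n
  -- The derivation built from first-order data has these data as its symbol: a lift at x has the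
  -- prescribed 1-jet there and trivial 1-jets at the other points.
  have hsurj : Function.Surjective Ψ := by
    intro h
    refine ⟨firstOrderDerivation h, ?_⟩
    funext x
    refine LinearMap.ext fun ξ => Subtype.ext (LinearMap.ext fun u => ?_)
    rw [hΨ, firstOrderDerivation_apply, Finset.sum_eq_single x]
    · have h1 := firstOrder_eq_zero (h x) (he.lift_self (ρg := ρg) x (σ' x ξ ⊗ₜ u))
      rw [map_sub, sub_eq_zero] at h1
      rw [h1, firstOrder_tmul, hσ']
    · exact fun y _ hy => firstOrder_eq_zero (h y) (he.lift_ne hy _)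
    · simp
  exact nonempty_quotient_equiv_of_surjective
    (M := LieDerivation k (equivariantMapAlgebra ρA ρg) N)
    (P := ∀ x : s, (RingHom.ker (x : A →ₐ[k] k)).Cotangent →ₗ[k] evalEquivariantHoms ρA ρg N x)
    Ψ hker hsurj

end OuterDerivations

universe v' w'

/-! ### Evaluation modules and equivariant maps g → Hom(V, V') -/

section EvaluationModules

attribute [local instance 100] LieRing.ofAssociativeRing

open Module LieModule

variable {k : Type u} {A : Type v} {g : Type w} {Γ : Type*} [Field k] [CommRing A] [Algebra k A]
  [LieRing g] [LieAlgebra k g] [Group Γ]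
  {ρA : Γ →* (A ≃ₐ[k] A)} {ρg : Γ →* (g ≃ₗ⁅k⁆ g)} {s : Finset (A →ₐ[k] k)}

theorem tensorRep_apply {L ι : Type*} [LieRing L] [LieAlgebra k L] [Fintype ι] [DecidableEq ι]
    (W : ι → Type*) [∀ i, AddCommGroup (W i)] [∀ i, Module k (W i)]
    (ρ : ∀ i, L →ₗ⁅k⁆ Module.End k (W i)) (u : L) :
    tensorRep W ρ u = ∑ i, actAt W i (ρ i u) := by
  change (∑ i, actAt W i ∘ₗ (ρ i).toLinearMap : L →ₗ[k] _) u = _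
  rw [LinearMap.sum_apply]
  rfl

theorem evaluationRep_apply [DecidableEq s] (W : s → FDLieModule k g)
    (α : equivariantMapAlgebra ρA ρg) : evaluationRep ρA ρg W α =
      ∑ x, actAt (fun x => (W x : Type _)) x
        (toEnd k g (W x) (evalAt (x : A →ₐ[k] k) (α : A ⊗[k] g))) := by
  unfold evaluationRep
  -- `evaluationRep` fixes the classical decidability instance; the final `congr!` replaces it by
  -- the ambient one.
  rw [@tensorRep_apply k _ _ _ _ _ _ (_) _ _ _ _ _]
  refine Finset.sum_congr rfl fun x _ => ?_
  congr!

theorem exists_eval_eq [Fintype Γ] [Module.Finite k g] {e : s → A} (he : IsLocalizer ρA s e)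
    (u : s → g) : ∃ α : equivariantMapAlgebra ρA ρg,
      ∀ x : s, evalAt (x : A →ₐ[k] k) (α : A ⊗[k] g) = u x := by
  refine ⟨∑ x, localLift ρA ρg (e x) (1 ⊗ₜ u x), fun x => ?_⟩
  rw [AddSubmonoidClass.coe_finsetSum, he.evalAt_sum_lift (fun x => (1 : A) ⊗ₜ[k] u x), evalAt_tmul,
    map_one, one_smul]

/-- Values at distinct points of s are independent, so the action of g on a single tensor factor
comes from an equivariant map. -/
theorem exists_evaluationRep_eq_actAt [Fintype Γ] [Module.Finite k g] [DecidableEq s] {e : s → A}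
    (he : IsLocalizer ρA s e) (x : s) (u : g) : ∃ α : equivariantMapAlgebra ρA ρg,
      evalAt (x : A →ₐ[k] k) (α : A ⊗[k] g) = u ∧
      (∀ y : s, y ≠ x → evalAt (y : A →ₐ[k] k) (α : A ⊗[k] g) = 0) ∧
      ∀ (W : s → FDLieModule k g), evaluationRep ρA ρg W α =
        actAt (fun x => (W x : Type _)) x (toEnd k g (W x) u) := by
  obtain ⟨α, hα⟩ := exists_eval_eq (ρg := ρg) he (Pi.single x u)
  have h1 : evalAt (x : A →ₐ[k] k) (α : A ⊗[k] g) = u := by rw [hα, Pi.single_eq_same]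
  have h2 : ∀ y : s, y ≠ x → evalAt (y : A →ₐ[k] k) (α : A ⊗[k] g) = 0 := fun y hy => by
    rw [hα, Pi.single_eq_of_ne hy]
  refine ⟨α, h1, h2, fun W => ?_⟩
  rw [evaluationRep_apply, Finset.sum_eq_single x, h1]
  · intro y _ hy
    rw [h2 y hy, map_zero, map_zero]
  · simp

theorem IsEvaluationTensor.factorsThrough {W : s → FDLieModule k g}
    {V : FDLieModule k (equivariantMapAlgebra ρA ρg)} (h : IsEvaluationTensor ρA ρg W V) :
    FactorsThrough ρA ρg s V := by
  classical
  obtain ⟨e, he⟩ := h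
  intro α hα v
  apply e.injective
  rw [he, evaluationRep_apply, Finset.sum_eq_zero, map_zero]
  · rfl
  · intro x _
    rw [hα x x.2, map_zero, map_zero]

theorem FactorsThrough.hom {V V' : Type*} [AddCommGroup V] [Module k V]
    [LieRingModule (equivariantMapAlgebra ρA ρg) V] [LieModule k (equivariantMapAlgebra ρA ρg) V]
    [AddCommGroup V'] [Module k V'] [LieRingModule (equivariantMapAlgebra ρA ρg) V']
    [LieModule k (equivariantMapAlgebra ρA ρg) V']
    (h : FactorsThrough ρA ρg s V) (h' : FactorsThrough ρA ρg s V') :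
    FactorsThrough ρA ρg s (V →ₗ[k] V') := by
  intro α hα f
  ext v
  rw [LieHom.lie_apply, h' α hα, h α hα, map_zero, sub_zero]
  rfl

theorem IsEvaluationTensor.isIrreducible {W : s → FDLieModule k g}
    {V : FDLieModule k (equivariantMapAlgebra ρA ρg)} (h : IsEvaluationTensor ρA ρg W V)
    (hV : LieModule.IsIrreducible k (equivariantMapAlgebra ρA ρg) V) (x : s) :
    LieModule.IsIrreducible k g (W x) := by
  classical
  obtain ⟨φ, hφ⟩ := h
  have := nontrivial_of_isIrreducible k (equivariantMapAlgebra ρA ρg) V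
  have : Nontrivial (⨂[k] x, W x) := φ.symm.toEquiv.nontrivial
  refine isIrreducible_of_tensor (W := fun x => (W x : Type _)) (fun Z hZ => ?_) x
  let Z' : LieSubmodule k (equivariantMapAlgebra ρA ρg) V :=
    { Z.comap (φ : V →ₗ[k] ⨂[k] x, W x) with
      lie_mem := fun {α v} hv => by
        change φ ⁅α, v⁆ ∈ Z
        rw [hφ, evaluationRep_apply, LinearMap.sum_apply]
        exact Submodule.sum_mem _ fun x _ => hZ x _ _ hv }
  have hZ' : ∀ v, v ∈ Z' ↔ φ v ∈ Z := fun _ => Iff.rfl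
  rcases eq_bot_or_eq_top Z' with h | h
  · left
    rw [Submodule.eq_bot_iff]
    intro z hz
    have : φ.symm z ∈ Z' := by rwa [hZ', φ.apply_symm_apply]
    rw [h, LieSubmodule.mem_bot, LinearEquiv.map_eq_zero_iff] at this
    exact this
  · right
    rw [eq_top_iff]
    intro z _
    have : φ.symm z ∈ Z' := h ▸ LieSubmodule.mem_top _
    rwa [hZ', φ.apply_symm_apply] at this

/-- Isomorphic irreducible evaluation modules have isomorphic factors. -/
theorem IsEvaluationTensor.nonempty_equiv [Fintype Γ] [Module.Finite k g] {e : s → A}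
    (he : IsLocalizer ρA s e) {W W' : s → FDLieModule.{_, _, v} k g}
    {V V' : FDLieModule k (equivariantMapAlgebra ρA ρg)} (h : IsEvaluationTensor ρA ρg W V)
    (h' : IsEvaluationTensor ρA ρg W' V')
    (hV : LieModule.IsIrreducible k (equivariantMapAlgebra ρA ρg) V)
    (hV' : LieModule.IsIrreducible k (equivariantMapAlgebra ρA ρg) V')
    (Θ : V ≃ₗ⁅k, equivariantMapAlgebra ρA ρg⁆ V') (x : s) : Nonempty (W x ≃ₗ⁅k, g⁆ W' x) := by
  classical
  by_contra hne
  rw [not_nonempty_iff] at hne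
  have hW := h.isIrreducible hV x
  have hW' := h'.isIrreducible hV' x
  obtain ⟨φ, hφ⟩ := h
  obtain ⟨φ', hφ'⟩ := h'
  have := nontrivial_of_isIrreducible k (equivariantMapAlgebra ρA ρg) V
  obtain ⟨v, hv⟩ := exists_ne (0 : V)
  have h0 := eq_zero_of_intertwines (W := fun x => (W x : Type _)) (W' := fun x => (W' x : Type _))
    hW hW' hne (φ' ∘ₗ (Θ : V →ₗ[k] V') ∘ₗ φ.symm) (fun u => by
      obtain ⟨α, -, -, hα⟩ := exists_evaluationRep_eq_actAt (ρg := ρg) he x u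
      refine LinearMap.ext fun z => ?_
      obtain ⟨v, rfl⟩ := φ.surjective z
      rw [← hα, ← hα]
      simp only [LinearMap.comp_apply, LinearEquiv.coe_coe, ← hφ, LinearEquiv.symm_apply_apply]
      rw [← hφ']
      congr 1
      exact Θ.map_lie α v)
  have h1 := LinearMap.congr_fun h0 (φ v)
  simp only [LinearMap.comp_apply, LinearEquiv.coe_coe, LinearEquiv.symm_apply_apply,
    LinearMap.zero_apply, LinearEquiv.map_eq_zero_iff] at h1
  exact hv (by simpa using h1)

section UpdateMap

variable {ι : Type*} [Fintype ι] [DecidableEq ι] {W W' : ι → Type*}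
  [∀ i, AddCommGroup (W i)] [∀ i, Module k (W i)] [∀ i, AddCommGroup (W' i)] [∀ i, Module k (W' i)]
  [∀ i, LieRingModule g (W i)] [∀ i, LieModule k g (W i)]
  [∀ i, LieRingModule g (W' i)] [∀ i, LieModule k g (W' i)]
  (θ : ∀ i, W i →ₗ[k] W' i) (x : ι)

/-- The tensor product of the maps `θ i`, with the one at `x` replaced. -/
noncomputable def mapUpdate : (W x →ₗ[k] W' x) →ₗ[k] (⨂[k] i, W i) →ₗ[k] ⨂[k] i, W' i :=
  (PiTensorProduct.mapMultilinear k W W').toLinearMap θ x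

omit [Fintype ι] in
theorem mapUpdate_apply (f : W x →ₗ[k] W' x) :
    mapUpdate θ x f = PiTensorProduct.map (Function.update θ x f) := rfl

variable {θ x}

/-- Vectors w and functionals η with η(θ w) = 1 at the other factors recover f by contraction. -/
theorem mapUpdate_injective (hnt : ∀ i, i ≠ x → Nontrivial (W i))
    (hθ : ∀ i, i ≠ x → Function.Injective (θ i)) : Function.Injective (mapUpdate θ x) := by
  rw [← LinearMap.ker_eq_bot, LinearMap.ker_eq_bot']
  intro f hf
  have hη : ∀ i, ∃ (w : W i) (η : Dual k (W' i)), i ≠ x → η (θ i w) = 1 := by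
    intro i
    by_cases hi : i = x
    · exact ⟨0, 0, fun h => absurd hi h⟩
    · have := hnt i hi
      obtain ⟨w, hw⟩ := exists_ne (0 : W i)
      have hw' : θ i w ≠ 0 := fun h => hw (hθ i hi (h.trans (map_zero _).symm))
      obtain ⟨η, hη⟩ := Module.Projective.exists_dual_ne_zero k hw'
      exact ⟨(η (θ i w))⁻¹ • w, η, fun _ => by simp [hη]⟩
  choose w₀ η hη using hη
  ext a
  have h := congrArg (contractAt x η)
    (LinearMap.congr_fun hf (PiTensorProduct.tprod k (Function.update w₀ x a)))
  rw [mapUpdate_apply, contractAt_map, Function.update_self, contractAt_tprod,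
    Function.update_self, Finset.prod_eq_one, one_smul] at h
  · simpa using h
  · intro i _
    split_ifs with hi
    · rfl
    · simp [hi, hη i hi]

omit [Fintype ι] in
theorem actAt_comp_mapUpdate_of_ne {y : ι} (hy : y ≠ x) (f : W x →ₗ[k] W' x) (u : g)
    (hθ : ∀ w, θ y ⁅u, w⁆ = ⁅u, θ y w⁆) :
    actAt W' y (toEnd k g (W' y) u) ∘ₗ mapUpdate θ x f =
      mapUpdate θ x f ∘ₗ actAt W y (toEnd k g (W y) u) := by
  rw [mapUpdate_apply, actAt_apply, actAt_apply, ← PiTensorProduct.map_comp,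
    ← PiTensorProduct.map_comp]
  congr 1
  funext i
  rcases eq_or_ne i y with rfl | hi
  · rw [Function.update_self, Function.update_self, Function.update_of_ne hy]
    ext w
    exact (hθ w).symm
  · rw [Function.update_of_ne hi, Function.update_of_ne hi]
    rfl

omit [Fintype ι] in
theorem actAt_comp_mapUpdate_self (f : W x →ₗ[k] W' x) (h : Module.End k (W' x)) :
    actAt W' x h ∘ₗ mapUpdate θ x f = mapUpdate θ x (h ∘ₗ f) := by
  rw [mapUpdate_apply, actAt_apply, ← PiTensorProduct.map_comp, mapUpdate_apply]
  congr 1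
  funext i
  rcases eq_or_ne i x with rfl | hi
  · simp
  · simp only [Function.update_of_ne hi]
    rfl

omit [Fintype ι] in
theorem mapUpdate_comp_actAt_self (f : W x →ₗ[k] W' x) (h : Module.End k (W x)) :
    mapUpdate θ x f ∘ₗ actAt W x h = mapUpdate θ x (f ∘ₗ h) := by
  rw [mapUpdate_apply, actAt_apply, ← PiTensorProduct.map_comp, mapUpdate_apply]
  congr 1
  funext i
  rcases eq_or_ne i x with rfl | hi
  · simp
  · simp only [Function.update_of_ne hi]
    rfl

/-- Away from x the two actions cancel because θ intertwines them; at x the action on Hom(W x, W' x)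
is left. -/
theorem sum_actAt_comp_mapUpdate (hθ : ∀ y, y ≠ x → ∀ (u : g) w, θ y ⁅u, w⁆ = ⁅u, θ y w⁆)
    (f : W x →ₗ[k] W' x) (u : ι → g) :
    (∑ y, actAt W' y (toEnd k g (W' y) (u y))) ∘ₗ mapUpdate θ x f -
      mapUpdate θ x f ∘ₗ (∑ y, actAt W y (toEnd k g (W y) (u y))) =
    mapUpdate θ x ⁅u x, f⁆ := by
  have h1 : ∀ (f : ι → Module.End k (⨂[k] i, W' i)) (h : (⨂[k] i, W i) →ₗ[k] ⨂[k] i, W' i),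
      (∑ y, f y) ∘ₗ h = ∑ y, f y ∘ₗ h := fun f h =>
    LinearMap.ext fun z => by simp only [LinearMap.sum_apply, LinearMap.comp_apply]
  have h2 : ∀ (f : ι → Module.End k (⨂[k] i, W i)) (h : (⨂[k] i, W i) →ₗ[k] ⨂[k] i, W' i),
      h ∘ₗ (∑ y, f y) = ∑ y, h ∘ₗ f y := fun f h =>
    LinearMap.ext fun z => by simp only [LinearMap.sum_apply, LinearMap.comp_apply, map_sum]
  rw [h1, h2, ← Finset.sum_sub_distrib,
    Finset.sum_eq_single x, actAt_comp_mapUpdate_self, mapUpdate_comp_actAt_self, ← map_sub]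
  · congr 1
  · intro y _ hy
    rw [actAt_comp_mapUpdate_of_ne hy f (u y) (hθ y hy (u y)), sub_self]
  · simp

end UpdateMap

section HomSpaces

/-- An evaluation-equivariant map with values in the image of the embedding K factors uniquely
through M; since evaluation at x is onto g, the factor is g-linear. -/
theorem nonempty_equiv_evalEquivariantHoms {M N : Type*} [AddCommGroup M] [Module k M]
    [LieRingModule g M] [LieModule k g M] [AddCommGroup N] [Module k N]
    [LieRingModule (equivariantMapAlgebra ρA ρg) N] [LieModule k (equivariantMapAlgebra ρA ρg) N]
    {x : A →ₐ[k] k} (K : M →ₗ[k] N) (hK : Function.Injective K)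
    (hlie : ∀ (α : equivariantMapAlgebra ρA ρg) m, ⁅α, K m⁆ = K ⁅evalAt x (α : A ⊗[k] g), m⁆)
    (hev : ∀ v, ∃ α : equivariantMapAlgebra ρA ρg, evalAt x (α : A ⊗[k] g) = v)
    (hex : ∀ f ∈ evalEquivariantHoms ρA ρg N x, ∀ v, ∃ m, K m = f v) :
    Nonempty ((g →ₗ⁅k, g⁆ M) ≃ₗ[k] evalEquivariantHoms ρA ρg N x) := by
  have hmem : ∀ ψ : g →ₗ⁅k, g⁆ M, K ∘ₗ (ψ : g →ₗ[k] M) ∈ evalEquivariantHoms ρA ρg N x := by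
    intro ψ α u
    change K (ψ ⁅_, u⁆) = ⁅α, K (ψ u)⁆
    rw [hlie, ψ.map_lie]
  let F : (g →ₗ⁅k, g⁆ M) →ₗ[k] evalEquivariantHoms ρA ρg N x :=
    { toFun := fun ψ => ⟨K ∘ₗ (ψ : g →ₗ[k] M), hmem ψ⟩
      map_add' := fun ψ ψ' => Subtype.ext (LinearMap.ext fun u => map_add K _ _)
      map_smul' := fun c ψ => Subtype.ext (LinearMap.ext fun u => map_smul K _ _) }
  have hF : ∀ ψ u, (F ψ : g →ₗ[k] N) u = K (ψ u) := fun _ _ => rfl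
  refine ⟨LinearEquiv.ofBijective F ⟨fun ψ ψ' hψ => ?_, fun f => ?_⟩⟩
  · ext1 u
    apply hK
    rw [← hF, ← hF, hψ]
  · choose T hT using hex f f.2
    let ψ : g →ₗ⁅k, g⁆ M :=
      { toFun := T
        map_add' := fun u v => hK (by rw [map_add, hT, hT, hT, map_add])
        map_smul' := fun c u => hK (by rw [map_smul, hT, hT, map_smul]; rfl)
        map_lie' := fun {v u} => hK (by
          obtain ⟨α, hα⟩ := hev v
          have h1 := hlie α (T u)
          rw [hα, hT, ← f.2 α u, hα] at h1
          rw [← h1, hT]) }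
    exact ⟨ψ, Subtype.ext (LinearMap.ext fun u => hT u)⟩

variable [Fintype Γ] [Module.Finite k g] {e : s → A} (he : IsLocalizer ρA s e)
  {W W' : s → FDLieModule.{u, w, w'} k g} {V V' : FDLieModule.{_, _, v'} k (equivariantMapAlgebra ρA ρg)}
  (h : IsEvaluationTensor ρA ρg W V) (h' : IsEvaluationTensor ρA ρg W' V')
  (hV : LieModule.IsIrreducible k (equivariantMapAlgebra ρA ρg) V)
  (hV' : LieModule.IsIrreducible k (equivariantMapAlgebra ρA ρg) V')

/-- A map α with value u at y and zero elsewhere on s acts by zero on g through x, so equivariance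
makes it annihilate f v. That is, f v intertwines the actions of u at y. -/
theorem intertwines_of_mem_evalEquivariantHoms [DecidableEq s] (he : IsLocalizer ρA s e)
    {φ : V ≃ₗ[k] (⨂[k] x, W x)}
    (hφ : ∀ (α : equivariantMapAlgebra ρA ρg) (v : V), φ ⁅α, v⁆ = evaluationRep ρA ρg W α (φ v))
    {φ' : V' ≃ₗ[k] (⨂[k] x, W' x)}
    (hφ' : ∀ (α : equivariantMapAlgebra ρA ρg) (v : V'), φ' ⁅α, v⁆ =
      evaluationRep ρA ρg W' α (φ' v)) {x y : s} (hy : y ≠ x)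
    {f : g →ₗ[k] V →ₗ[k] V'} (hf : f ∈ evalEquivariantHoms ρA ρg (V →ₗ[k] V') x) (u v : g) :
    (φ' ∘ₗ f v ∘ₗ φ.symm) ∘ₗ actAt (fun x => (W x : Type _)) y (toEnd k g (W y) u) =
      actAt (fun x => (W' x : Type _)) y (toEnd k g (W' y) u) ∘ₗ (φ' ∘ₗ f v ∘ₗ φ.symm) := by
  obtain ⟨α, -, hα0, hα⟩ := exists_evaluationRep_eq_actAt (ρg := ρg) he y u
  have h0 := hf α v
  rw [hα0 x hy.symm, zero_lie, map_zero] at h0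
  refine LinearMap.ext fun z => ?_
  obtain ⟨w, rfl⟩ := φ.surjective z
  rw [← hα, ← hα]
  simp only [LinearMap.comp_apply, LinearEquiv.coe_coe, ← hφ, LinearEquiv.symm_apply_apply]
  rw [← hφ']
  congr 1
  have h1 := LinearMap.congr_fun h0 w
  rw [LieHom.lie_apply, LinearMap.zero_apply] at h1
  exact (sub_eq_zero.mp h1.symm).symm

include he h h' hV hV' in
theorem evalEquivariantHoms_eq_bot {x y : s} (hy : y ≠ x) (hne : IsEmpty (W y ≃ₗ⁅k, g⁆ W' y)) :
    evalEquivariantHoms ρA ρg (V →ₗ[k] V') (x : A →ₐ[k] k) = ⊥ := by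
  classical
  have hW := h.isIrreducible hV y
  have hW' := h'.isIrreducible hV' y
  obtain ⟨φ, hφ⟩ := h
  obtain ⟨φ', hφ'⟩ := h'
  rw [Submodule.eq_bot_iff]
  intro f hf
  ext v w
  have h0 := eq_zero_of_intertwines (W := fun x => (W x : Type _)) (W' := fun x => (W' x : Type _))
    hW hW' hne (φ' ∘ₗ f v ∘ₗ φ.symm)
    (fun u => intertwines_of_mem_evalEquivariantHoms he hφ hφ' hy hf u v)
  have h1 := LinearMap.congr_fun h0 (φ w)
  simpa using h1

include he h h' hV in
-- The values of such a map intertwine the irreducible factors at all y ≠ x, so by Burnside they are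
-- the fixed isomorphisms there, tensored with one free entry in Hom(W x, W' x).
theorem nonempty_evalEquivariantHoms_equiv [IsAlgClosed k] {x : s}
    (hx : ∀ y, y ≠ x → Nonempty (W y ≃ₗ⁅k, g⁆ W' y)) :
    Nonempty ((g →ₗ⁅k, g⁆ (W x →ₗ[k] W' x)) ≃ₗ[k]
      evalEquivariantHoms ρA ρg (V →ₗ[k] V') (x : A →ₐ[k] k)) := by
  classical
  have hW := fun y => h.isIrreducible hV y
  have hnt : ∀ y, Nontrivial (W y) := fun y => nontrivial_of_isIrreducible k g (W y)
  obtain ⟨φ, hφ⟩ := h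
  obtain ⟨φ', hφ'⟩ := h'
  let θ : ∀ y, y ≠ x → W y ≃ₗ⁅k, g⁆ W' y := fun y hy => (hx y hy).some
  let θ' : ∀ y, W y →ₗ[k] W' y := fun y => if hy : y ≠ x then (θ y hy : W y →ₗ[k] W' y) else 0
  have hθ' : ∀ y (hy : y ≠ x), θ' y = (θ y hy : W y →ₗ[k] W' y) := fun y hy => dif_pos hy
  let K : (W x →ₗ[k] W' x) →ₗ[k] (V →ₗ[k] V') :=
    (φ.arrowCongr φ').symm.toLinearMap ∘ₗ
      mapUpdate (W := fun x => (W x : Type _)) (W' := fun x => (W' x : Type _)) θ' x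
  have hKinj : Function.Injective K := by
    refine (φ.arrowCongr φ').symm.injective.comp (mapUpdate_injective (fun y _ => hnt y) ?_)
    intro y hy
    rw [hθ' y hy]
    exact (θ y hy).injective
  have hK : ∀ f v, φ' (K f v) = mapUpdate (W := fun x => (W x : Type _))
      (W' := fun x => (W' x : Type _)) θ' x f (φ v) := by
    intro f v
    simp [K]
  have hKlie : ∀ (α : equivariantMapAlgebra ρA ρg) f,
      ⁅α, K f⁆ = K ⁅evalAt (x : A →ₐ[k] k) (α : A ⊗[k] g), f⁆ := by
    intro α f
    ext v
    apply φ'.injective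
    have h1 := LinearMap.congr_fun (sum_actAt_comp_mapUpdate (g := g)
      (W := fun x => (W x : Type _)) (W' := fun x => (W' x : Type _)) (θ := θ') (x := x)
      (fun y hy u w => by rw [hθ' y hy]; exact (θ y hy).map_lie u w) f
      (fun y : s => evalAt (y : A →ₐ[k] k) (α : A ⊗[k] g))) (φ v)
    rw [hK, ← h1, LieHom.lie_apply, map_sub, hφ', hK, hK, hφ, evaluationRep_apply,
      evaluationRep_apply]
    rfl
  refine nonempty_equiv_evalEquivariantHoms K hKinj hKlie (fun v => ?_) fun f hf v => ?_
  · obtain ⟨α, hα⟩ := exists_eval_eq (ρg := ρg) he fun _ => v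
    exact ⟨α, hα x⟩
  · obtain ⟨T₀, hT₀⟩ := exists_eq_map_update (W := fun x => (W x : Type _))
      (W' := fun x => (W' x : Type _)) x (fun y _ => hnt y)
      (fun y hy => (θ y hy : W y ≃ₗ[k] W' y)) θ' hθ' (φ' ∘ₗ f v ∘ₗ φ.symm)
      (fun y hy p => comp_actAt_of_intertwines (W := fun x => (W x : Type _))
        (W' := fun x => (W' x : Type _)) (hW y) (θ y hy) _
        (fun u => intertwines_of_mem_evalEquivariantHoms he hφ hφ' hy hf u v) p)
    refine ⟨T₀, ?_⟩
    ext w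
    apply φ'.injective
    rw [hK, mapUpdate_apply, ← hT₀]
    simp

end HomSpaces

end EvaluationModules

/-! ### Identification of M* ⊗ N with Hom(M, N) -/

section DualTensor

variable {k : Type u} {g : Type v} [Field k] [LieRing g] [LieAlgebra k g]
  {M N P : Type*} [AddCommGroup M] [Module k M] [LieRingModule g M] [LieModule k g M]
  [AddCommGroup N] [Module k N] [LieRingModule g N] [LieModule k g N]
  [AddCommGroup P] [Module k P] [LieRingModule g P] [LieModule k g P]

theorem dualTensorHom_lie (u : g) (z : Module.Dual k M ⊗[k] N) :
    dualTensorHom k M N ⁅u, z⁆ = ⁅u, dualTensorHom k M N z⁆ := by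
  induction z using TensorProduct.induction_on with
  | zero =>
    have h0 : ⁅u, (0 : Module.Dual k M ⊗[k] N)⁆ = 0 := lie_zero (M := Module.Dual k M ⊗[k] N) u
    rw [h0, map_zero, lie_zero]
  | add a b ha hb =>
    have h0 : ⁅u, a + b⁆ = ⁅u, a⁆ + ⁅u, b⁆ :=
      lie_add (M := Module.Dual k M ⊗[k] N) u a b
    rw [h0, map_add, ha, hb, map_add, lie_add]
  | tmul f n =>
    rw [TensorProduct.LieModule.lie_tmul_right]
    ext m
    simp [dualTensorHom_apply, sub_eq_neg_add]

/-- Composition with an isomorphism of Lie modules. -/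
def LieModuleEquiv.homCongrRight (E : M ≃ₗ⁅k, g⁆ N) : (P →ₗ⁅k, g⁆ M) ≃ₗ[k] (P →ₗ⁅k, g⁆ N) where
  toFun f := (E : M →ₗ⁅k, g⁆ N).comp f
  invFun f := (E.symm : N →ₗ⁅k, g⁆ M).comp f
  map_add' _ _ := by ext; simp
  map_smul' _ _ := by ext; simp
  left_inv _ := by ext; simp
  right_inv _ := by ext; simp

/-- `M* ⊗ N ≅ Hom(M, N)` as Lie modules. -/
noncomputable def dualTensorLieEquiv [Module.Finite k M] :
    (Module.Dual k M ⊗[k] N) ≃ₗ⁅k, g⁆ (M →ₗ[k] N) :=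
  { dualTensorHomEquiv k M N with
    map_lie' := fun {u z} => by
      change dualTensorHomEquiv k M N ⁅u, z⁆ = ⁅u, dualTensorHomEquiv k M N z⁆
      simpa using dualTensorHom_lie u z }

end DualTensor

/-! ### The three cases of Ext¹ -/

section ExtComputation

attribute [local instance 100] LieRing.ofAssociativeRing

open Module LieModule

variable {k g A : Type u} [Field k] [IsAlgClosed k] [CharZero k] [LieRing g] [LieAlgebra k g]
  [Module.Finite k g] [LieAlgebra.IsSemisimple k g] [CommRing A] [Algebra k A]
  [Algebra.FiniteType k A] {Γ : Type v} [Group Γ] [Finite Γ]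
  {ρA : Γ →* (A ≃ₐ[k] A)} {ρg : Γ →* (g ≃ₗ⁅k⁆ g)} {s : Finset (A →ₐ[k] k)}
  {W W' : s → FDLieModule.{u, u, u} k g}
  {V V' : FDLieModule.{u, u, u} k (equivariantMapAlgebra ρA ρg)}
  (hfree : ActsFreely ρA) (hs : s ∈ orbitSeparated ρA)
  (h : IsEvaluationTensor ρA ρg W V) (h' : IsEvaluationTensor ρA ρg W' V')
  (hV : LieModule.IsIrreducible k (equivariantMapAlgebra ρA ρg) V)
  (hV' : LieModule.IsIrreducible k (equivariantMapAlgebra ρA ρg) V')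

include hfree hs h h' in
theorem nonempty_lieExtOne_equiv : Nonempty (LieExtOne k (equivariantMapAlgebra ρA ρg) V V' ≃ₗ[k]
    ∀ x : s, (RingHom.ker (x : A →ₐ[k] k)).Cotangent →ₗ[k]
      evalEquivariantHoms ρA ρg (V →ₗ[k] V') (x : A →ₐ[k] k)) := by
  have := Fintype.ofFinite Γ
  obtain ⟨E⟩ := extOne_equiv_derivations k (equivariantMapAlgebra ρA ρg) V V'
  obtain ⟨E'⟩ := nonempty_outerDerivations_equiv
    (FactorsThrough.hom h.factorsThrough h'.factorsThrough) hfree hs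
  exact ⟨E.trans E'⟩

include hfree hs h h' hV in
omit [CharZero k] [LieAlgebra.IsSemisimple k g] in
-- The cotangent space is finite-dimensional, so Hom out of it is a tensor product with its dual.
theorem nonempty_cotangentHom_equiv {x : s}
    (hx : ∀ y, y ≠ x → Nonempty (W y ≃ₗ⁅k, g⁆ W' y)) :
    Nonempty (((RingHom.ker (x : A →ₐ[k] k)).Cotangent →ₗ[k]
      evalEquivariantHoms ρA ρg (V →ₗ[k] V') (x : A →ₐ[k] k)) ≃ₗ[k]
      (g →ₗ⁅k, g⁆ Module.Dual k (W x) ⊗[k] W' x) ⊗[k]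
        Module.Dual k (RingHom.ker (x : A →ₐ[k] k)).Cotangent) := by
  have := Fintype.ofFinite Γ
  obtain ⟨e, he⟩ := exists_isLocalizer hfree hs
  obtain ⟨E⟩ := nonempty_evalEquivariantHoms_equiv he h h' hV hx
  let E' : (g →ₗ⁅k, g⁆ Module.Dual k (W x) ⊗[k] W' x) ≃ₗ[k] (g →ₗ⁅k, g⁆ (W x →ₗ[k] W' x)) :=
    LieModuleEquiv.homCongrRight dualTensorLieEquiv
  exact ⟨(dualTensorHomEquiv k _ _).symm ≪≫ₗ TensorProduct.comm k _ _ ≪≫ₗ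
    TensorProduct.congr (E' ≪≫ₗ E).symm (LinearEquiv.refl k _)⟩

include hfree hs h h' hV hV' in
omit [IsAlgClosed k] [CharZero k] [LieAlgebra.IsSemisimple k g] [Algebra.FiniteType k A] in
theorem subsingleton_cotangentHom {x y : s} (hy : y ≠ x)
    (hne : IsEmpty (W y ≃ₗ⁅k, g⁆ W' y)) :
    Subsingleton ((RingHom.ker (x : A →ₐ[k] k)).Cotangent →ₗ[k]
      evalEquivariantHoms ρA ρg (V →ₗ[k] V') (x : A →ₐ[k] k)) := by
  have := Fintype.ofFinite Γ
  obtain ⟨e, he⟩ := exists_isLocalizer hfree hs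
  have h0 := evalEquivariantHoms_eq_bot he h h' hV hV' hy hne
  have : Subsingleton (evalEquivariantHoms ρA ρg (V →ₗ[k] V') (x : A →ₐ[k] k)) :=
    Submodule.subsingleton_iff_eq_bot.mpr h0
  exact ⟨fun f f' => LinearMap.ext fun ξ => Subsingleton.elim _ _⟩

include hfree hs h h' hV hV' in
-- With two points of non-isomorphism, every z in s differs from at least one of them, so its
-- summand vanishes.
theorem subsingleton_lieExtOne {x y : s} (hxy : x ≠ y) (hx : IsEmpty (W x ≃ₗ⁅k, g⁆ W' x))
    (hy : IsEmpty (W y ≃ₗ⁅k, g⁆ W' y)) :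
    Subsingleton (LieExtOne k (equivariantMapAlgebra ρA ρg) V V') := by
  obtain ⟨E⟩ := nonempty_lieExtOne_equiv hfree hs h h'
  have hsub : ∀ z : s, Subsingleton ((RingHom.ker (z : A →ₐ[k] k)).Cotangent →ₗ[k]
      evalEquivariantHoms ρA ρg (V →ₗ[k] V') (z : A →ₐ[k] k)) := by
    intro z
    by_cases hz : x = z
    · exact subsingleton_cotangentHom hfree hs h h' hV hV' (fun h => hxy (hz.trans h.symm)) hy
    · exact subsingleton_cotangentHom hfree hs h h' hV hV' hz hx
  exact E.toEquiv.subsingleton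

/-- A product of modules all of which but one are trivial. -/
noncomputable def LinearEquiv.piOfSubsingleton {R ι : Type*} [DecidableEq ι] [Ring R] (M : ι → Type*)
    [∀ i, AddCommGroup (M i)] [∀ i, Module R (M i)] (i : ι)
    (hM : ∀ j, j ≠ i → Subsingleton (M j)) : (∀ j, M j) ≃ₗ[R] M i :=
  LinearEquiv.ofLinearMap (LinearMap.proj i) (LinearMap.single R M i)
    (by ext; simp) (by
      ext f j
      by_cases hj : j = i
      · subst hj; simp
      · have := hM j hj
        exact Subsingleton.elim _ _)

include hfree hs h h' hV hV' in
theorem nonempty_lieExtOne_equiv_of_isEmpty {x₀ : s} (hx₀ : IsEmpty (W x₀ ≃ₗ⁅k, g⁆ W' x₀))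
    (hx : ∀ x : s, x ≠ x₀ → Nonempty (W x ≃ₗ⁅k, g⁆ W' x)) :
    Nonempty (LieExtOne k (equivariantMapAlgebra ρA ρg) V V' ≃ₗ[k]
      (g →ₗ⁅k, g⁆ Module.Dual k (W x₀) ⊗[k] W' x₀) ⊗[k]
        Module.Dual k (RingHom.ker (x₀ : A →ₐ[k] k)).Cotangent) := by
  classical
  obtain ⟨E⟩ := nonempty_lieExtOne_equiv hfree hs h h'
  obtain ⟨E'⟩ := nonempty_cotangentHom_equiv hfree hs h h' hV hx
  exact ⟨E ≪≫ₗ LinearEquiv.piOfSubsingleton _ x₀ (fun x hx =>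
    subsingleton_cotangentHom hfree hs h h' hV hV' hx.symm hx₀) ≪≫ₗ E'⟩

include hfree hs h h' hV hV' in
-- An isomorphism V ≅ V' forces isomorphic factors at every point, so the computation of the summand
-- applies at each x, and the finite product is a direct sum.
theorem nonempty_lieExtOne_equiv_of_equiv
    (hVV' : Nonempty (V ≃ₗ⁅k, equivariantMapAlgebra ρA ρg⁆ V')) :
    Nonempty (LieExtOne k (equivariantMapAlgebra ρA ρg) V V' ≃ₗ[k]
      ⨁ x : s, (g →ₗ⁅k, g⁆ Module.Dual k (W x) ⊗[k] W' x) ⊗[k]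
        Module.Dual k (RingHom.ker (x : A →ₐ[k] k)).Cotangent) := by
  classical
  have := Fintype.ofFinite Γ
  obtain ⟨Θ⟩ := hVV'
  obtain ⟨e, he⟩ := exists_isLocalizer hfree hs
  obtain ⟨E⟩ := nonempty_lieExtOne_equiv hfree hs h h'
  have hW : ∀ x, Nonempty (W x ≃ₗ⁅k, g⁆ W' x) := h.nonempty_equiv he h' hV hV' Θ
  have E' := fun x => (nonempty_cotangentHom_equiv hfree hs h h' hV (x := x) fun y _ => hW y).some
  exact ⟨E ≪≫ₗ LinearEquiv.piCongrRight E' ≪≫ₗ (DirectSum.linearEquivFunOnFintype k s _).symm⟩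

end ExtComputation

/-! ### Ideals with abelian image -/

section AbelianIdeals

attribute [local instance 100] LieRing.ofAssociativeRing

open Module LieModule

/-- In an irreducible traceless representation, ideals with abelian image act trivially. -/
theorem LieModule.toEnd_eq_zero_of_abelian {k : Type*} {L V : Type*} [Field k] [IsAlgClosed k]
    [CharZero k] [LieRing L] [LieAlgebra k L] [AddCommGroup V] [Module k V] [LieRingModule L V]
    [LieModule k L V] [Module.Finite k V] [IsIrreducible k L V]
    (htr : ∀ a, LinearMap.trace k V (toEnd k L V a) = 0) (K : LieIdeal k L)
    (hK : ∀ a ∈ K, ∀ b ∈ K, toEnd k L V ⁅a, b⁆ = 0) {a : L} (ha : a ∈ K) :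
    toEnd k L V a = 0 := by
  let R := (toEnd k L V).range
  have hR : ∀ a, toEnd k L V a ∈ R := fun a => ⟨a, rfl⟩
  have := nontrivial_of_isIrreducible k L V
  have hirr : IsIrreducible k R V := by
    refine IsIrreducible.mk fun N hN => ?_
    let N' : LieSubmodule k L V :=
      { N.toSubmodule with lie_mem := fun {a v} hv => N.lie_mem (x := ⟨_, hR a⟩) hv }
    have h1 : N'.toSubmodule = N.toSubmodule := rfl
    have h2 : N' ≠ ⊥ := fun h => hN (by
      rw [← LieSubmodule.toSubmodule_inj, ← h1, h]; rfl)
    have h3 := (eq_bot_or_eq_top N').resolve_left h2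
    rw [← LieSubmodule.toSubmodule_inj, ← h1, h3]
    rfl
  -- A faithful irreducible algebra of traceless operators has trivial radical; the image of K is an
  -- abelian ideal in it, hence zero.
  have hrad : LieAlgebra.HasTrivialRadical k R := by
    refine LieAlgebra.hasTrivialRadical_of_isIrreducible_of_isFaithful k R V ?_
    rintro ⟨_, b, rfl⟩
    exact htr b
  let I : LieIdeal k R :=
    { carrier := {r | ∃ b ∈ K, toEnd k L V b = r}
      add_mem' := by
        rintro _ _ ⟨b, hb, h⟩ ⟨c, hc, h'⟩
        exact ⟨b + c, add_mem hb hc, by rw [map_add, h, h']; rfl⟩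
      zero_mem' := ⟨0, zero_mem _, map_zero _⟩
      smul_mem' := by
        rintro c _ ⟨b, hb, h⟩
        exact ⟨c • b, K.smul_mem c hb, by rw [map_smul, h]; rfl⟩
      lie_mem := by
        rintro ⟨_, c, rfl⟩ _ ⟨b, hb, h⟩
        refine ⟨⁅c, b⁆, K.lie_mem hb, ?_⟩
        rw [LieHom.map_lie, h]
        rfl }
  have hI : I = ⊥ := by
    refine (LieAlgebra.hasTrivialRadical_iff_no_abelian_ideals k R).mp hrad I ⟨?_⟩
    rintro ⟨r, b, hb, h⟩ ⟨r', b', hb', h'⟩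
    apply Subtype.ext
    apply Subtype.ext
    change ⁅(r : Module.End k V), (r' : Module.End k V)⁆ = 0
    rw [← h, ← h', ← LieHom.map_lie, hK b hb b' hb']
  have hmem : (⟨_, hR a⟩ : R) ∈ I := ⟨a, ha, rfl⟩
  rw [hI, LieSubmodule.mem_bot] at hmem
  exact congrArg Subtype.val hmem

end AbelianIdeals

/-! ### Finite support of irreducible modules -/

section Support

theorem LinearMap.eq_zero_of_mem_span {R T E : Type*} [Ring R] [AddCommGroup T] [Module R T]
    [AddCommGroup E] [Module R E] {M : Submodule R T} (F : M →ₗ[R] E) {S : Set T}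
    (hS : ∀ z ∈ S, ∃ h : z ∈ M, F ⟨z, h⟩ = 0) {x : M} (hx : (x : T) ∈ Submodule.span R S) :
    F x = 0 := by
  have h : Submodule.span R S ≤ (LinearMap.ker F).map M.subtype :=
    Submodule.span_le.mpr fun z hz => by
      obtain ⟨hz, hz0⟩ := hS z hz
      exact ⟨⟨z, hz⟩, hz0, rfl⟩
  obtain ⟨y, hy, hyx⟩ := h hx
  rwa [← Subtype.ext (show (y : T) = x from hyx)]

attribute [local instance 100] LieRing.ofAssociativeRing

open Module LieModule

variable {k : Type u} {A : Type v} {g : Type w} {Γ : Type*} [Field k] [CommRing A] [Algebra k A]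
  [LieRing g] [LieAlgebra k g] [Group Γ]
  (ρA : Γ →* (A ≃ₐ[k] A)) (ρg : Γ →* (g ≃ₗ⁅k⁆ g))

/-- The invariant functions. -/
def invariantSubalgebra : Subalgebra k A where
  carrier := {a | ∀ γ, ρA γ a = a}
  mul_mem' ha hb γ := by rw [map_mul, ha, hb]
  one_mem' γ := map_one _
  add_mem' ha hb γ := by rw [map_add, ha, hb]
  zero_mem' γ := map_zero _
  algebraMap_mem' c γ := (ρA γ).commutes c

theorem isIntegral_invariantSubalgebra [Finite Γ] :
    Algebra.IsIntegral (invariantSubalgebra ρA) A := by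
  let _ : MulSemiringAction Γ A := MulSemiringAction.compHom A ρA
  have hsmul : ∀ (γ : Γ) (a : A), γ • a = ρA γ a := fun _ _ => rfl
  have : SMulCommClass Γ (invariantSubalgebra ρA) A := ⟨fun γ b a => by
    change ρA γ ((b : A) * a) = (b : A) * ρA γ a
    rw [map_mul, b.2 γ]⟩
  have : Algebra.IsInvariant (invariantSubalgebra ρA) A Γ := ⟨fun a ha => ⟨⟨a, ha⟩, rfl⟩⟩
  exact Algebra.IsInvariant.isIntegral (invariantSubalgebra ρA) A Γ

/-- Multiplication of equivariant maps by invariant functions. -/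
def invariantMul (b : invariantSubalgebra ρA) :
    equivariantMapAlgebra ρA ρg →ₗ[k] equivariantMapAlgebra ρA ρg where
  toFun α := ⟨(b : A) • (α : A ⊗[k] g), smul_mem_equivariantMapAlgebra ρA ρg b.2 α.2⟩
  map_add' _ _ := Subtype.ext (smul_add _ _ _)
  map_smul' _ _ := Subtype.ext (smul_comm _ _ _)

theorem coe_invariantMul (b : invariantSubalgebra ρA) (α : equivariantMapAlgebra ρA ρg) :
    (invariantMul ρA ρg b α : A ⊗[k] g) = (b : A) • (α : A ⊗[k] g) := rfl

theorem invariantMul_lie (b : invariantSubalgebra ρA) (α β : equivariantMapAlgebra ρA ρg) :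
    ⁅invariantMul ρA ρg b α, β⁆ = ⁅α, invariantMul ρA ρg b β⁆ :=
  Subtype.ext (by
    rw [LieSubalgebra.coe_bracket, LieSubalgebra.coe_bracket, coe_invariantMul, coe_invariantMul,
      smul_lie, lie_smul])

variable {ρA ρg}
variable {V : Type*} [AddCommGroup V] [Module k V] [LieRingModule (equivariantMapAlgebra ρA ρg) V]
  [LieModule k (equivariantMapAlgebra ρA ρg) V] [Module.Finite k V]
  [IsIrreducible k (equivariantMapAlgebra ρA ρg) V]

omit [Module.Finite k V] [IsIrreducible k (equivariantMapAlgebra ρA ρg) V] in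
-- The commutator theorem with both ideals equal to A shows that the algebra is perfect, and
-- commutators have trace zero.
theorem trace_toEnd_equivariant [Fintype Γ] [IsAlgClosed k] [CharZero k] [Algebra.FiniteType k A]
    [Module.Finite k g] [LieAlgebra.IsKilling k g] (hfree : ActsFreely ρA)
    (α : equivariantMapAlgebra ρA ρg) :
    LinearMap.trace k V (toEnd k (equivariantMapAlgebra ρA ρg) V α) = 0 := by
  have h := mem_span_lie_of_mem_tensorIdeal_mul ρA ρg hfree (I := ⊤) (J := ⊤)
    (fun _ _ _ => trivial) (fun _ _ _ => trivial) α.2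
    (by rw [Ideal.mul_top]; exact mem_tensorIdeal_top _)
  refine LinearMap.eq_zero_of_mem_span (M := (equivariantMapAlgebra ρA ρg).toSubmodule)
    (LinearMap.trace k V ∘ₗ (toEnd k (equivariantMapAlgebra ρA ρg) V).toLinearMap) ?_ h
  rintro _ ⟨κ, hκ, -, κ', hκ', -, rfl⟩
  refine ⟨LieSubalgebra.lie_mem _ hκ hκ', ?_⟩
  change LinearMap.trace k V (toEnd k (equivariantMapAlgebra ρA ρg) V
    ⁅(⟨κ, hκ⟩ : equivariantMapAlgebra ρA ρg), ⟨κ', hκ'⟩⁆) = 0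
  rw [LieHom.map_lie, LieRing.of_associative_ring_bracket, map_sub, LinearMap.trace_mul_comm,
    sub_self]

section Kernel

variable [IsAlgClosed k] [CharZero k]
  (htr : ∀ α, LinearMap.trace k V (toEnd k (equivariantMapAlgebra ρA ρg) V α) = 0)
include htr

/-- The kernel of an irreducible representation is stable under multiplication by invariants. -/
theorem toEnd_invariantMul_eq_zero (b : invariantSubalgebra ρA) {α : equivariantMapAlgebra ρA ρg}
    (hα : toEnd k (equivariantMapAlgebra ρA ρg) V α = 0) :
    toEnd k (equivariantMapAlgebra ρA ρg) V (invariantMul ρA ρg b α) = 0 := by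
  -- The elements whose brackets with everything act by zero. It contains bα because [bα, β] = [α,
  -- bβ], and its image is abelian.
  let K : LieIdeal k (equivariantMapAlgebra ρA ρg) :=
    { carrier := {α | ∀ β, toEnd k (equivariantMapAlgebra ρA ρg) V ⁅α, β⁆ = 0}
      add_mem' := fun ha hb β => by rw [add_lie, map_add, ha, hb, add_zero]
      zero_mem' := fun β => by rw [zero_lie, map_zero]
      smul_mem' := fun c a ha β => by rw [smul_lie, map_smul, ha, smul_zero]
      lie_mem := fun {γ α} hα β => by
        have h1 : toEnd k (equivariantMapAlgebra ρA ρg) V ⁅γ, α⁆ = 0 := by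
          rw [← lie_skew, map_neg, hα, neg_zero]
        rw [LieHom.map_lie, h1, zero_lie] }
  refine toEnd_eq_zero_of_abelian htr K (fun a ha b _ => ha b) (fun β => ?_)
  rw [invariantMul_lie, LieHom.map_lie, hα, zero_lie]

/-- Invariants act on an irreducible module modulo its kernel. -/
noncomputable def invariantMulQuotient :
    invariantSubalgebra ρA →ₐ[k] Module.End k (equivariantMapAlgebra ρA ρg ⧸
      LinearMap.ker (toEnd k (equivariantMapAlgebra ρA ρg) V).toLinearMap) :=
  AlgHom.ofLinearMap
    { toFun := fun b => Submodule.mapQ _ _ (invariantMul ρA ρg b)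
        fun _ hα => toEnd_invariantMul_eq_zero htr b hα
      map_add' := fun b c => Submodule.linearMap_qext _ (LinearMap.ext fun α =>
        congrArg Submodule.Quotient.mk (show invariantMul ρA ρg (b + c) α =
          invariantMul ρA ρg b α + invariantMul ρA ρg c α from Subtype.ext (add_smul _ _ _)))
      map_smul' := fun c b => Submodule.linearMap_qext _ (LinearMap.ext fun α =>
        congrArg Submodule.Quotient.mk (show invariantMul ρA ρg (c • b) α =
          c • invariantMul ρA ρg b α from Subtype.ext (smul_assoc _ _ _))) }
    (Submodule.linearMap_qext _ (LinearMap.ext fun α =>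
        congrArg Submodule.Quotient.mk (show invariantMul ρA ρg 1 α = α from
          Subtype.ext (one_smul _ _))))
    (fun b c => Submodule.linearMap_qext _ (LinearMap.ext fun α =>
        congrArg Submodule.Quotient.mk (show invariantMul ρA ρg (b * c) α =
          invariantMul ρA ρg b (invariantMul ρA ρg c α) from Subtype.ext (mul_smul _ _ _))))

theorem invariantMulQuotient_eq_zero {b : invariantSubalgebra ρA} :
    invariantMulQuotient htr b = 0 ↔
      ∀ α, toEnd k (equivariantMapAlgebra ρA ρg) V (invariantMul ρA ρg b α) = 0 := by
  constructor
  · intro h α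
    have h1 := LinearMap.congr_fun h (Submodule.Quotient.mk α)
    change Submodule.Quotient.mk (invariantMul ρA ρg b α) = 0 at h1
    rw [Submodule.Quotient.mk_eq_zero] at h1
    exact h1
  · intro h
    ext α
    change Submodule.Quotient.mk (invariantMul ρA ρg b α) = 0
    rw [Submodule.Quotient.mk_eq_zero]
    exact h α

variable [Algebra.FiniteType k A] [Module.Finite k g] [Fintype Γ]

/-- The kernel of an irreducible representation contains all equivariant maps vanishing on some
closed subscheme with finitely many points. -/
theorem exists_ideal_finite :
    ∃ J : Ideal A, Module.Finite k (A ⧸ J) ∧ ∀ α : equivariantMapAlgebra ρA ρg,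
      (α : A ⊗[k] g) ∈ tensorIdeal k g J → toEnd k (equivariantMapAlgebra ρA ρg) V α = 0 := by
  -- The annihilator of the finite-dimensional quotient by the kernel, so invariants are integral
  -- over k modulo its extension J. As A is integral over the invariants and of finite type, A/J is
  -- finite-dimensional.
  let I₀ : Ideal (invariantSubalgebra ρA) := RingHom.ker (invariantMulQuotient (V := V) htr)
  let J : Ideal A := I₀.map (algebraMap (invariantSubalgebra ρA) A)
  refine ⟨J, ?_, fun α hα => ?_⟩
  · have hfin : Module.Finite k (equivariantMapAlgebra ρA ρg ⧸ LinearMap.ker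
        (toEnd k (equivariantMapAlgebra ρA ρg) V).toLinearMap) :=
      Module.Finite.equiv (LinearMap.quotKerEquivRange
        (toEnd k (equivariantMapAlgebra ρA ρg) V).toLinearMap).symm
    have hB : ∀ b : invariantSubalgebra ρA, IsIntegral k (Ideal.Quotient.mkₐ k J (b : A)) := by
      intro b
      obtain ⟨p, hp, hp0⟩ := IsIntegral.of_finite k (invariantMulQuotient (V := V) htr b)
      refine ⟨p, hp, ?_⟩
      rw [← Polynomial.aeval_def, Polynomial.aeval_algHom_apply] at hp0 ⊢
      have h1 : Polynomial.aeval b p ∈ I₀ := hp0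
      have h2 : algebraMap (invariantSubalgebra ρA) A (Polynomial.aeval b p) =
          Polynomial.aeval (b : A) p :=
        (Polynomial.aeval_algHom_apply (invariantSubalgebra ρA).val b p).symm
      rw [← h2]
      exact Ideal.Quotient.eq_zero_iff_mem.mpr (Ideal.mem_map_of_mem _ h1)
    have hint : Algebra.IsIntegral k (A ⧸ J) := by
      refine ⟨fun c => ?_⟩
      obtain ⟨a, rfl⟩ := Ideal.Quotient.mk_surjective c
      have := isIntegral_invariantSubalgebra ρA
      have ha : IsIntegral (invariantSubalgebra ρA) a := Algebra.IsIntegral.isIntegral a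
      let φ : invariantSubalgebra ρA →ₐ[k] integralClosure k (A ⧸ J) :=
        AlgHom.codRestrict ((Ideal.Quotient.mkₐ k J).comp (invariantSubalgebra ρA).val) _ hB
      have h1 : IsIntegral (integralClosure k (A ⧸ J)) (Ideal.Quotient.mk J a) :=
        ha.map_of_comp_eq φ.toRingHom (Ideal.Quotient.mk J) rfl
      exact isIntegral_trans _ h1
    exact Algebra.IsIntegral.finite
  · have h1 : ∀ a ∈ J, ∀ (c : A) (u : g), toEnd k (equivariantMapAlgebra ρA ρg) V
        (localLift ρA ρg 1 ((c * a) ⊗ₜ u)) = 0 := by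
      intro a ha
      induction ha using Submodule.span_induction with
      | mem a ha =>
        obtain ⟨b, hb, rfl⟩ := ha
        intro c u
        have h2 : localLift ρA ρg 1 ((c * algebraMap (invariantSubalgebra ρA) A b) ⊗ₜ u) =
            invariantMul ρA ρg b (localLift ρA ρg 1 (c ⊗ₜ u)) := by
          apply Subtype.ext
          rw [coe_invariantMul, coe_localLift, coe_localLift, one_smul, one_smul,
            ← orbitSum_smul_invariant ρA ρg b.2, TensorProduct.smul_tmul', smul_eq_mul, mul_comm]
          rfl
        rw [h2]
        exact (invariantMulQuotient_eq_zero htr).mp hb _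
      | zero => simp
      | add a b _ _ ha hb =>
        intro c u
        rw [mul_add, TensorProduct.add_tmul, map_add, map_add, ha, hb, add_zero]
      | smul c' a _ ha =>
        intro c u
        rw [smul_eq_mul, ← mul_assoc]
        exact ha _ _
    have h2 : toEnd k (equivariantMapAlgebra ρA ρg) V
        (localLift ρA ρg 1 (α : A ⊗[k] g)) = 0 := by
      refine tensorIdeal_induction (P := fun β => toEnd k (equivariantMapAlgebra ρA ρg) V
        (localLift ρA ρg 1 β) = 0) ?_ (fun β β' hβ hβ' => ?_) (fun a ha u => ?_) hα
      · rw [map_zero, map_zero]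
      · rw [map_add, map_add, hβ, hβ', add_zero]
      · rw [← one_mul a]
        exact h1 a ha 1 u
    have h3 : localLift ρA ρg 1 (α : A ⊗[k] g) = (Fintype.card Γ : k) • α := by
      apply Subtype.ext
      rw [coe_localLift, one_smul, orbitSum_of_mem _ _ α.2]
      rfl
    rw [h3, map_smul] at h2
    exact (smul_eq_zero.mp h2).resolve_left (by simp [Fintype.card_ne_zero])

end Kernel

end Support

/-! ### Existence of evaluation presentations -/

section Existence

attribute [local instance 100] LieRing.ofAssociativeRing

open Module LieModule

/-- The radical of an ideal of finite codimension is an intersection of finitely many kernels of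
rational points. -/
theorem Ideal.exists_finset_points {k A : Type*} [Field k] [CommRing A] [Algebra k A] [IsAlgClosed k]
    [Algebra.FiniteType k A] (J : Ideal A) [Module.Finite k (A ⧸ J)] :
    ∃ (Y : Finset (A →ₐ[k] k)) (m : ℕ), (⨅ y ∈ Y, RingHom.ker y) ^ m ≤ J := by
  classical
  have : IsNoetherianRing A := Algebra.FiniteType.isNoetherianRing k A
  have : IsJacobsonRing A := isJacobsonRing_of_finiteType (A := k)
  -- The rational points of A/J, finite in number because A/J is finite-dimensional. By the
  -- Nullstellensatz they cut out the radical of J.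
  let Y : Finset (A →ₐ[k] k) :=
    (Finset.univ : Finset (A ⧸ J →ₐ[k] k)).image fun y => y.comp (Ideal.Quotient.mkₐ k J)
  refine ⟨Y, Ideal.exists_pow_le_of_le_radical_of_fg ?_ (IsNoetherian.noetherian _)⟩
  rw [Ideal.radical_eq_jacobson, Ideal.jacobson]
  refine le_sInf fun M hM => ?_
  obtain ⟨hJM, hM⟩ := hM
  obtain ⟨x, hx⟩ := Ideal.exists_point_of_ne_top (k := k) M hM.ne_top
  have hMx : M = RingHom.ker x := hM.eq_of_le (isMaximal_ker_point x).ne_top hx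
  have hxY : x ∈ Y := by
    refine Finset.mem_image.mpr ⟨Ideal.Quotient.liftₐ J x fun a ha => hx (hJM ha),
      Finset.mem_univ _, ?_⟩
    ext a
    rfl
  rw [hMx]
  exact (iInf_le _ x).trans (iInf_le _ hxY)

variable {k : Type u} {A : Type v} {g : Type w} {Γ : Type*} [Field k] [CommRing A] [Algebra k A]
  [LieRing g] [LieAlgebra k g] [Group Γ]
  {ρA : Γ →* (A ≃ₐ[k] A)} {ρg : Γ →* (g ≃ₗ⁅k⁆ g)}

section

variable {V : Type*} [AddCommGroup V] [Module k V] [LieRingModule (equivariantMapAlgebra ρA ρg) V]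
  [LieModule k (equivariantMapAlgebra ρA ρg) V]

/-- Descend one power at a time: brackets of maps with coefficients in Q^(m+1) have coefficients in
Q^(2m+2), inside Q^(m+2), which already acts by zero. So the ideal attached to Q^(m+1) has abelian
image. -/
theorem toEnd_eq_zero_of_tensorIdeal_pow [Module.Finite k V]
    [IsIrreducible k (equivariantMapAlgebra ρA ρg) V] [IsAlgClosed k] [CharZero k]
    [Module.Finite k g]
    (htr : ∀ α, LinearMap.trace k V (toEnd k (equivariantMapAlgebra ρA ρg) V α) = 0)
    (Q : Ideal A) (m : ℕ) (h : ∀ α : equivariantMapAlgebra ρA ρg,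
      (α : A ⊗[k] g) ∈ tensorIdeal k g (Q ^ (m + 1)) →
        toEnd k (equivariantMapAlgebra ρA ρg) V α = 0) (α : equivariantMapAlgebra ρA ρg)
    (hα : (α : A ⊗[k] g) ∈ tensorIdeal k g Q) :
    toEnd k (equivariantMapAlgebra ρA ρg) V α = 0 := by
  induction m with
  | zero => exact h α (by rwa [zero_add, pow_one])
  | succ m ih =>
    refine ih fun β hβ => ?_
    let K : LieIdeal k (equivariantMapAlgebra ρA ρg) :=
      { carrier := {κ | (κ : A ⊗[k] g) ∈ tensorIdeal k g (Q ^ (m + 1))}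
        add_mem' := fun ha hb => (tensorIdeal k g (Q ^ (m + 1))).add_mem ha hb
        zero_mem' := (tensorIdeal k g (Q ^ (m + 1))).zero_mem
        smul_mem' := fun c a ha => by
          change c • (a : A ⊗[k] g) ∈ tensorIdeal k g (Q ^ (m + 1))
          rw [← algebraMap_smul A c]
          exact Submodule.smul_mem _ _ ha
        lie_mem := fun {γ κ} hκ => lie_mem_tensorIdeal_right _ hκ }
    refine toEnd_eq_zero_of_abelian htr K (fun a ha b hb => h _ ?_) (a := β) hβ
    refine tensorIdeal_mono ?_ (lie_mem_tensorIdeal_mul ha hb)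
    rw [← pow_add]
    exact Ideal.pow_le_pow_right (by omega)

variable (V) in
/-- An irreducible representation only depends on the values at finitely many points. -/
theorem exists_finset_factorsThrough [Module.Finite k V]
    [IsIrreducible k (equivariantMapAlgebra ρA ρg) V] [IsAlgClosed k] [CharZero k]
    [Finite Γ] [Algebra.FiniteType k A] [Module.Finite k g] [LieAlgebra.IsKilling k g]
    (hfree : ActsFreely ρA) : ∃ Y : Finset (A →ₐ[k] k), FactorsThrough ρA ρg Y V := by
  have := Fintype.ofFinite Γ
  have htr := trace_toEnd_equivariant (ρg := ρg) (V := V) hfree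
  obtain ⟨J, hfin, hJ⟩ := exists_ideal_finite htr
  obtain ⟨Y, m, hY⟩ := Ideal.exists_finset_points (k := k) J
  refine ⟨Y, fun α hα n => ?_⟩
  have h := toEnd_eq_zero_of_tensorIdeal_pow htr (⨅ y ∈ Y, RingHom.ker y) m (fun β hβ => hJ β
    (tensorIdeal_mono ((Ideal.pow_le_pow_right (Nat.le_succ m)).trans hY) hβ)) α ?_
  · exact LinearMap.congr_fun h n
  · simp only [mem_tensorIdeal_iInf]
    exact fun y hy => evalAt_eq_zero_iff.mp (hα y hy)

omit [Module k V] [LieModule k (equivariantMapAlgebra ρA ρg) V] in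
-- The value of an equivariant map at γx is determined by its value at x.
theorem FactorsThrough.mono {Y s : Finset (A →ₐ[k] k)} (h : FactorsThrough ρA ρg Y V)
    (hs : ∀ y ∈ Y, ∃ x ∈ s, ∃ γ, pointAction ρA γ x = y) : FactorsThrough ρA ρg s V := by
  intro α hα n
  refine h α (fun y hy => ?_) n
  obtain ⟨x, hx, γ, rfl⟩ := hs y hy
  rw [evalAt_pointAction ρA ρg α.2, hα x hx, map_zero]

end

variable (ρA) in
theorem exists_orbit_representatives (Y : Finset (A →ₐ[k] k)) :
    ∃ s ∈ orbitSeparated ρA, ∀ y ∈ Y, ∃ x ∈ s, ∃ γ, pointAction ρA γ x = y := by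
  classical
  let S : Setoid (A →ₐ[k] k) :=
    { r := fun x y => ∃ γ, pointAction ρA γ x = y
      iseqv :=
        { refl := fun x => ⟨1, pointAction_one ρA x⟩
          symm := by
            rintro x _ ⟨γ, rfl⟩
            exact ⟨γ⁻¹, by rw [← pointAction_mul, inv_mul_cancel, pointAction_one]⟩
          trans := by
            rintro x _ _ ⟨γ, rfl⟩ ⟨δ, rfl⟩
            exact ⟨δ * γ, pointAction_mul ρA δ γ x⟩ } }
  refine ⟨(Y.image (Quotient.mk S)).image Quotient.out, ?_, fun y hy => ?_⟩
  · intro x hx y hy hxy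
    obtain ⟨p, -, rfl⟩ := Finset.mem_image.mp hx
    obtain ⟨q, -, rfl⟩ := Finset.mem_image.mp hy
    refine Set.disjoint_left.mpr ?_
    rintro _ ⟨γ, rfl⟩ ⟨δ, hδ⟩
    apply hxy
    have h1 : S p.out q.out := S.trans ⟨γ, rfl⟩ (S.symm ⟨δ, hδ⟩)
    have h2 : Quotient.mk S p.out = Quotient.mk S q.out := Quotient.sound h1
    rw [Quotient.out_eq, Quotient.out_eq] at h2
    rw [h2]
  · exact ⟨_, Finset.mem_image_of_mem _ (Finset.mem_image_of_mem _ hy), Quotient.mk_out (s := S) y⟩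

/-- An irreducible module depending only on values at `s` is an evaluation module. -/
theorem exists_isEvaluationTensor [IsAlgClosed k] [CharZero k]
    [Finite Γ] [Algebra.FiniteType k A] [Module.Finite k g] [LieAlgebra.IsKilling k g]
    (hfree : ActsFreely ρA) {s : Finset (A →ₐ[k] k)} (hs : s ∈ orbitSeparated ρA)
    {V : FDLieModule.{_, _, w'} k (equivariantMapAlgebra ρA ρg)}
    (hV : IsIrreducible k (equivariantMapAlgebra ρA ρg) V) (hN : FactorsThrough ρA ρg s V) :
    ∃ W : s → FDLieModule.{u, w, w'} k g, IsEvaluationTensor ρA ρg W V := by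
  classical
  have := Fintype.ofFinite Γ
  obtain ⟨e, he⟩ := exists_isLocalizer hfree hs
  have := nontrivial_of_isIrreducible k (equivariantMapAlgebra ρA ρg) V
  have hirr : ∀ Z : Submodule k V, (∀ x u, ∀ z ∈ Z, pointRep he hN x u z ∈ Z) → Z = ⊥ ∨ Z = ⊤ := by
    intro Z hZ
    let Z' : LieSubmodule k (equivariantMapAlgebra ρA ρg) V :=
      { Z with
        lie_mem := fun {α v} hv => by
          rw [lie_eq_sum_pointRep he hN]
          exact Submodule.sum_mem _ fun x _ => hZ x _ v hv }
    have h1 : Z'.toSubmodule = Z := rfl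
    rcases eq_bot_or_eq_top Z' with h | h
    · exact Or.inl (by rw [← h1, h]; rfl)
    · exact Or.inr (by rw [← h1, h]; rfl)
  obtain ⟨W, φ, hφ⟩ := exists_tensor_decomposition V (pointRep he hN)
    (fun x y hxy u v => LinearMap.ext fun n => pointRep_comm he hN hxy u v n) hirr
  refine ⟨W, φ, fun α v => ?_⟩
  rw [lie_eq_sum_pointRep he hN, map_sum, evaluationRep_apply, LinearMap.sum_apply]
  exact Finset.sum_congr rfl fun x _ => hφ x _ v

/-- A common set of points is obtained from orbit representatives of the union of the two supports.
-/
theorem exists_evaluation_presentations [IsAlgClosed k] [CharZero k]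
    [Finite Γ] [Algebra.FiniteType k A] [Module.Finite k g] [LieAlgebra.IsKilling k g]
    (hfree : ActsFreely ρA) {V V' : FDLieModule.{_, _, w'} k (equivariantMapAlgebra ρA ρg)}
    (hV : IsIrreducible k (equivariantMapAlgebra ρA ρg) V)
    (hV' : IsIrreducible k (equivariantMapAlgebra ρA ρg) V') :
    ∃ s ∈ orbitSeparated ρA, ∃ W W' : s → FDLieModule.{u, w, w'} k g,
      IsEvaluationTensor ρA ρg W V ∧ IsEvaluationTensor ρA ρg W' V' := by
  classical
  obtain ⟨Y, hY⟩ := exists_finset_factorsThrough (ρA := ρA) (ρg := ρg) V hfree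
  obtain ⟨Y', hY'⟩ := exists_finset_factorsThrough (ρA := ρA) (ρg := ρg) V' hfree
  obtain ⟨s, hs, h⟩ := exists_orbit_representatives ρA (Y ∪ Y')
  obtain ⟨W, hW⟩ := exists_isEvaluationTensor hfree hs hV
    (hY.mono fun y hy => h y (Finset.mem_union_left _ hy))
  obtain ⟨W', hW'⟩ := exists_isEvaluationTensor hfree hs hV'
    (hY'.mono fun y hy => h y (Finset.mem_union_right _ hy))
  exact ⟨s, hs, W, W', hW, hW'⟩

end Existence

/-! ### Multiloop actions -/

section Torus

variable {k : Type u} [Field k] {n : ℕ}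

theorem eval_monomial_ne_zero (x : LaurentRing k n →ₐ[k] k) (a : Fin n → ℤ) :
    x (AddMonoidAlgebra.single a 1) ≠ 0 := by
  intro h
  have h1 : x (AddMonoidAlgebra.single a 1 * AddMonoidAlgebra.single (-a) 1) = 1 := by
    rw [AddMonoidAlgebra.single_mul_single, add_neg_cancel, mul_one,
      ← AddMonoidAlgebra.one_def, map_one]
  rw [map_mul, h, zero_mul] at h1
  exact zero_ne_one h1

theorem eval_monomial_add (x : LaurentRing k n →ₐ[k] k) (a b : Fin n → ℤ) :
    x (AddMonoidAlgebra.single (a + b) 1) =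
      x (AddMonoidAlgebra.single a 1) * x (AddMonoidAlgebra.single b 1) := by
  rw [← map_mul, AddMonoidAlgebra.single_mul_single, mul_one]

theorem torusScale_single (t : Fin n → kˣ) (a : Fin n → ℤ) :
    torusScale k n t (AddMonoidAlgebra.single a 1) =
      ((∏ i, t i ^ a i : kˣ) : k) • AddMonoidAlgebra.single a 1 := by
  simp [torusScale]

theorem multiloopAction_inv_single (m : Fin n → ℕ) (ξ : Fin n → kˣ)
    (hξ : ∀ i, IsPrimitiveRoot (ξ i) (m i)) (γ : MultiloopGroup m) (a : Fin n → ℤ) :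
    multiloopAction m ξ hξ γ⁻¹ (AddMonoidAlgebra.single a 1) =
      ((∏ i, multiloopTorusHom m ξ hξ γ i ^ a i : kˣ) : k) • AddMonoidAlgebra.single a 1 := by
  rw [← torusScale_single]
  have : (multiloopTorusHom m ξ hξ)⁻¹ γ⁻¹ = multiloopTorusHom m ξ hξ γ := by
    rw [MonoidHom.inv_apply, map_inv, inv_inv]
  simp only [multiloopAction, MonoidHom.comp_apply, this]
  rfl

theorem multiloopTorusHom_injective (m : Fin n → ℕ) (ξ : Fin n → kˣ)
    (hξ : ∀ i, IsPrimitiveRoot (ξ i) (m i)) (γ : MultiloopGroup m)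
    (h : ∀ i, multiloopTorusHom m ξ hξ γ i = 1) : γ = 1 := by
  apply Multiplicative.toAdd.injective
  funext i
  have h0 := h i
  have hinj := (ZMod.lift_injective (m i)
    (f := ⟨zmultiplesHom (Additive kˣ) (Additive.ofMul (ξ i)), by
        rw [zmultiplesHom_apply, natCast_zsmul, ← ofMul_pow, (hξ i).pow_eq_one, ofMul_one]⟩)).2
    (fun j hj => by
      rw [ZMod.intCast_zmod_eq_zero_iff_dvd]
      exact ((hξ i).zpow_eq_one_iff_dvd j).1 hj)
  apply hinj
  rw [toAdd_one, Pi.zero_apply, map_zero]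
  exact h0

/-- An element fixing a point scales each coordinate there by a power of ξᵢ. Coordinates are nonzero
on the torus, so that power is 1, and primitivity applies. -/
theorem actsFreely_multiloopAction (m : Fin n → ℕ) (ξ : Fin n → kˣ)
    (hξ : ∀ i, IsPrimitiveRoot (ξ i) (m i)) : ActsFreely (multiloopAction m ξ hξ) := by
  intro γ x hx
  refine multiloopTorusHom_injective m ξ hξ γ fun i => ?_
  have h1 : x (multiloopAction m ξ hξ γ⁻¹ (AddMonoidAlgebra.single (Pi.single i 1) 1)) =
      x (AddMonoidAlgebra.single (Pi.single i 1) 1) := DFunLike.congr_fun hx _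
  rw [multiloopAction_inv_single, map_smul, smul_eq_mul,
    mul_eq_right₀ (eval_monomial_ne_zero x _), Units.val_eq_one,
    Finset.prod_eq_single i (fun j _ hj => by rw [Pi.single_eq_of_ne hj, zpow_zero])
      (fun hi => (hi (Finset.mem_univ i)).elim), Pi.single_eq_same, zpow_one] at h1
  exact h1

/-- The logarithmic differential `a ↦ z^{-a} d(z^a)` at a rational point of the torus. -/
noncomputable def logCotangent (x : LaurentRing k n →ₐ[k] k) :
    (Fin n → ℤ) →+ (RingHom.ker x).Cotangent :=
  AddMonoidHom.mk'
    (fun a => (x (AddMonoidAlgebra.single a 1))⁻¹ •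
      cotangentMap x (AddMonoidAlgebra.single a 1)) fun a b => by
    have ha := eval_monomial_ne_zero x a
    have hb := eval_monomial_ne_zero x b
    have h : (AddMonoidAlgebra.single (a + b) 1 : LaurentRing k n) =
        AddMonoidAlgebra.single a 1 * AddMonoidAlgebra.single b 1 := by
      rw [AddMonoidAlgebra.single_mul_single, mul_one]
    rw [h, cotangentMap_mul, map_mul, smul_add, smul_smul, smul_smul, add_comm]
    congr 2
    · field_simp
    · field_simp

/-- The homomorphism to the dual numbers given by a tangent vector with logarithmic
coordinates `c` at the point `x` of the torus. -/
noncomputable def torusTangent (x : LaurentRing k n →ₐ[k] k) (c : Fin n → k) :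
    LaurentRing k n →ₐ[k] TrivSqZeroExt k k :=
  AddMonoidAlgebra.lift k (TrivSqZeroExt k k) (Fin n → ℤ)
    { toFun := fun a => (x (AddMonoidAlgebra.single a.toAdd 1),
        x (AddMonoidAlgebra.single a.toAdd 1) * ∑ i, (a.toAdd i : k) * c i)
      map_one' := by
        ext
        · change x (AddMonoidAlgebra.single 0 1) = 1
          rw [← AddMonoidAlgebra.one_def, map_one]
        · change _ * ∑ i, (((0 : Fin n → ℤ) i : ℤ) : k) * c i = 0
          simp
      map_mul' := fun a b => by
        ext
        · exact eval_monomial_add x _ _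
        · change x (AddMonoidAlgebra.single (a.toAdd + b.toAdd) 1) *
            ∑ i, (((a.toAdd i + b.toAdd i : ℤ)) : k) * c i =
            x (AddMonoidAlgebra.single a.toAdd 1) *
              (x (AddMonoidAlgebra.single b.toAdd 1) * ∑ i, (b.toAdd i : k) * c i) +
            (x (AddMonoidAlgebra.single a.toAdd 1) * ∑ i, (a.toAdd i : k) * c i) *
              x (AddMonoidAlgebra.single b.toAdd 1)
          rw [eval_monomial_add]
          simp only [Int.cast_add, add_mul, Finset.sum_add_distrib]
          ring }

theorem torusTangent_single (x : LaurentRing k n →ₐ[k] k) (c : Fin n → k) (a : Fin n → ℤ) :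
    (torusTangent x c (AddMonoidAlgebra.single a 1)).snd =
      x (AddMonoidAlgebra.single a 1) * ∑ i, (a i : k) * c i := by
  rw [torusTangent, AddMonoidAlgebra.lift_single, one_smul]
  rfl

theorem fst_torusTangent (x : LaurentRing k n →ₐ[k] k) (c : Fin n → k) (f : LaurentRing k n) :
    (torusTangent x c f).fst = x f := by
  have : (TrivSqZeroExt.fstHom k k k).comp (torusTangent x c) = x := by
    refine AddMonoidAlgebra.algHom_ext (fun a => ?_) (by ext)
    change (torusTangent x c (AddMonoidAlgebra.single a 1)).fst = _
    rw [torusTangent, AddMonoidAlgebra.lift_single, one_smul]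
    rfl
  exact DFunLike.congr_fun this f

/-- The linear form on the cotangent space at `x` with logarithmic coordinates `c`. -/
noncomputable def torusCotangentForm (x : LaurentRing k n →ₐ[k] k) (c : Fin n → k) :
    Module.Dual k (RingHom.ker x).Cotangent :=
  Ideal.Cotangent.lift
    (((TrivSqZeroExt.sndHom k k).comp (torusTangent x c).toLinearMap).domRestrict
      ((RingHom.ker x).restrictScalars k)) fun f f' => by
    change (torusTangent x c ((f : LaurentRing k n) * f')).snd = 0
    rw [map_mul, TrivSqZeroExt.snd_mul, fst_torusTangent, fst_torusTangent,
      (RingHom.mem_ker).1 f.2, (RingHom.mem_ker).1 f'.2]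
    simp

theorem torusCotangentForm_cotangentMap (x : LaurentRing k n →ₐ[k] k) (c : Fin n → k)
    (f : LaurentRing k n) :
    torusCotangentForm x c (cotangentMap x f) = (torusTangent x c f).snd := by
  rw [cotangentMap_apply]
  change (torusTangent x c (f - algebraMap k (LaurentRing k n) (x f))).snd = _
  rw [map_sub, AlgHom.commutes, TrivSqZeroExt.snd_sub]
  simp [TrivSqZeroExt.algebraMap_eq_inl]

/-- The tangent space of the torus `(kˣ)ⁿ` at a rational point is `kⁿ`. -/
noncomputable def torusTangentEquiv (x : LaurentRing k n →ₐ[k] k) :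
    Module.Dual k (RingHom.ker x).Cotangent ≃ₗ[k] (Fin n → k) :=
  LinearEquiv.ofBijective
    (LinearMap.pi fun i => LinearMap.applyₗ (logCotangent x (Pi.single i 1))) <| by
    constructor
    · rw [← LinearMap.ker_eq_bot, LinearMap.ker_eq_bot']
      intro φ hφ
      -- Logarithmic differentials are additive in the exponent, so vanishing on the dzᵢ/zᵢ gives
      -- vanishing on all monomials, which span.
      have h0 : φ.toAddMonoidHom.comp (logCotangent x) = 0 := by
        refine AddMonoidHom.functions_ext' _ _ _ fun i => AddMonoidHom.ext_int ?_
        exact congrFun hφ i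
      have h1 : ∀ a, φ (cotangentMap x (AddMonoidAlgebra.single a 1)) = 0 := fun a => by
        have := DFunLike.congr_fun h0 a
        change φ ((x (AddMonoidAlgebra.single a 1))⁻¹ • _) = 0 at this
        rw [map_smul, smul_eq_zero, inv_eq_zero] at this
        exact this.resolve_left (eval_monomial_ne_zero x a)
      ext c
      obtain ⟨f, rfl⟩ := cotangentMap_surjective x c
      induction f using AddMonoidAlgebra.induction_on with
      | of a => exact h1 a
      | add f f' h h' => rw [map_add, map_add, map_add, h, h']
      | smul r f h => rw [map_smul, map_smul, map_smul, h]
    · intro c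
      refine ⟨torusCotangentForm x c, ?_⟩
      funext i
      change torusCotangentForm x c ((x (AddMonoidAlgebra.single (Pi.single i 1) 1))⁻¹ •
        cotangentMap x (AddMonoidAlgebra.single (Pi.single i 1) 1)) = c i
      rw [map_smul, torusCotangentForm_cotangentMap, torusTangent_single, smul_eq_mul,
        inv_mul_cancel_left₀ (eval_monomial_ne_zero x _), Finset.sum_eq_single i]
      · simp
      · intro j _ hj
        simp [Pi.single_eq_of_ne hj]
      · simp

end Torus

theorem proposition6p3 {k g : Type u} [Field k] [IsAlgClosed k] [CharZero k]
    [LieRing g] [LieAlgebra k g] [Module.Finite k g] [LieAlgebra.IsSemisimple k g] :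
    -- Finite abelian groups acting freely on an affine scheme of finite type.
    (∀ (A : Type u) [CommRing A] [Algebra k A] [Algebra.FiniteType k A]
        (Γ : Type v) [CommGroup Γ] [Finite Γ]
        (ρA : Γ →* (A ≃ₐ[k] A)) (ρg : Γ →* (g ≃ₗ⁅k⁆ g)), ActsFreely ρA →
      ∀ V V' : FDLieModule.{u, u, u} k (equivariantMapAlgebra ρA ρg),
        LieModule.IsIrreducible k (equivariantMapAlgebra ρA ρg) V →
        LieModule.IsIrreducible k (equivariantMapAlgebra ρA ρg) V' →
        (∃ s ∈ orbitSeparated ρA, ∃ W W' : s → FDLieModule.{u, u, u} k g,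
          IsEvaluationTensor ρA ρg W V ∧ IsEvaluationTensor ρA ρg W' V') ∧
        ∀ s ∈ orbitSeparated ρA, ∀ W W' : s → FDLieModule.{u, u, u} k g,
          IsEvaluationTensor ρA ρg W V → IsEvaluationTensor ρA ρg W' V' →
          ((∃ x y : s, x ≠ y ∧ IsEmpty (W x ≃ₗ⁅k, g⁆ W' x) ∧ IsEmpty (W y ≃ₗ⁅k, g⁆ W' y)) →
            Subsingleton (LieExtOne k (equivariantMapAlgebra ρA ρg) V V')) ∧
          (∀ x₀ : s, IsEmpty (W x₀ ≃ₗ⁅k, g⁆ W' x₀) →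
            (∀ x : s, x ≠ x₀ → Nonempty (W x ≃ₗ⁅k, g⁆ W' x)) →
            Nonempty (LieExtOne k (equivariantMapAlgebra ρA ρg) V V' ≃ₗ[k]
              (g →ₗ⁅k, g⁆ Module.Dual k (W x₀) ⊗[k] W' x₀) ⊗[k]
                Module.Dual k (RingHom.ker (x₀ : A →ₐ[k] k)).Cotangent)) ∧
          (Nonempty (V ≃ₗ⁅k, equivariantMapAlgebra ρA ρg⁆ V') →
            Nonempty (LieExtOne k (equivariantMapAlgebra ρA ρg) V V' ≃ₗ[k]
              ⨁ x : s, (g →ₗ⁅k, g⁆ Module.Dual k (W x) ⊗[k] W' x) ⊗[k]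
                Module.Dual k (RingHom.ker (x : A →ₐ[k] k)).Cotangent))) ∧
    -- Multiloop algebras.
    (∀ (n : ℕ) (m : Fin n → ℕ), (∀ i, 0 < m i) →
      ∀ (ξ : Fin n → kˣ) (hξ : ∀ i, IsPrimitiveRoot (ξ i) (m i))
        (ρg : MultiloopGroup m →* (g ≃ₗ⁅k⁆ g))
        (V V' : FDLieModule.{u, u, u} k (equivariantMapAlgebra (multiloopAction m ξ hξ) ρg)),
        LieModule.IsIrreducible k (equivariantMapAlgebra (multiloopAction m ξ hξ) ρg) V →
        LieModule.IsIrreducible k (equivariantMapAlgebra (multiloopAction m ξ hξ) ρg) V' →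
        (∃ s ∈ orbitSeparated (multiloopAction m ξ hξ),
          ∃ W W' : s → FDLieModule.{u, u, u} k g,
            IsEvaluationTensor (multiloopAction m ξ hξ) ρg W V ∧
            IsEvaluationTensor (multiloopAction m ξ hξ) ρg W' V') ∧
        ∀ s ∈ orbitSeparated (multiloopAction m ξ hξ),
          ∀ W W' : s → FDLieModule.{u, u, u} k g,
          IsEvaluationTensor (multiloopAction m ξ hξ) ρg W V →
          IsEvaluationTensor (multiloopAction m ξ hξ) ρg W' V' →
          ((∃ x y : s, x ≠ y ∧ IsEmpty (W x ≃ₗ⁅k, g⁆ W' x) ∧ IsEmpty (W y ≃ₗ⁅k, g⁆ W' y)) →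
            Subsingleton
              (LieExtOne k (equivariantMapAlgebra (multiloopAction m ξ hξ) ρg) V V')) ∧
          (∀ x₀ : s, IsEmpty (W x₀ ≃ₗ⁅k, g⁆ W' x₀) →
            (∀ x : s, x ≠ x₀ → Nonempty (W x ≃ₗ⁅k, g⁆ W' x)) →
            Nonempty (LieExtOne k (equivariantMapAlgebra (multiloopAction m ξ hξ) ρg) V V' ≃ₗ[k]
              (g →ₗ⁅k, g⁆ Module.Dual k (W x₀) ⊗[k] W' x₀) ⊗[k] (Fin n → k))) ∧
          (Nonempty (V ≃ₗ⁅k, equivariantMapAlgebra (multiloopAction m ξ hξ) ρg⁆ V') →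
            Nonempty (LieExtOne k (equivariantMapAlgebra (multiloopAction m ξ hξ) ρg) V V' ≃ₗ[k]
              ⨁ x : s, (g →ₗ⁅k, g⁆ Module.Dual k (W x) ⊗[k] W' x) ⊗[k] (Fin n → k)))) := by
  refine ⟨?_, ?_⟩
  · intro A _ _ _ Γ _ _ ρA ρg hfree V V' hV hV'
    refine ⟨exists_evaluation_presentations hfree hV hV', fun s hs W W' h h' => ⟨?_, ?_, ?_⟩⟩
    · rintro ⟨x, y, hxy, hx, hy⟩
      exact subsingleton_lieExtOne hfree hs h h' hV hV' hxy hx hy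
    · intro x₀ hx₀ hx
      exact nonempty_lieExtOne_equiv_of_isEmpty hfree hs h h' hV hV' hx₀ hx
    · intro hVV'
      exact nonempty_lieExtOne_equiv_of_equiv hfree hs h h' hV hV' hVV'
  · intro n m hm ξ hξ ρg V V' hV hV'
    -- Makes each `ZMod (m i)`, and hence the group, finite.
    have : ∀ i, NeZero (m i) := fun i => ⟨(hm i).ne'⟩
    have hfree := actsFreely_multiloopAction m ξ hξ
    refine ⟨exists_evaluation_presentations hfree hV hV', fun s hs W W' h h' => ⟨?_, ?_, ?_⟩⟩
    · rintro ⟨x, y, hxy, hx, hy⟩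
      exact subsingleton_lieExtOne hfree hs h h' hV hV' hxy hx hy
    · intro x₀ hx₀ hx
      obtain ⟨e⟩ := nonempty_lieExtOne_equiv_of_isEmpty hfree hs h h' hV hV' hx₀ hx
      exact ⟨e.trans (TensorProduct.congr (LinearEquiv.refl k _) (torusTangentEquiv x₀.1))⟩
    · intro hVV'
      obtain ⟨e⟩ := nonempty_lieExtOne_equiv_of_equiv hfree hs h h' hV hV' hVV'
      exact ⟨e.trans (DFinsupp.mapRange.linearEquiv fun x : s =>
        TensorProduct.congr (LinearEquiv.refl k _) (torusTangentEquiv x.1))⟩
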